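/- For positive integers $n,k$ let $\nu(n,k)$ denote the unique positive zero of $$f_{n,k}(x)=x\log k+x-\left(x+\tfrac12\right)\log x-(x-1)\log n,\qquad x>0,$$ where $\log$ is the natural logarithm. Let $m=m(n)$ be a sequence of nonnegative integers such that $m(n)\le n/2+O(n^{2/3})$ as $n\to\infty$, that is, there is a constant $C$ such that $m(n)\le n/2+Cn^{2/3}$ for all sufficiently large $n$, and such that $m(n)\ge1$ for all sufficiently large $n$. Let $P=P(n,m)$ be a graph chosen uniformly at random from the class of all simple planar graphs on vertex set $\{1,\dots,n\}$ with exactly $m$ edges (which is nonempty for all sufficiently large $n$), let $\Delta(P)$ be its maximum degree, and say that an event holds whp if its probability tends to $1$ as $n\to\infty$. Then for every fixed $\varepsilon>0$, whp $$\lfloor \nu(n,2m)-\varepsilon\rfloor\le\Delta(P)\le\lfloor\nu(n,2m)+\varepsilon\rfloor .$$ In particular, whp $\Delta(P)\in\{D,D+1\}$, where $D=D(n)=\lfloor\nu(n,2m)-1/3\rfloor$. -/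

import Mathlib

namespace RandomPlanar

open Filter Topology

/-- The Euclidean plane. -/
abbrev Plane : Type := EuclideanSpace ℝ (Fin 2)

/-- `A` is a simple arc (an injective continuous image of `[0,1]`) with end points `p` and `q`. -/
def IsArcBetween (A : Set Plane) (p q : Plane) : Prop :=
  ∃ γ : unitInterval → Plane, Continuous γ ∧ Function.Injective γ ∧
    γ 0 = p ∧ γ 1 = q ∧ Set.range γ = A

/-- `pt` and `arc` draw the graph `G` in the plane without crossings: vertices go to distinct
points, every edge to a simple arc joining the images of its two ends and containing no other
vertex, and two distinct edges meet only in the images of common end vertices. The values of `arc`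
outside the edge set of `G` are irrelevant. -/
structure IsPlaneDrawing {V : Type*} (G : SimpleGraph V) (pt : V → Plane)
    (arc : Sym2 V → Set Plane) : Prop where
  pt_injective : Function.Injective pt
  isArc : ∀ u v : V, G.Adj u v → IsArcBetween (arc s(u, v)) (pt u) (pt v)
  vertex_mem : ∀ e ∈ G.edgeSet, ∀ w : V, pt w ∈ arc e → w ∈ e
  edges_meet : ∀ e ∈ G.edgeSet, ∀ f ∈ G.edgeSet, e ≠ f →
    arc e ∩ arc f ⊆ pt '' {v | v ∈ e ∧ v ∈ f}

/-- A graph is planar if it has a crossing-free drawing in the plane. -/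
def IsPlanar {V : Type*} (G : SimpleGraph V) : Prop :=
  ∃ (pt : V → Plane) (arc : Sym2 V → Set Plane), IsPlaneDrawing G pt arc

/-- The class of planar graphs on `n` labelled vertices with exactly `m` edges. -/
def planarClass (n m : ℕ) : Set (SimpleGraph (Fin n)) :=
  {G | IsPlanar G ∧ G.edgeSet.ncard = m}

/-- The maximum degree of a graph on `n` labelled vertices. -/
noncomputable def maxDeg {n : ℕ} (G : SimpleGraph (Fin n)) : ℕ :=
  open Classical in G.maxDegree

/-- The probability that a uniformly random element of the finite nonempty set `S` lies in `E`. -/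
noncomputable def uniformProb {α : Type*} (S E : Set α) : ℝ :=
  ((S ∩ E).ncard : ℝ) / (S.ncard : ℝ)

/-- For `P(n,m)` a uniformly random planar graph on `n` labelled vertices with `m = m(n)` edges:
with high probability, that is with probability tending to `1` as `n → ∞`,
the property `Q n` holds for `P(n,m)`. -/
def WhpPlanar (m : ℕ → ℕ) (Q : (n : ℕ) → SimpleGraph (Fin n) → Prop) : Prop :=
  Tendsto (fun n => uniformProb (planarClass n (m n)) {G | Q n G}) atTop (𝓝 1)

/-- The function `f_{n,k}(x) = x log k + x - (x + 1/2) log x - (x - 1) log n`. -/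
noncomputable def nuFun (n k : ℕ) (x : ℝ) : ℝ :=
  x * Real.log k + x - (x + 1 / 2) * Real.log x - (x - 1) * Real.log n

theorem nuFun_pos {n k : ℕ} {x : ℝ} (h0 : 0 < x) (h1 : x ≤ 1) : 0 < nuFun n k x := by
  have hk : 0 ≤ Real.log k := Real.log_natCast_nonneg k
  have hn : 0 ≤ Real.log n := Real.log_natCast_nonneg n
  have hx : Real.log x ≤ 0 := Real.log_nonpos h0.le h1
  have e1 : 0 ≤ x * Real.log k := mul_nonneg h0.le hk
  have e2 : (x + 1 / 2) * Real.log x ≤ 0 := mul_nonpos_of_nonneg_of_nonpos (by linarith) hx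
  have e3 : (x - 1) * Real.log n ≤ 0 := mul_nonpos_of_nonpos_of_nonneg (by linarith) hn
  unfold nuFun
  linarith

theorem nuFun_cross {n k : ℕ} {x y : ℝ} (hx : 1 ≤ x) (hxy : x < y) :
    0 < y * nuFun n k x - x * nuFun n k y := by
  have hn : 0 ≤ Real.log n := Real.log_natCast_nonneg n
  have hx0 : 0 < x := by linarith
  have hy0 : 0 < y := by linarith
  have hl : Real.log x ≤ x - 1 := Real.log_le_sub_one_of_pos hx0
  have hL : Real.log x - Real.log y ≤ x / y - 1 := by
    rw [← Real.log_div hx0.ne' hy0.ne']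
    exact Real.log_le_sub_one_of_pos (div_pos hx0 hy0)
  have hL' : y - x ≤ y * (Real.log y - Real.log x) := by
    have := mul_le_mul_of_nonneg_left hL hy0.le
    have h2 : y * (x / y - 1) = x - y := by field_simp
    linarith
  have hL0 : 0 ≤ Real.log y - Real.log x := sub_nonneg.2 (Real.log_le_log hx0 hxy.le)
  have a1 : x * (y - x) ≤ x * (y * (Real.log y - Real.log x)) :=
    mul_le_mul_of_nonneg_left hL' hx0.le
  have a2 : 0 ≤ x * (Real.log y - Real.log x) := mul_nonneg hx0.le hL0
  have a3 : (y - x) * Real.log x ≤ (y - x) * (x - 1) :=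
    mul_le_mul_of_nonneg_left hl (by linarith)
  have a4 : 0 ≤ (y - x) * Real.log n := mul_nonneg (by linarith) hn
  have a5 : 0 < x * (y - x) := mul_pos hx0 (by linarith)
  unfold nuFun
  nlinarith

/-- For positive `n` and `k` the function `f_{n,k}` has a unique positive zero. -/
theorem existsUnique_nu {n k : ℕ} (_hn : 0 < n) (hk : 0 < k) :
    ∃! x : ℝ, 0 < x ∧ nuFun n k x = 0 := by
  have hk1 : (1 : ℝ) ≤ k := by exact_mod_cast hk
  have hnl : 0 ≤ Real.log n := Real.log_natCast_nonneg n
  have hX : (1 : ℝ) ≤ k * Real.exp 2 := by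
    have : (1 : ℝ) ≤ Real.exp 2 := Real.one_le_exp (by norm_num)
    nlinarith
  have hfX : nuFun n k (k * Real.exp 2) ≤ 0 := by
    have hlog : Real.log (k * Real.exp 2) = Real.log k + 2 := by
      rw [Real.log_mul (by positivity) (Real.exp_pos 2).ne', Real.log_exp]
    have hkl : 0 ≤ Real.log k := Real.log_natCast_nonneg k
    have := mul_nonneg (sub_nonneg.2 hX) hnl
    unfold nuFun
    rw [hlog]
    nlinarith
  have hc : ContinuousOn (nuFun n k) (Set.Icc 1 (k * Real.exp 2)) := by
    unfold nuFun
    have : ContinuousOn Real.log (Set.Icc (1 : ℝ) (k * Real.exp 2)) :=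
      Real.continuousOn_log.mono fun x hx => by
        have := hx.1
        simp only [Set.mem_compl_iff, Set.mem_singleton_iff]
        linarith
    fun_prop
  obtain ⟨x, hx, hx0⟩ := intermediate_value_Icc' hX hc
    ⟨hfX, (nuFun_pos one_pos le_rfl).le⟩
  have gt_one : ∀ z : ℝ, 0 < z → nuFun n k z = 0 → 1 ≤ z := fun z hz h => by
    by_contra hlt
    exact (nuFun_pos (n := n) (k := k) hz (not_le.1 hlt).le).ne' h
  refine ⟨x, ⟨by linarith [hx.1], hx0⟩, ?_⟩
  rintro y ⟨hy, hy0⟩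
  have hy1 := gt_one y hy hy0
  rcases lt_trichotomy y x with h | h | h
  · have := nuFun_cross (n := n) (k := k) hy1 h
    simp [hx0, hy0] at this
  · exact h
  · have := nuFun_cross (n := n) (k := k) hx.1 h
    simp [hx0, hy0] at this

open Classical in
/-- `nu n k` is the unique positive zero of `f_{n,k}` for `n, k ≥ 1`
(with the irrelevant value `0` if `n = 0` or `k = 0`). -/
noncomputable def nu (n k : ℕ) : ℝ :=
  if h : 0 < n ∧ 0 < k then (existsUnique_nu h.1 h.2).choose else 0

end RandomPlanar

/-! A uniform planar graph with `m` edges is the uniform graph G(n,m) conditioned on planarity. For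
`m ≤ n/2 + O(n^{2/3})`, that is, up to the critical window, G(n,m) is planar with probability
bounded away from 0. A property that fails in G(n,m) with vanishing probability therefore also fails
with vanishing probability after conditioning (`whpPlanar_of_unif`), and it remains to prove two
facts about G(n,m).

Planarity (`eventually_le_unif_isOuterplanar`). Outerplanarity, encoded as a non-crossing vertex
order, is a convenient sufficient condition. A graph with no path having two chords at its ends has
no component with two independent cycles and is outerplanar. Put `h = n^{-1/3}`. At density `(1 -
2h)/n` a first moment count excludes such paths with probability at least 3/4. The density is then
raised to `(1 + l h)/n` one edge at a time. An added edge can destroy outerplanarity only if its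
ends are already connected, and by Harris' inequality this is negatively correlated with
outerplanarity. The total loss is governed by the sum of all connection probabilities, hence by the
expected component size, which a supermartingale for the exploration process bounds by `O(n^{1/3})`
(`ex_card_reach_critical`). The product of the loss factors stays above a positive constant
(`pr_isOuterplanar_ge`). Monotonicity in the number of edges and Chebyshev's inequality carry this
over to G(n,m).

Maximum degree (`eventually_unif_maxDeg`). By Stirling, `exp (nuFun n (2 * m) d)` is, up to constant
factors, the relevant estimate for the expected number of vertices of degree at least `d` near the
threshold, so `nu` marks where this number passes 1. Near `nu` the function is steep, so moving by
`ε` makes the estimate tend to 0 or to infinity. The first moment gives the upper bound for the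
degree; the second moment, computed in the binomial model, gives the lower one. -/

namespace RandomPlanar

open Filter Topology

/-! ### Products of Bernoulli measures on a finite power set -/

section Bernoulli

variable {E : Type*} [Fintype E] [DecidableEq E]

/-- The weight of `S` when every `e` is put into a random set independently with
probability `p e`. -/
def bern (p : E → ℝ) (S : Finset E) : ℝ := ∏ e, if e ∈ S then p e else 1 - p e

/-- The expectation of `f` under the product Bernoulli measure. -/
def ex (p : E → ℝ) (f : Finset E → ℝ) : ℝ := ∑ S, bern p S * f S

open Classical in
/-- The probability of `Q` under the product Bernoulli measure. -/
noncomputable def pr (p : E → ℝ) (Q : Finset E → Prop) : ℝ := ex p fun S => if Q S then 1 else 0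

theorem pr_eq_ex (p : E → ℝ) (Q : Finset E → Prop) [DecidablePred Q] :
    pr p Q = ex p fun S => if Q S then 1 else 0 := by
  unfold pr
  congr!

/-- All values of `p` are probabilities. -/
def IsProb (p : E → ℝ) : Prop := ∀ e, 0 ≤ p e ∧ p e ≤ 1

variable {p q : E → ℝ}

theorem bern_nonneg (hp : IsProb p) (S : Finset E) : 0 ≤ bern p S :=
  Finset.prod_nonneg fun e _ => by have := hp e; split_ifs <;> linarith

theorem ex_add (f g : Finset E → ℝ) : ex p (fun S => f S + g S) = ex p f + ex p g := by
  simp [ex, mul_add, Finset.sum_add_distrib]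

theorem ex_sub (f g : Finset E → ℝ) : ex p (fun S => f S - g S) = ex p f - ex p g := by
  simp [ex, mul_sub, Finset.sum_sub_distrib]

theorem ex_const_mul (c : ℝ) (f : Finset E → ℝ) : ex p (fun S => c * f S) = c * ex p f := by
  simp only [ex, Finset.mul_sum]
  exact Finset.sum_congr rfl fun S _ => by ring

theorem ex_sum {ι : Type*} (s : Finset ι) (f : ι → Finset E → ℝ) :
    ex p (fun S => ∑ i ∈ s, f i S) = ∑ i ∈ s, ex p (f i) := by
  simp only [ex, Finset.mul_sum]
  exact Finset.sum_comm

theorem ex_le_ex (hp : IsProb p) {f g : Finset E → ℝ} (h : ∀ S, f S ≤ g S) : ex p f ≤ ex p g :=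
  Finset.sum_le_sum fun S _ => mul_le_mul_of_nonneg_left (h S) (bern_nonneg hp S)

theorem ex_nonneg (hp : IsProb p) {f : Finset E → ℝ} (h : ∀ S, 0 ≤ f S) : 0 ≤ ex p f :=
  Finset.sum_nonneg fun S _ => mul_nonneg (bern_nonneg hp S) (h S)

/-- Conditioning on a single coordinate. -/
theorem ex_split (p : E → ℝ) (e : E) (f : Finset E → ℝ) :
    ex p f = p e * ex p (fun S => f (insert e S)) + (1 - p e) * ex p (fun S => f (S.erase e)) := by
  have hu : (Finset.univ : Finset (Finset E)) = (insert e (Finset.univ.erase e)).powerset := by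
    rw [Finset.insert_erase (Finset.mem_univ e), Finset.powerset_univ]
  have key : ∀ g : Finset E → ℝ, ex p g = ∑ S ∈ (Finset.univ.erase e).powerset,
      (∏ x ∈ Finset.univ.erase e, if x ∈ S then p x else 1 - p x) *
        ((1 - p e) * g S + p e * g (insert e S)) := by
    intro g
    unfold ex
    rw [hu, Finset.sum_powerset_insert (Finset.notMem_erase e _), ← Finset.sum_add_distrib]
    refine Finset.sum_congr rfl fun S hS => ?_
    have he : e ∉ S := fun h => by
      have := Finset.mem_powerset.1 hS h
      simp at this
    have h1 : bern p S = (1 - p e) *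
        ∏ x ∈ Finset.univ.erase e, if x ∈ S then p x else 1 - p x := by
      unfold bern
      rw [← Finset.mul_prod_erase _ _ (Finset.mem_univ e), if_neg he]
    have h2 : bern p (insert e S) = p e *
        ∏ x ∈ Finset.univ.erase e, if x ∈ S then p x else 1 - p x := by
      unfold bern
      rw [← Finset.mul_prod_erase _ _ (Finset.mem_univ e), if_pos (Finset.mem_insert_self e S)]
      congr 1
      refine Finset.prod_congr rfl fun x hx => ?_
      simp [(Finset.mem_erase.1 hx).1]
    rw [h1, h2]
    ring
  rw [key f, key fun S => f (insert e S), key fun S => f (S.erase e), Finset.mul_sum,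
    Finset.mul_sum, ← Finset.sum_add_distrib]
  refine Finset.sum_congr rfl fun S hS => ?_
  have he : e ∉ S := fun h => by
    have := Finset.mem_powerset.1 hS h
    simp at this
  rw [Finset.insert_idem, Finset.erase_eq_of_notMem he, Finset.erase_insert he]
  ring

theorem ex_one (p : E → ℝ) : ex p (fun _ => 1) = 1 := by
  have h := (Finset.prod_add p (fun e => 1 - p e) Finset.univ).symm
  simp only [add_sub_cancel, Finset.prod_const_one, Finset.powerset_univ] at h
  refine Eq.trans ?_ h
  unfold ex bern
  refine Finset.sum_congr rfl fun S _ => ?_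
  rw [mul_one, Finset.prod_ite]
  congr 1
  · exact Finset.prod_congr (by ext; simp) fun _ _ => rfl
  · exact Finset.prod_congr (by ext; simp) fun _ _ => rfl

theorem ex_const (p : E → ℝ) (c : ℝ) : ex p (fun _ => c) = c := by
  have := ex_const_mul (p := p) c fun _ => 1
  rw [ex_one] at this
  simpa using this

/-- The weight of `W ⊆ T` under the product measure restricted to `T`. -/
def bernOn (p : E → ℝ) (T W : Finset E) : ℝ := (∏ e ∈ W, p e) * ∏ e ∈ T \ W, (1 - p e)

omit [Fintype E] in
theorem bernOn_nonneg (hp : IsProb p) (T W : Finset E) : 0 ≤ bernOn p T W :=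
  mul_nonneg (Finset.prod_nonneg fun e _ => (hp e).1)
    (Finset.prod_nonneg fun e _ => sub_nonneg.2 (hp e).2)

/-- Conditioning on a set of coordinates. -/
theorem ex_split_on (p : E → ℝ) (T : Finset E) (f : Finset E → ℝ) :
    ex p f = ∑ W ∈ T.powerset, bernOn p T W * ex p (fun S => f (S \ T ∪ W)) := by
  induction T using Finset.induction_on with
  | empty => simp [bernOn]
  | insert e T he ih =>
    rw [ih, Finset.sum_powerset_insert he, ← Finset.sum_add_distrib]
    refine Finset.sum_congr rfl fun W hW => ?_
    have hWT := Finset.mem_powerset.1 hW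
    have heW : e ∉ W := fun h => he (hWT h)
    have h1 : bernOn p (insert e T) W = (1 - p e) * bernOn p T W := by
      unfold bernOn
      rw [Finset.insert_sdiff_of_notMem _ heW,
        Finset.prod_insert (fun h => he (Finset.mem_sdiff.1 h).1)]
      ring
    have h2 : bernOn p (insert e T) (insert e W) = p e * bernOn p T W := by
      unfold bernOn
      rw [Finset.prod_insert heW, Finset.insert_sdiff_insert, Finset.sdiff_insert_of_notMem he]
      ring
    rw [h1, h2, ex_split p e]
    have e1 : (fun S : Finset E => f (insert e S \ T ∪ W)) =
        fun S => f (S \ insert e T ∪ insert e W) := by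
      funext S
      congr 1
      ext x
      simp only [Finset.mem_union, Finset.mem_sdiff, Finset.mem_insert]
      by_cases hx : x = e
      · simp [hx, he]
      · simp [hx]
    have e2 : (fun S : Finset E => f (S.erase e \ T ∪ W)) =
        fun S => f (S \ insert e T ∪ W) := by
      funext S
      congr 1
      ext x
      simp only [Finset.mem_union, Finset.mem_sdiff, Finset.mem_insert, Finset.mem_erase]
      tauto
    rw [e1, e2]
    ring

theorem sum_bernOn (p : E → ℝ) (T : Finset E) : ∑ W ∈ T.powerset, bernOn p T W = 1 := by
  have := ex_split_on p T fun _ => 1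
  simpa [ex_one] using this.symm

/-- The law of the restriction to `T`. -/
theorem ex_eq_sum_bernOn (p : E → ℝ) (T : Finset E) {f : Finset E → ℝ}
    (hf : ∀ S, f S = f (S ∩ T)) : ex p f = ∑ W ∈ T.powerset, bernOn p T W * f W := by
  rw [ex_split_on p T]
  refine Finset.sum_congr rfl fun W hW => ?_
  have : (fun S => f (S \ T ∪ W)) = fun _ => f W := by
    funext S
    rw [hf]
    congr 1
    have := Finset.mem_powerset.1 hW
    ext x
    have := @this x
    simp only [Finset.mem_inter, Finset.mem_union, Finset.mem_sdiff]
    tauto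
  rw [this, ex_const]

/-- Functions of disjoint sets of coordinates are independent. -/
theorem ex_mul_of_disjoint (p : E → ℝ) (T : Finset E) {f g : Finset E → ℝ}
    (hf : ∀ S, f S = f (S ∩ T)) (hg : ∀ S, g S = g (S \ T)) :
    ex p (fun S => f S * g S) = ex p f * ex p g := by
  rw [ex_split_on p T, ex_eq_sum_bernOn p T hf, Finset.sum_mul]
  refine Finset.sum_congr rfl fun W hW => ?_
  have hWT := Finset.mem_powerset.1 hW
  have : (fun S => f (S \ T ∪ W) * g (S \ T ∪ W)) = fun S => f W * g S := by
    funext S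
    rw [hf (S \ T ∪ W), hg (S \ T ∪ W), hg S]
    congr 2
    · ext x
      have := @hWT x
      simp only [Finset.mem_inter, Finset.mem_union, Finset.mem_sdiff]
      tauto
    · ext x
      have := @hWT x
      simp only [Finset.mem_union, Finset.mem_sdiff]
      tauto
  rw [this, ex_const_mul, mul_assoc]

/-- The expectation of a function not depending on `e` does not depend on `p e`. -/
theorem ex_congr_of_erase {e : E} (hpq : ∀ x, x ≠ e → p x = q x) {f : Finset E → ℝ}
    (hf : ∀ S, f S = f (S.erase e)) : ex p f = ex q f := by
  have hf' : ∀ S, f S = f (S ∩ Finset.univ.erase e) := fun S => by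
    rw [hf S, hf (S ∩ _)]
    congr 1
    ext x
    simp [and_comm]
  rw [ex_eq_sum_bernOn p _ hf', ex_eq_sum_bernOn q _ hf']
  refine Finset.sum_congr rfl fun W hW => ?_
  have hW' := Finset.mem_powerset.1 hW
  congr 1
  unfold bernOn
  congr 1
  · exact Finset.prod_congr rfl fun x hx => hpq x (Finset.mem_erase.1 (hW' hx)).1
  · refine Finset.prod_congr rfl fun x hx => ?_
    rw [hpq x (Finset.mem_erase.1 (Finset.mem_sdiff.1 hx).1).1]

/-- This is the lattice condition behind both the Harris and the Holley inequality. It holds factor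
by factor; the only case that is not an equality is `e ∈ a \ b`, where it reads `p (1 - q) ≤ (1 - p)
q`. -/
theorem bern_mul_le (hp : IsProb p) (hq : IsProb q) (h : ∀ e, p e ≤ q e) (a b : Finset E) :
    bern p a * bern q b ≤ bern p (a ⊓ b) * bern q (a ⊔ b) := by
  unfold bern
  rw [← Finset.prod_mul_distrib, ← Finset.prod_mul_distrib]
  refine Finset.prod_le_prod (fun e _ => ?_) fun e _ => ?_
  · have := hp e; have := hq e
    refine mul_nonneg ?_ ?_ <;> split_ifs <;> linarith
  · have h1 := hp e; have h2 := hq e; have := h e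
    by_cases ha : e ∈ a <;> by_cases hb : e ∈ b <;> simp [ha, hb]
    nlinarith

/-- The Harris inequality. -/
theorem harris (hp : IsProb p) {f g : Finset E → ℝ} (hf0 : 0 ≤ f) (hg0 : 0 ≤ g)
    (hf : Monotone f) (hg : Monotone g) : ex p f * ex p g ≤ ex p (fun S => f S * g S) := by
  have := fkg (μ := bern p) (f := f) (g := g) (bern_nonneg hp) hf0 hg0 hf hg
    (bern_mul_le hp hp fun _ => le_rfl)
  have h1 : ∑ S, bern p S = 1 := by simpa [ex] using ex_one p
  rwa [h1, one_mul] at this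

/-- The expectation of a monotone function is monotone in the probabilities. -/
theorem ex_mono_prob (hp : IsProb p) (hq : IsProb q) (h : ∀ e, p e ≤ q e) {f : Finset E → ℝ}
    (hf0 : 0 ≤ f) (hf : Monotone f) : ex p f ≤ ex q f := by
  have := holley (μ := f) (f := bern p) (g := bern q) hf0 (bern_nonneg hp) (bern_nonneg hq) hf
    (by have h1 := ex_one p; have h2 := ex_one q; simp only [ex, mul_one] at h1 h2; rw [h1, h2])
    (bern_mul_le hp hq h)
  simpa [ex, mul_comm] using this

section pr

variable {P Q : Finset E → Prop}

theorem pr_nonneg (hp : IsProb p) (Q : Finset E → Prop) : 0 ≤ pr p Q :=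
  ex_nonneg hp fun S => by split_ifs <;> norm_num

theorem pr_mono (hp : IsProb p) (h : ∀ S, P S → Q S) : pr p P ≤ pr p Q :=
  ex_le_ex hp fun S => by
    have := h S
    split_ifs <;> first | tauto | norm_num

theorem pr_not (p : E → ℝ) (Q : Finset E → Prop) : pr p (fun S => ¬ Q S) = 1 - pr p Q := by
  unfold pr
  rw [← congrArg (· - ex p _) (ex_one p), ← ex_sub]
  congr 1
  funext S
  by_cases h : Q S <;> simp [h]

theorem pr_le_one (hp : IsProb p) (Q : Finset E → Prop) : pr p Q ≤ 1 := by
  have := pr_nonneg hp fun S => ¬ Q S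
  rw [pr_not] at this
  linarith

theorem pr_or_le (hp : IsProb p) : pr p (fun S => P S ∨ Q S) ≤ pr p P + pr p Q := by
  unfold pr
  rw [← ex_add]
  refine ex_le_ex hp fun S => ?_
  by_cases h1 : P S <;> by_cases h2 : Q S <;> simp [h1, h2]

/-- The union bound. -/
theorem pr_exists_le (hp : IsProb p) {ι : Type*} (s : Finset ι) (R : ι → Finset E → Prop) :
    pr p (fun S => ∃ i ∈ s, R i S) ≤ ∑ i ∈ s, pr p (R i) := by
  classical
  unfold pr
  rw [← ex_sum]
  refine ex_le_ex hp fun S => ?_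
  have h0 : ∀ i ∈ s, (0 : ℝ) ≤ if R i S then 1 else 0 := fun i _ => by split_ifs <;> norm_num
  split_ifs with h
  · obtain ⟨i, hi, hR⟩ := h
    calc (1 : ℝ) = if R i S then 1 else 0 := by simp [hR]
      _ ≤ _ := Finset.single_le_sum h0 hi
  · exact Finset.sum_nonneg h0

/-- Markov's inequality. -/
theorem pr_le_of_le (hp : IsProb p) {f : Finset E → ℝ} {c : ℝ} (hc : 0 < c) (hf : ∀ S, 0 ≤ f S)
    (h : ∀ S, Q S → c ≤ f S) : pr p Q ≤ ex p f / c := by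
  rw [le_div_iff₀' hc]
  unfold pr
  rw [← ex_const_mul]
  refine ex_le_ex hp fun S => ?_
  have h1 := h S
  have h2 := hf S
  by_cases hQ : Q S
  · simpa [hQ] using h1 hQ
  · simpa [hQ] using h2

theorem pr_subset (p : E → ℝ) (T : Finset E) : pr p (fun S => T ⊆ S) = ∏ e ∈ T, p e := by
  rw [pr_eq_ex, ex_eq_sum_bernOn p T fun S => by simp [Finset.subset_inter_iff], Finset.sum_eq_single T]
  · simp [bernOn]
  · intro W hW hne
    have : ¬ T ⊆ W := fun h => hne (Finset.Subset.antisymm (Finset.mem_powerset.1 hW) h)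
    simp [this]
  · simp

end pr

/-- Under a constant density the weight depends only on the cardinality. -/
theorem bern_const (c : ℝ) (S : Finset E) :
    bern (fun _ => c) S = c ^ S.card * (1 - c) ^ (Fintype.card E - S.card) := by
  unfold bern
  rw [Finset.prod_ite, Finset.prod_const, Finset.prod_const]
  congr 2
  · congr 1; ext; simp
  · rw [← Finset.card_compl]; congr 1; ext; simp

omit [Fintype E] in
theorem bernOn_const (c : ℝ) {T W : Finset E} (h : W ⊆ T) :
    bernOn (fun _ => c) T W = c ^ W.card * (1 - c) ^ (T.card - W.card) := by
  unfold bernOn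
  rw [Finset.prod_const, Finset.prod_const, Finset.card_sdiff_of_subset h]

theorem ex_card (c : ℝ) : ex (fun _ : E => c) (fun S => (S.card : ℝ)) = Fintype.card E * c := by
  have h1 : (fun S : Finset E => (S.card : ℝ)) =
      fun S => ∑ e : E, if ({e} : Finset E) ⊆ S then 1 else 0 := by
    funext S; simp
  have h2 : ∀ e : E, ex (fun _ : E => c) (fun S => if ({e} : Finset E) ⊆ S then 1 else 0) = c := by
    intro e
    have := pr_subset (fun _ : E => c) {e}
    rw [pr_eq_ex] at this
    simpa using this
  rw [h1, ex_sum]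
  simp only [h2]
  simp

theorem ex_card_sq (c : ℝ) : ex (fun _ : E => c) (fun S => (S.card : ℝ) ^ 2) =
    Fintype.card E * c + Fintype.card E * (Fintype.card E - 1) * c ^ 2 := by
  have h1 : (fun S : Finset E => (S.card : ℝ) ^ 2) =
      fun S => ∑ e : E, ∑ f : E, if ({e, f} : Finset E) ⊆ S then 1 else 0 := by
    funext S
    have : (S.card : ℝ) = ∑ e : E, if e ∈ S then 1 else 0 := by simp
    rw [this, sq, Finset.sum_mul_sum]
    refine Finset.sum_congr rfl fun e _ => Finset.sum_congr rfl fun f _ => ?_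
    by_cases he : e ∈ S <;> by_cases hf : f ∈ S <;> simp [he, hf, Finset.insert_subset_iff]
  have h2 : ∀ e f : E, ex (fun _ : E => c)
      (fun S => if ({e, f} : Finset E) ⊆ S then 1 else 0) = if e = f then c else c ^ 2 := by
    intro e f
    have := pr_subset (fun _ : E => c) {e, f}
    rw [pr_eq_ex] at this
    split_ifs with h
    · subst h; simpa using this
    · rw [Finset.prod_const, Finset.card_pair h] at this; exact_mod_cast this
  rw [h1, ex_sum]
  simp_rw [ex_sum, h2]
  have h3 : ∀ e : E, ∑ f : E, (if e = f then c else c ^ 2) =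
      c + (Fintype.card E - 1) * c ^ 2 := by
    intro e
    have : ∀ f : E, (if e = f then c else c ^ 2) = c ^ 2 + if e = f then c - c ^ 2 else 0 := by
      intro f; split_ifs <;> ring
    simp_rw [this, Finset.sum_add_distrib]
    simp
    ring
  simp_rw [h3]
  simp
  ring

/-- Chebyshev's inequality for the number of elements. -/
theorem pr_card_far_le {c t : ℝ} (h0 : 0 ≤ c) (h1 : c ≤ 1) (ht : 0 < t) :
    pr (fun _ : E => c) (fun S => t ≤ |(S.card : ℝ) - Fintype.card E * c|) ≤
      Fintype.card E * c / t ^ 2 := by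
  have hp : IsProb fun _ : E => c := fun _ => ⟨h0, h1⟩
  refine (pr_le_of_le hp (f := fun S => ((S.card : ℝ) - Fintype.card E * c) ^ 2)
    (pow_pos ht 2) (fun S => sq_nonneg _) fun S h => ?_).trans ?_
  · rw [← sq_abs ((S.card : ℝ) - _)]
    exact pow_le_pow_left₀ ht.le h 2
  · have : (fun S : Finset E => ((S.card : ℝ) - Fintype.card E * c) ^ 2) =
        fun S => (S.card : ℝ) ^ 2 - (2 * (Fintype.card E * c) * S.card -
          (Fintype.card E * c) ^ 2) := by
      funext S; ring
    rw [this, ex_sub, ex_sub, ex_const_mul, ex_const, ex_card, ex_card_sq]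
    gcongr
    nlinarith [mul_nonneg (Nat.cast_nonneg (α := ℝ) (Fintype.card E)) (sq_nonneg c)]

end Bernoulli

/-! ### Graphs with a non-crossing vertex order -/

section Noncrossing

variable {V : Type*}

/-- The edges `ab` and `cd` never interleave in the order given by `φ`. -/
def IsNoncrossing (G : SimpleGraph V) (φ : V → ℤ) : Prop :=
  Function.Injective φ ∧ ∀ a b c d, G.Adj a b → G.Adj c d → φ a < φ c → φ c < φ b → ¬ φ b < φ d

/-- Outerplanarity, in the form of a non-crossing order of the vertices. -/
def IsOuterplanar (G : SimpleGraph V) : Prop := ∃ φ, IsNoncrossing G φ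

theorem IsOuterplanar.mono {G H : SimpleGraph V} (h : G ≤ H) (hH : IsOuterplanar H) :
    IsOuterplanar G :=
  let ⟨φ, h1, h2⟩ := hH
  ⟨φ, h1, fun a b c d hab hcd => h2 a b c d (h hab) (h hcd)⟩

/-- Points of the plane on the parabola `y = x²`. -/
noncomputable def parabola (x : ℝ) : Plane := !₂[x, x ^ 2]

/-- The height above the parabola along a chord is a product that depends only on the abscissa. Two
chords thus meet exactly where their products agree, which reduces crossings to the real inequality
`chord_meet`. -/
theorem segment_parabola {a b : ℝ} {P : Plane} (h : P ∈ segment ℝ (parabola a) (parabola b)) :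
    P 1 - P 0 ^ 2 = (P 0 - a) * (b - P 0) ∧ P 0 ∈ Set.uIcc a b := by
  obtain ⟨s, t, hs, ht, hst, rfl⟩ := h
  have e0 : (s • parabola a + t • parabola b) 0 = s * a + t * b := by simp [parabola]
  have e1 : (s • parabola a + t • parabola b) 1 = s * a ^ 2 + t * b ^ 2 := by simp [parabola]
  obtain rfl : s = 1 - t := by linarith
  refine ⟨by rw [e0, e1]; ring, ?_⟩
  rw [e0, ← segment_eq_uIcc]
  exact ⟨1 - t, t, hs, ht, hst, by simp⟩

theorem plane_ext {P Q : Plane} (h0 : P 0 = Q 0) (h1 : P 1 = Q 1) : P = Q := by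
  ext i
  fin_cases i
  · exact h0
  · exact h1

theorem isArcBetween_segment {P Q : Plane} (h : P ≠ Q) : IsArcBetween (segment ℝ P Q) P Q := by
  refine ⟨fun t => AffineMap.lineMap P Q (t : ℝ), ?_, ?_, by simp, by simp, ?_⟩
  · exact AffineMap.lineMap_continuous.comp continuous_subtype_val
  · intro s t hst
    exact Subtype.ext (AffineMap.lineMap_injective ℝ h hst)
  · rw [segment_eq_image_lineMap]
    ext x
    simp [unitInterval]

/-- Two chords of the parabola whose ends do not interleave meet only in common ends. -/
theorem chord_meet {a b c d x : ℝ} (hcd : c < d) (hne : ¬ (a = c ∧ b = d))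
    (h1 : ¬ (a < c ∧ c < b ∧ b < d)) (h2 : ¬ (c < a ∧ a < d ∧ d < b))
    (hx1 : a ≤ x) (hx2 : x ≤ b) (hx3 : c ≤ x) (hx4 : x ≤ d)
    (he : (x - a) * (b - x) = (x - c) * (d - x)) : (x = a ∨ x = b) ∧ (x = c ∨ x = d) := by
  by_cases h0 : (x - a) * (b - x) = 0
  · rw [h0] at he
    constructor
    · rcases mul_eq_zero.1 h0 with h | h
      · left; linarith
      · right; linarith
    · rcases mul_eq_zero.1 he.symm with h | h
      · left; linarith
      · right; linarith
  exfalso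
  have ha : 0 < x - a := lt_of_le_of_ne (by linarith) fun h => h0 (by rw [← h]; ring)
  have hb : 0 < b - x := lt_of_le_of_ne (by linarith) fun h => h0 (by rw [← h]; ring)
  have hc : 0 < x - c := lt_of_le_of_ne (by linarith) fun h => h0 (by rw [he, ← h]; ring)
  have hd : 0 < d - x := lt_of_le_of_ne (by linarith) fun h => h0 (by rw [he, ← h]; ring)
  -- At an interior meeting point the intervals overlap, so without interleaving they are nested.
  -- The outer interval then has the strictly larger product, unless a shared end forces the two
  -- chords to coincide.
  rcases lt_trichotomy a c with h | h | h
  · have : d ≤ b := not_lt.1 fun h' => h1 ⟨h, by linarith, h'⟩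
    nlinarith
  · subst h
    have : b = d := by
      have := mul_left_cancel₀ ha.ne' he
      linarith
    exact hne ⟨rfl, this⟩
  · have : b ≤ d := not_lt.1 fun h' => h2 ⟨h, by linarith, h'⟩
    nlinarith

/-- Outerplanar graphs are planar: draw them with straight edges between points of a parabola. -/
theorem IsOuterplanar.isPlanar {G : SimpleGraph V} (hG : IsOuterplanar G) : IsPlanar G := by
  obtain ⟨φ, hinj, hφ⟩ := hG
  set pt : V → Plane := fun v => parabola (φ v) with hpt
  have hpt0 : ∀ v, pt v 0 = φ v := fun v => by simp [hpt, parabola]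
  have hpt1 : ∀ v, pt v 1 = (φ v : ℝ) ^ 2 := fun v => by simp [hpt, parabola]
  have hpti : Function.Injective pt := fun u v h => by
    have : pt u 0 = pt v 0 := by rw [h]
    rw [hpt0, hpt0] at this
    exact hinj (Int.cast_injective (α := ℝ) this)
  -- A convex hull is symmetric in the two ends, so the segment is defined on unordered pairs.
  set arc : Sym2 V → Set Plane := fun e => convexHull ℝ (pt '' {v | v ∈ e}) with harc
  have harc' : ∀ u v, arc s(u, v) = segment ℝ (pt u) (pt v) := fun u v => by
    have : {w | w ∈ s(u, v)} = {u, v} := by ext; simp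
    rw [harc]
    simp only [this, Set.image_pair, convexHull_pair]
  -- an edge with its ends in increasing order
  have hord : ∀ e ∈ G.edgeSet, ∃ u v, G.Adj u v ∧ φ u < φ v ∧ e = s(u, v) := by
    intro e
    induction e with | h u v => ?_
    intro he
    rw [SimpleGraph.mem_edgeSet] at he
    rcases lt_trichotomy (φ u) (φ v) with h | h | h
    · exact ⟨u, v, he, h, rfl⟩
    · exact absurd (hinj h) he.ne
    · exact ⟨v, u, he.symm, h, Sym2.eq_swap⟩
  have hmem : ∀ u v P, φ u < φ v → P ∈ segment ℝ (pt u) (pt v) →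
      P 1 - P 0 ^ 2 = (P 0 - φ u) * (φ v - P 0) ∧ (φ u : ℝ) ≤ P 0 ∧ P 0 ≤ φ v := by
    intro u v P huv hP
    have h := segment_parabola hP
    have : (φ u : ℝ) ≤ φ v := by exact_mod_cast huv.le
    rw [Set.uIcc_of_le this] at h
    exact ⟨h.1, h.2.1, h.2.2⟩
  refine ⟨pt, arc, hpti, fun u v huv => ?_, fun e he w hw => ?_, fun e he f hf hef P hP => ?_⟩
  · rw [harc']
    exact isArcBetween_segment (hpti.ne huv.ne)
  · obtain ⟨u, v, huv, hlt, rfl⟩ := hord e he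
    rw [harc'] at hw
    have h := (hmem u v _ hlt hw).1
    rw [hpt0, hpt1, sub_self, eq_comm, mul_eq_zero] at h
    rcases h with h | h
    · have : w = u := hinj (Int.cast_injective (α := ℝ) (sub_eq_zero.1 h))
      simp [this]
    · have : w = v := hinj (Int.cast_injective (α := ℝ) ((sub_eq_zero.1 h)).symm)
      simp [this]
  · obtain ⟨a, b, hab, habl, rfl⟩ := hord e he
    obtain ⟨c, d, hcd, hcdl, rfl⟩ := hord f hf
    obtain ⟨hP1, hP2⟩ := hP
    rw [harc'] at hP1 hP2
    obtain ⟨e1, e2, e3⟩ := hmem a b P habl hP1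
    obtain ⟨f1, f2, f3⟩ := hmem c d P hcdl hP2
    have hx := chord_meet (a := φ a) (b := φ b) (c := φ c) (d := φ d)
      (by exact_mod_cast hcdl)
      (by
        rintro ⟨h1, h2⟩
        apply hef
        rw [hinj (Int.cast_injective (α := ℝ) h1), hinj (Int.cast_injective (α := ℝ) h2)])
      (by
        rintro ⟨h1, h2, h3⟩
        exact hφ a b c d hab hcd (by exact_mod_cast h1) (by exact_mod_cast h2)
          (by exact_mod_cast h3))
      (by
        rintro ⟨h1, h2, h3⟩
        exact hφ c d a b hcd hab (by exact_mod_cast h1) (by exact_mod_cast h2)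
          (by exact_mod_cast h3))
      e2 e3 f2 f3 (by rw [← e1, ← f1])
    have key : ∀ w, P 0 = φ w → (w = a ∨ w = b) → P = pt w := by
      intro w hw hwab
      refine plane_ext (by rw [hw, hpt0]) ?_
      rw [hpt1, ← hw]
      have : P 1 - P 0 ^ 2 = 0 := by
        rw [e1]
        rcases hwab with rfl | rfl <;> rw [hw] <;> ring
      linarith
    obtain ⟨w, hw, hwab⟩ : ∃ w, P 0 = φ w ∧ (w = a ∨ w = b) := by
      rcases hx.1 with h | h
      exacts [⟨a, h, Or.inl rfl⟩, ⟨b, h, Or.inr rfl⟩]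
    have hwcd : w = c ∨ w = d := by
      rcases hx.2 with h | h
      · exact Or.inl (hinj (Int.cast_injective (α := ℝ) (hw.symm.trans h)))
      · exact Or.inr (hinj (Int.cast_injective (α := ℝ) (hw.symm.trans h)))
    exact ⟨w, by simp [hwab, hwcd], (key w hw hwab).symm⟩

theorem exists_abs_lt [Finite V] (φ : V → ℤ) : ∃ M : ℤ, ∀ v, -M < φ v ∧ φ v < M := by
  obtain ⟨a, ha⟩ := (Set.finite_range φ).bddAbove
  obtain ⟨b, hb⟩ := (Set.finite_range φ).bddBelow
  refine ⟨max a (-b) + 1, fun v => ?_⟩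
  have h1 : φ v ≤ a := ha ⟨v, rfl⟩
  have h2 : b ≤ φ v := hb ⟨v, rfl⟩
  omega

/-- Joining two components by an edge preserves outerplanarity. -/
theorem IsOuterplanar.of_bridge [Finite V] {G H : SimpleGraph V} (hG : IsOuterplanar G) {x y : V}
    (hxy : ¬ G.Reachable x y) (hH : ∀ a b, H.Adj a b → G.Adj a b ∨ s(a, b) = s(x, y)) :
    IsOuterplanar H := by
  classical
  obtain ⟨φ, hinj, hφ⟩ := hG
  obtain ⟨M, hM⟩ := exists_abs_lt φ
  set C : V → Prop := fun v => G.Reachable x v with hC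
  have hCadj : ∀ a b, G.Adj a b → (C a ↔ C b) := fun a b h =>
    ⟨fun h1 => h1.trans h.reachable, fun h1 => h1.trans h.symm.reachable⟩
  -- Rotate the order on the component of `x` so that `x` comes last, at 0, and rotate the order on
  -- all other vertices so that `y` comes first, at 1. The shifts by `4 * M` perform the rotation.
  -- The two blocks are separated, and `x`, `y` are consecutive, so the new edge crosses nothing.
  set ψ : V → ℤ := fun v =>
    if C v then (if φ v ≤ φ x then φ v - φ x else φ v - φ x - 4 * M)
    else (if φ y ≤ φ v then φ v - φ y + 1 else φ v - φ y + 1 + 4 * M) with hψ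
  have hψ1 : ∀ v, C v → (φ v ≤ φ x ∧ ψ v = φ v - φ x ∨ φ x < φ v ∧ ψ v = φ v - φ x - 4 * M) := by
    intro v hv
    by_cases h : φ v ≤ φ x
    · left; simp [hψ, hv, h]
    · right; simp [hψ, hv, h]; omega
  have hψ2 : ∀ v, ¬ C v →
      (φ y ≤ φ v ∧ ψ v = φ v - φ y + 1 ∨ φ v < φ y ∧ ψ v = φ v - φ y + 1 + 4 * M) := by
    intro v hv
    by_cases h : φ y ≤ φ v
    · left; simp [hψ, hv, h]
    · right; simp [hψ, hv, h]; omega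
  have hCx : C x := SimpleGraph.Reachable.refl x
  have hCy : ¬ C y := hxy
  refine ⟨ψ, fun u v huv => hinj ?_, ?_⟩
  · have := hM u; have := hM v; have := hM x; have := hM y
    by_cases hu : C u <;> by_cases hv : C v
    · have := hψ1 u hu; have := hψ1 v hv; omega
    · have := hψ1 u hu; have := hψ2 v hv; omega
    · have := hψ2 u hu; have := hψ1 v hv; omega
    · have := hψ2 u hu; have := hψ2 v hv; omega
  have main : ∀ a b c d, G.Adj a b → G.Adj c d → ψ a < ψ c → ψ c < ψ b → ¬ ψ b < ψ d := by
    intro a b c d hab hcd h1 h2 h3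
    -- Interleaving of two chords is invariant under cyclic rotation; these are the four rotated
    -- forms of the forbidden pattern.
    have k1 := hφ a b c d hab hcd
    have k2 := hφ c d b a hcd hab.symm
    have k3 := hφ b a d c hab.symm hcd.symm
    have k4 := hφ d c a b hcd.symm hab
    have := hM a; have := hM b; have := hM c; have := hM d; have := hM x; have := hM y
    by_cases ha : C a <;> by_cases hc : C c
    · have := hψ1 a ha; have := hψ1 b ((hCadj a b hab).1 ha)
      have := hψ1 c hc; have := hψ1 d ((hCadj c d hcd).1 hc)
      omega
    · have := hψ1 a ha; have := hψ1 b ((hCadj a b hab).1 ha)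
      have := hψ2 c hc; omega
    · have := hψ2 a ha; have := hψ1 c hc; have := hψ1 d ((hCadj c d hcd).1 hc)
      have := hψ2 b (fun h => ha ((hCadj a b hab).2 h))
      omega
    · have := hψ2 a ha; have := hψ2 c hc
      have := hψ2 b (fun h => ha ((hCadj a b hab).2 h))
      have := hψ2 d (fun h => hc ((hCadj c d hcd).2 h))
      omega
  have hx0 : ψ x = 0 := by have := hψ1 x hCx; omega
  have hy1 : ψ y = 1 := by have := hψ2 y hCy; omega
  have hle : ∀ v, C v → ψ v ≤ 0 := fun v hv => by
    have := hψ1 v hv; have := hM v; have := hM x; omega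
  have hge : ∀ v, ¬ C v → 1 ≤ ψ v := fun v hv => by
    have := hψ2 v hv; have := hM v; have := hM y; omega
  intro a b c d hab hcd h1 h2 h3
  rcases hH a b hab with hab' | hab' <;> rcases hH c d hcd with hcd' | hcd'
  · exact main a b c d hab' hcd' h1 h2 h3
  · rw [Sym2.eq_iff] at hcd'
    rcases hcd' with ⟨rfl, rfl⟩ | ⟨rfl, rfl⟩ <;> omega
  · rw [Sym2.eq_iff] at hab'
    rcases hab' with ⟨rfl, rfl⟩ | ⟨rfl, rfl⟩ <;> omega
  · rw [Sym2.eq_iff] at hcd' hab'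
    rcases hab' with ⟨rfl, rfl⟩ | ⟨rfl, rfl⟩ <;> rcases hcd' with ⟨rfl, rfl⟩ | ⟨rfl, rfl⟩ <;> omega

end Noncrossing

/-! ### Graphs without two independent cycles in a component -/

section TwoChord

variable {V : Type*}

/-- `v 0, …, v k` is a path of `G`. -/
def IsVPath (G : SimpleGraph V) (k : ℕ) (v : ℕ → V) : Prop :=
  Set.InjOn v (Set.Iic k) ∧ ∀ t < k, G.Adj (v t) (v (t + 1))

/-- A path in `G` with two further edges, each joining an end of the path to the path. -/
def IsTwoChord (G : SimpleGraph V) (k i j : ℕ) (v : ℕ → V) : Prop :=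
  -- The inequalities keep both chords off the edges of the path, and the implication excludes that
  -- both chords are the one edge `v 0 v k`. So there are `k + 2` edges on `k + 1` vertices.
  IsVPath G k v ∧ 2 ≤ i ∧ i ≤ k ∧ j + 2 ≤ k ∧ (i = k → j ≠ 0) ∧
    G.Adj (v 0) (v i) ∧ G.Adj (v k) (v j)

/-- `G` contains a path with two chords at its ends. -/
def HasTwoChord (G : SimpleGraph V) : Prop := ∃ k i j v, IsTwoChord G k i j v

theorem IsVPath.mono {G H : SimpleGraph V} (h : G ≤ H) {k : ℕ} {v : ℕ → V} (hv : IsVPath G k v) :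
    IsVPath H k v := ⟨hv.1, fun t ht => h (hv.2 t ht)⟩

theorem HasTwoChord.mono {G H : SimpleGraph V} (h : G ≤ H) (hG : HasTwoChord G) :
    HasTwoChord H := by
  obtain ⟨k, i, j, v, h1, h2, h3, h4, h5, h6, h7⟩ := hG
  exact ⟨k, i, j, v, h1.mono h, h2, h3, h4, h5, h h6, h h7⟩

theorem IsVPath.reverse {G : SimpleGraph V} {k : ℕ} {v : ℕ → V} (hv : IsVPath G k v) :
    IsVPath G k fun t => v (k - t) := by
  refine ⟨fun s hs t ht h => ?_, fun t ht => ?_⟩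
  · have := hv.1 (show k - s ≤ k by omega) (show k - t ≤ k by omega) h
    simp only [Set.mem_Iic] at hs ht
    omega
  · have := hv.2 (k - (t + 1)) (by omega)
    rw [show k - (t + 1) + 1 = k - t by omega] at this
    exact this.symm

theorem IsVPath.cons {G : SimpleGraph V} {k : ℕ} {v : ℕ → V} (hv : IsVPath G k v) {w : V}
    (hw : ∀ t ≤ k, v t ≠ w) (h : G.Adj w (v 0)) :
    IsVPath G (k + 1) fun t => if t = 0 then w else v (t - 1) := by
  refine ⟨fun s hs t ht hst => ?_, fun t ht => ?_⟩
  · simp only [Set.mem_Iic] at hs ht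
    rcases Nat.eq_zero_or_pos s with rfl | hs0 <;> rcases Nat.eq_zero_or_pos t with rfl | ht0
    · rfl
    · simp only [if_pos, if_neg ht0.ne'] at hst
      exact absurd hst.symm (hw _ (by omega))
    · simp only [if_pos, if_neg hs0.ne'] at hst
      exact absurd hst (hw _ (by omega))
    · simp only [if_neg hs0.ne', if_neg ht0.ne'] at hst
      have := hv.1 (show s - 1 ≤ k by omega) (show t - 1 ≤ k by omega) hst
      omega
  · rcases Nat.eq_zero_or_pos t with rfl | ht0
    · simpa using h
    · simp only [if_neg ht0.ne', if_neg (Nat.succ_ne_zero t)]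
      have := hv.2 (t - 1) (by omega)
      rwa [show t - 1 + 1 = t + 1 - 1 by omega] at this

/-- The index at distance `t` after `i` on a cycle with `k + 1` vertices. -/
def rotIdx (k i t : ℕ) : ℕ := if i + t ≤ k then i + t else i + t - (k + 1)

theorem IsVPath.rotate {G : SimpleGraph V} {k i : ℕ} {v : ℕ → V} (hv : IsVPath G k v)
    (hc : G.Adj (v k) (v 0)) (hi : i ≤ k) : IsVPath G k fun t => v (rotIdx k i t) := by
  refine ⟨fun s hs t ht h => ?_, fun t ht => ?_⟩
  · simp only [Set.mem_Iic] at hs ht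
    have := hv.1 (show rotIdx k i s ≤ k by unfold rotIdx; split_ifs <;> omega)
      (show rotIdx k i t ≤ k by unfold rotIdx; split_ifs <;> omega) h
    unfold rotIdx at this
    split_ifs at this <;> omega
  · rcases lt_trichotomy (i + t) k with h | h | h
    · have := hv.2 (i + t) h
      simp only [rotIdx, if_pos h.le, if_pos (show i + (t + 1) ≤ k by omega)]
      exact this
    · simp only [rotIdx, if_pos h.le, if_neg (show ¬ i + (t + 1) ≤ k by omega)]
      rw [h, show i + (t + 1) - (k + 1) = 0 by omega]
      exact hc
    · have := hv.2 (i + t - (k + 1)) (by omega)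
      simp only [rotIdx, if_neg (show ¬ i + t ≤ k by omega),
        if_neg (show ¬ i + (t + 1) ≤ k by omega)]
      rwa [show i + t - (k + 1) + 1 = i + (t + 1) - (k + 1) by omega] at this

theorem IsVPath.lt_card [Fintype V] {G : SimpleGraph V} {k : ℕ} {v : ℕ → V}
    (hv : IsVPath G k v) : k + 1 ≤ Fintype.card V := by
  have h : Function.Injective fun t : Fin (k + 1) => v t := fun s t hst => by
    have := hv.1 (show (s : ℕ) ≤ k by omega) (show (t : ℕ) ≤ k by omega) hst
    exact Fin.ext this
  simpa using Fintype.card_le_of_injective _ h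

/-- A longest path with closing edge and no second chord carries a whole component. -/
theorem adj_of_longest {G : SimpleGraph V} (hG : ¬ HasTwoChord G) {k : ℕ} {v : ℕ → V}
    (hv : IsVPath G k v) (hmax : ∀ v', ¬ IsVPath G (k + 1) v') (hk : 2 ≤ k)
    (hc : G.Adj (v k) (v 0)) {i : ℕ} (hi : i ≤ k) {w : V} (hw : G.Adj (v i) w) :
    ∃ i' ≤ k, w = v i' ∧ (i' = i + 1 ∨ i = i' + 1 ∨ (i = 0 ∧ i' = k) ∨ (i = k ∧ i' = 0)) := by
  -- The path closes to a cycle, so it may be restarted at `v i`. A neighbour of `v i` off the cycle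
  -- could be put in front, contradicting maximality.
  have hr := hv.rotate hc hi
  have h0 : rotIdx k i 0 = i := by simp [rotIdx, hi]
  obtain ⟨s, hs, hsw⟩ : ∃ s ≤ k, v (rotIdx k i s) = w := by
    by_contra! h
    exact hmax _ (hr.cons h (by rw [h0]; exact hw.symm))
  have hs0 : s ≠ 0 := by
    rintro rfl
    rw [h0] at hsw
    exact hw.ne hsw
  refine ⟨rotIdx k i s, by unfold rotIdx; split_ifs <;> omega, hsw.symm, ?_⟩
  -- A neighbour that is not adjacent along the cycle gives a chord, and the closing edge of the
  -- rotated path is the second one.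
  by_cases hs1 : 2 ≤ s ∧ s < k
  · refine absurd ⟨k, s, 0, _, hr, hs1.1, hs, by omega, by omega, ?_, ?_⟩ hG
    · rw [h0, hsw]; exact hw
    · rw [h0]
      rcases Nat.eq_zero_or_pos i with rfl | hi0
      · simpa [rotIdx] using hc
      · have := hv.2 (i - 1) (by omega)
        rw [show i - 1 + 1 = i by omega] at this
        simp only [rotIdx, if_neg (show ¬ i + k ≤ k by omega)]
        rwa [show i + k - (k + 1) = i - 1 by omega]
  · unfold rotIdx
    split_ifs <;> omega

/-- Since `xy` is not a bridge, a walk from `x` to `y` avoiding it must leave `x` by another edge.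
-/
theorem exists_second_neighbor {G : SimpleGraph V}
    (hb : ∀ x y, G.Adj x y → (G.deleteEdges {s(x, y)}).Reachable x y) {x y : V}
    (h : G.Adj x y) : ∃ z, z ≠ y ∧ G.Adj x z := by
  by_contra! hz
  obtain ⟨p⟩ := hb x y h
  cases p with
  | nil => exact h.ne rfl
  | cons h1 p =>
    rw [SimpleGraph.deleteEdges_adj] at h1
    rename_i z
    by_cases hzy : z = y
    · subst hzy; simp at h1
    · exact hz z hzy h1.1

/-- A longest path in a graph without bridges, if there are no two chords, closes to a cycle. -/
theorem closing_of_longest {G : SimpleGraph V} (hG : ¬ HasTwoChord G)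
    (hb : ∀ x y, G.Adj x y → (G.deleteEdges {s(x, y)}).Reachable x y) {k : ℕ} {v : ℕ → V}
    (hv : IsVPath G k v) (hmax : ∀ v', ¬ IsVPath G (k + 1) v') (hk : 1 ≤ k) :
    2 ≤ k ∧ G.Adj (v k) (v 0) := by
  have key : ∀ v', IsVPath G k v' → ∃ i, 2 ≤ i ∧ i ≤ k ∧ G.Adj (v' 0) (v' i) := by
    intro v' hv'
    obtain ⟨z, hz1, hz⟩ := exists_second_neighbor hb (hv'.2 0 (by omega))
    obtain ⟨s, hs, hsz⟩ : ∃ s ≤ k, v' s = z := by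
      by_contra! h
      exact hmax _ (hv'.cons h hz.symm)
    refine ⟨s, ?_, hs, by rwa [hsz]⟩
    rcases s with _ | _ | s
    · exact absurd hsz hz.ne
    · exact absurd hsz.symm hz1
    · omega
  obtain ⟨i, hi2, hik, hi⟩ := key v hv
  obtain ⟨j, hj2, hjk, hj⟩ := key _ hv.reverse
  refine ⟨by omega, ?_⟩
  -- By maximality each end of the path has a second neighbour on the path. Either the two edges
  -- found this way are both `v 0 v k`, or they are two distinct chords.
  by_cases h : i = k ∧ k - j = 0
  · rw [h.1] at hi
    exact hi.symm
  · exact absurd ⟨k, i, k - j, v, hv, hi2, hik, by omega, by omega, hi, hj⟩ hG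

/-- If no component contains two cycles, the graph is outerplanar. -/
theorem isOuterplanar_of_not_hasTwoChord [Fintype V] {G : SimpleGraph V}
    (hG : ¬ HasTwoChord G) : IsOuterplanar G := by
  classical
  induction hN : G.edgeSet.ncard using Nat.strong_induction_on generalizing G with
  | _ N ih => ?_
  subst hN
  by_cases hE : ∃ x y, G.Adj x y
  swap
  · push Not at hE
    obtain ⟨e⟩ := Fintype.truncEquivFin V
    exact ⟨fun a => (e a : ℕ), fun a b h => e.injective (Fin.ext (Nat.cast_injective (R := ℤ) h)),
      fun a b _ _ h => absurd h (hE a b)⟩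
  -- If there is a bridge, delete it, use induction and restore it by `of_bridge`. Otherwise a
  -- longest path closes to a cycle that is a whole component.
  by_cases hb : ∀ x y, G.Adj x y → (G.deleteEdges {s(x, y)}).Reachable x y
  swap
  · push Not at hb
    obtain ⟨x, y, hxy, hr⟩ := hb
    have hlt : G.deleteEdges {s(x, y)} ≤ G := SimpleGraph.deleteEdges_le _
    refine (ih _ ?_ (fun h => hG (h.mono hlt)) rfl).of_bridge hr fun a b hab => ?_
    · refine Set.ncard_lt_ncard ?_ (Set.toFinite _)
      rw [SimpleGraph.edgeSet_deleteEdges]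
      refine ⟨Set.sdiff_subset, fun h => ?_⟩
      exact (h ((SimpleGraph.mem_edgeSet G).2 hxy)).2 rfl
    · rw [SimpleGraph.deleteEdges_adj, Set.mem_singleton_iff]
      tauto
  obtain ⟨x, y, hxy⟩ := hE
  -- a longest path
  have hex : ∃ k, 1 ≤ k ∧ (∃ v, IsVPath G k v) ∧ ∀ v', ¬ IsVPath G (k + 1) v' := by
    have h1 : ∃ v, IsVPath G 1 v := by
      refine ⟨fun t => if t = 0 then x else y, fun s hs t ht h => ?_, fun t ht => ?_⟩
      · simp only [Set.mem_Iic] at hs ht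
        have := hxy.ne
        have := hxy.ne'
        interval_cases s <;> interval_cases t <;> simp_all
      · obtain rfl : t = 0 := by omega
        simpa using hxy
    by_contra! hno
    have : ∀ k, 1 ≤ k → ∃ v, IsVPath G k v := by
      intro k hk
      induction k, hk using Nat.le_induction with
      | base => exact h1
      | succ k hk ih => exact hno k hk ih
    obtain ⟨v, hv⟩ := this (Fintype.card V + 1) (by omega)
    have := hv.lt_card
    omega
  obtain ⟨k, hk1, ⟨v, hv⟩, hmax⟩ := hex
  obtain ⟨hk2, hc⟩ := closing_of_longest hG hb hv hmax hk1
  have hadj := fun i hi w hw =>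
    adj_of_longest hG hv hmax hk2 hc (i := i) hi (w := w) hw
  set C : V → Prop := fun a => ∃ i ≤ k, a = v i with hCdef
  have hCadj : ∀ a b, G.Adj a b → C a → C b := by
    rintro a b hab ⟨i, hi, rfl⟩
    obtain ⟨i', hi', h, -⟩ := hadj i hi b hab
    exact ⟨i', hi', h⟩
  let G' : SimpleGraph V :=
    { Adj := fun a b => G.Adj a b ∧ ¬ C a ∧ ¬ C b
      symm := ⟨fun a b h => ⟨h.1.symm, h.2.2, h.2.1⟩⟩
      loopless := ⟨fun a h => h.1.ne rfl⟩ }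
  have hle : G' ≤ G := fun a b h => h.1
  obtain ⟨φ, hinj, hφ⟩ := ih G'.edgeSet.ncard (by
    refine Set.ncard_lt_ncard ⟨SimpleGraph.edgeSet_mono hle, fun h => ?_⟩ (Set.toFinite _)
    have h2 := h ((SimpleGraph.mem_edgeSet G).2 (hv.2 0 (by omega)))
    exact ((SimpleGraph.mem_edgeSet G').1 h2).2.1 ⟨0, by omega, rfl⟩)
    (fun h => hG (h.mono hle)) rfl
  obtain ⟨M, hM⟩ := exists_abs_lt φ
  have hidx : ∀ a, ∃ i : ℕ, C a → i ≤ k ∧ a = v i := fun a => by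
    by_cases h : C a
    · obtain ⟨i, hi⟩ := h; exact ⟨i, fun _ => hi⟩
    · exact ⟨0, fun h' => absurd h' h⟩
  choose idx hidx using hidx
  -- The cycle is placed in its cyclic order beyond all other vertices. Its edges join consecutive
  -- positions or the two extreme ones, so nothing interleaves with them.
  set ψ : V → ℤ := fun a => if C a then M + idx a else φ a with hψ
  have hψ1 : ∀ a, C a → ψ a = M + idx a := fun a h => by simp [hψ, h]
  have hψ2 : ∀ a, ¬ C a → ψ a = φ a := fun a h => by simp [hψ, h]
  refine ⟨ψ, fun a b hab => ?_, fun a b c d hab hcd h1 h2 h3 => ?_⟩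
  · have := hM a; have := hM b
    by_cases ha : C a <;> by_cases hb : C b
    · rw [hψ1 a ha, hψ1 b hb] at hab
      rw [(hidx a ha).2, (hidx b hb).2, show idx a = idx b by omega]
    · rw [hψ1 a ha, hψ2 b hb] at hab; omega
    · rw [hψ2 a ha, hψ1 b hb] at hab; omega
    · rw [hψ2 a ha, hψ2 b hb] at hab; exact hinj hab
  · have := hM a; have := hM b; have := hM c; have := hM d
    by_cases ha : C a
    · have hbC := hCadj a b hab ha
      by_cases hcC : C c
      · have hdC := hCadj c d hcd hcC
        rw [hψ1 a ha, hψ1 c hcC] at h1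
        rw [hψ1 b hbC, hψ1 c hcC] at h2
        rw [hψ1 b hbC, hψ1 d hdC] at h3
        obtain ⟨i', hi', hbi, h⟩ := hadj (idx a) (hidx a ha).1 b (by rw [← (hidx a ha).2]; exact hab)
        have hb' := hidx b hbC
        have : idx b = i' := hv.1 hb'.1 hi' (by rw [← hb'.2, hbi])
        have := (hidx d hdC).1
        omega
      · rw [hψ1 a ha, hψ2 c hcC] at h1; omega
    · have hbC : ¬ C b := fun h => ha (hCadj b a hab.symm h)
      by_cases hcC : C c
      · rw [hψ1 c hcC, hψ2 b hbC] at h2; omega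
      · have hdC : ¬ C d := fun h => hcC (hCadj d c hcd.symm h)
        rw [hψ2 a ha, hψ2 c hcC] at h1
        rw [hψ2 b hbC, hψ2 c hcC] at h2
        rw [hψ2 b hbC, hψ2 d hdC] at h3
        exact hφ a b c d ⟨hab, ha, hbC⟩ ⟨hcd, hcC, hdC⟩ h1 h2 h3

end TwoChord

/-! ### The binomial random graph and exploration of its components -/

section RandomGraph

variable {V : Type*}

/-- The possible edges on the vertex set `V`. -/
abbrev Edge (V : Type*) : Type _ := {e : Sym2 V // ¬ e.IsDiag}

/-- The possible edge joining two distinct vertices. -/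
def mkEdge (x y : V) (h : x ≠ y) : Edge V := ⟨s(x, y), by simpa using h⟩

/-- The graph with edge set `S`. -/
def gr (S : Finset (Edge V)) : SimpleGraph V where
  Adj x y := ∃ h : x ≠ y, mkEdge x y h ∈ S
  symm := ⟨fun x y ⟨h, hS⟩ => ⟨h.symm, by
    have : mkEdge y x h.symm = mkEdge x y h := Subtype.ext Sym2.eq_swap
    rwa [this]⟩⟩
  loopless := ⟨fun _ h => h.1 rfl⟩

theorem gr_mono {S T : Finset (Edge V)} (h : S ⊆ T) : gr S ≤ gr T :=
  fun _ _ ⟨hne, hS⟩ => ⟨hne, h hS⟩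

theorem mkEdge_eq_iff {x y a b : V} {h : x ≠ y} {h' : a ≠ b} :
    mkEdge x y h = mkEdge a b h' ↔ x = a ∧ y = b ∨ x = b ∧ y = a := by
  simp [mkEdge]

theorem mkEdge_right_inj {v x y : V} {h : v ≠ x} {h' : v ≠ y} :
    mkEdge v x h = mkEdge v y h' ↔ x = y := by
  rw [mkEdge_eq_iff]
  constructor
  · rintro (⟨-, h⟩ | ⟨h1, h2⟩)
    · exact h
    · rw [h2, ← h1]
  · rintro rfl
    exact Or.inl ⟨rfl, rfl⟩

/-- Adjacency within the vertex set `X`. -/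
def AdjIn (S : Finset (Edge V)) (X : Finset V) (x y : V) : Prop := (gr S).Adj x y ∧ x ∈ X ∧ y ∈ X

variable [Fintype V] [DecidableEq V]

open Classical in
/-- The vertices that can be reached from `A` inside `A ∪ U`. -/
noncomputable def reach (S : Finset (Edge V)) (A U : Finset V) : Finset V :=
  Finset.univ.filter fun b => ∃ a ∈ A, Relation.ReflTransGen (AdjIn S (A ∪ U)) a b

theorem reach_congr {S S' : Finset (Edge V)} {A U : Finset V}
    (h : ∀ x y, x ∈ A ∪ U → y ∈ A ∪ U → ((gr S).Adj x y ↔ (gr S').Adj x y)) :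
    reach S A U = reach S' A U := by
  have : AdjIn S (A ∪ U) = AdjIn S' (A ∪ U) := by
    funext x y
    refine propext ⟨fun h1 => ?_, fun h1 => ?_⟩
    · exact ⟨(h x y h1.2.1 h1.2.2).1 h1.1, h1.2⟩
    · exact ⟨(h x y h1.2.1 h1.2.2).2 h1.1, h1.2⟩
  unfold reach
  rw [this]

/-- One step of the exploration, from the active vertex `v`. -/
theorem reach_subset {S : Finset (Edge V)} {A U W : Finset V} {v : V} (hv : v ∈ A) (hvU : v ∉ U)
    (hWU : W ⊆ U) (hW : ∀ u ∈ U, (gr S).Adj v u → u ∈ W) :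
    reach S A U ⊆ insert v (reach S (A.erase v ∪ W) (U \ W)) := by
  classical
  have hX : ∀ b, b ∈ (A.erase v ∪ W) ∪ (U \ W) ↔ b ≠ v ∧ b ∈ A ∪ U := by
    intro b
    have h1 := @hWU b
    have h2 : b ∈ U → b ≠ v := fun h h' => hvU (h' ▸ h)
    simp only [Finset.mem_union, Finset.mem_erase, Finset.mem_sdiff]
    tauto
  have hin : ∀ b ∈ A.erase v ∪ W, b ∈ reach S (A.erase v ∪ W) (U \ W) := fun b hb => by
    simp only [reach, Finset.mem_filter, Finset.mem_univ, true_and]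
    exact ⟨b, hb, Relation.ReflTransGen.refl⟩
  intro b hb
  simp only [reach, Finset.mem_filter, Finset.mem_univ, true_and] at hb
  obtain ⟨a, ha, hab⟩ := hb
  induction hab with
  | refl =>
    by_cases hav : a = v
    · simp [hav]
    · exact Finset.mem_insert_of_mem (hin a (by simp [hav, ha]))
  | tail hab' hbc ih =>
    rename_i b c
    rcases Finset.mem_insert.1 ih with rfl | hbr
    · by_cases hcb : c = b
      · simp [hcb]
      · refine Finset.mem_insert_of_mem (hin c ?_)
        rcases Finset.mem_union.1 hbc.2.2 with h | h
        · exact Finset.mem_union_left _ (Finset.mem_erase.2 ⟨hcb, h⟩)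
        · exact Finset.mem_union_right _ (hW c h hbc.1)
    · by_cases hcv : c = v
      · simp [hcv]
      by_cases hbv : b = v
      · subst hbv
        refine Finset.mem_insert_of_mem (hin c ?_)
        rcases Finset.mem_union.1 hbc.2.2 with h | h
        · exact Finset.mem_union_left _ (Finset.mem_erase.2 ⟨hcv, h⟩)
        · exact Finset.mem_union_right _ (hW c h hbc.1)
      · refine Finset.mem_insert_of_mem ?_
        simp only [reach, Finset.mem_filter, Finset.mem_univ, true_and] at hbr ⊢
        obtain ⟨a', ha', h'⟩ := hbr
        exact ⟨a', ha', h'.tail ⟨hbc.1, (hX b).2 ⟨hbv, hbc.2.1⟩, (hX c).2 ⟨hcv, hbc.2.2⟩⟩⟩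

/-- The probability generating function of the binomial law; it evaluates the exponential part of
the supermartingale. -/
theorem sum_bernOn_pow {E : Type*} [DecidableEq E] (p z : ℝ) (T : Finset E) :
    ∑ W ∈ T.powerset, bernOn (fun _ => p) T W * z ^ W.card = (1 - p + p * z) ^ T.card := by
  have h := Finset.prod_add (fun _ : E => p * z) (fun _ => 1 - p) T
  rw [Finset.prod_const] at h
  rw [add_comm, h]
  refine Finset.sum_congr rfl fun W _ => ?_
  simp only [bernOn, Finset.prod_const, mul_pow]
  ring

theorem sum_bernOn_card {E : Type*} [Fintype E] [DecidableEq E] (p : ℝ) (T : Finset E) :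
    ∑ W ∈ T.powerset, bernOn (fun _ => p) T W * (W.card : ℝ) = p * T.card := by
  have h := ex_eq_sum_bernOn (fun _ : E => p) T (f := fun S => ((S ∩ T).card : ℝ))
    fun S => by simp
  have h2 : ∑ W ∈ T.powerset, bernOn (fun _ => p) T W * (((W ∩ T).card : ℕ) : ℝ) =
      ∑ W ∈ T.powerset, bernOn (fun _ => p) T W * (W.card : ℝ) :=
    Finset.sum_congr rfl fun W hW => by
      rw [Finset.inter_eq_left.2 (Finset.mem_powerset.1 hW)]
  rw [← h2, ← h]
  have h3 : (fun S : Finset E => ((S ∩ T).card : ℝ)) =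
      fun S => ∑ e ∈ T, if ({e} : Finset E) ⊆ S then 1 else 0 := by
    funext S
    simp [Finset.inter_comm]
  rw [h3, ex_sum]
  have h4 : ∀ e : E, ex (fun _ : E => p) (fun S => if ({e} : Finset E) ⊆ S then 1 else 0) = p := by
    intro e
    have := pr_subset (fun _ : E => p) {e}
    rw [pr_eq_ex] at this
    simpa using this
  simp only [h4]
  simp [mul_comm]

/-- A supermartingale bound for the exploration process. -/
theorem ex_card_reach_le {p z γ : ℝ} {c : ℕ → ℝ} (hp0 : 0 ≤ p) (hp1 : p ≤ 1)
    (hstep : ∀ a u, a + 1 + u ≤ Fintype.card V →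
      1 + c (a + u) * (1 - z ^ a * (1 - p + p * z) ^ u) + γ * (a + p * u) ≤
        c (a + 1 + u) * (1 - z ^ (a + 1)) + γ * (a + 1)) (A U : Finset V) (hAU : Disjoint A U) :
    ex (fun _ : Edge V => p) (fun S => ((reach S A U).card : ℝ)) ≤
      c (A.card + U.card) * (1 - z ^ A.card) + γ * A.card := by
  classical
  have hp : IsProb fun _ : Edge V => p := fun _ => ⟨hp0, hp1⟩
  induction hr : A.card + U.card using Nat.strong_induction_on generalizing A U with
  | _ r ih => ?_
  subst hr
  rcases A.eq_empty_or_nonempty with rfl | ⟨v, hv⟩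
  · have : (fun S : Finset (Edge V) => ((reach S ∅ U).card : ℝ)) = fun _ => 0 := by
      funext S; simp [reach]
    rw [this, ex_const]
    simp
  have hvU : v ∉ U := Finset.disjoint_left.1 hAU hv
  have hne : ∀ u : U, v ≠ u := fun u h => hvU (h ▸ u.2)
  -- These are the edges revealed when `v` is processed. Their number is binomial, and the
  -- neighbours found move from the unexplored set `U` to the active set. With `a + 1` active and
  -- `u` unexplored vertices, `hstep` says that the potential `c (1 - z ^ a) + γ a` drops by at
  -- least 1 on average, which pays for the processed vertex.
  set T : Finset (Edge V) := U.attach.image (fun u : {x // x ∈ U} => mkEdge v u (hne u)) with hT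
  have hTcard : T.card = U.card := by
    rw [hT, Finset.card_image_of_injective, Finset.card_attach]
    intro u w h
    exact Subtype.ext (mkEdge_right_inj.1 h)
  have hvT : ∀ x y (h : x ≠ y), mkEdge x y h ∈ T → x = v ∨ y = v := by
    intro x y h hxy
    obtain ⟨u, -, hu⟩ := Finset.mem_image.1 hxy
    rcases mkEdge_eq_iff.1 hu with h | h
    · exact Or.inl h.1.symm
    · exact Or.inr h.1.symm
  set N : Finset (Edge V) → Finset V := fun W => U.filter fun u => ∃ h : v ≠ u, mkEdge v u h ∈ W
    with hN
  have hNcard : ∀ W ⊆ T, (N W).card = W.card := by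
    intro W hW
    refine Finset.card_bij (fun u hu => mkEdge v u (hne ⟨u, (Finset.mem_filter.1 hu).1⟩))
      (fun u hu => (Finset.mem_filter.1 hu).2.2) (fun u _ w _ h => mkEdge_right_inj.1 h)
      fun e he => ?_
    obtain ⟨u, -, rfl⟩ := Finset.mem_image.1 (hW he)
    exact ⟨u, Finset.mem_filter.2 ⟨u.2, hne u, he⟩, rfl⟩
  rw [ex_split_on _ T]
  have hA1 : (A.erase v).card + 1 = A.card := Finset.card_erase_add_one hv
  set a := (A.erase v).card with ha
  have hle : ∀ W ∈ T.powerset, bernOn (fun _ => p) T W *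
      ex (fun _ : Edge V => p) (fun S => ((reach (S \ T ∪ W) A U).card : ℝ)) ≤
      bernOn (fun _ => p) T W *
        (1 + (c (a + U.card) * (1 - z ^ (a + W.card)) + γ * (a + W.card))) := by
    intro W hW
    have hWT := Finset.mem_powerset.1 hW
    refine mul_le_mul_of_nonneg_left ?_ (bernOn_nonneg hp T W)
    have hNU : N W ⊆ U := Finset.filter_subset _ _
    have hdis : Disjoint (A.erase v) (N W) :=
      Finset.disjoint_of_subset_left (Finset.erase_subset _ _)
        (Finset.disjoint_of_subset_right hNU hAU)
    have hc1 : (A.erase v ∪ N W).card = a + W.card := by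
      rw [Finset.card_union_of_disjoint hdis, hNcard W hWT]
    have hc2 : (U \ N W).card = U.card - W.card := by
      rw [Finset.card_sdiff_of_subset hNU, hNcard W hWT]
    have hWle : W.card ≤ U.card := hTcard ▸ Finset.card_le_card hWT
    have hih := ih ((A.erase v ∪ N W).card + (U \ N W).card) (by omega) (A.erase v ∪ N W) (U \ N W)
      (by
        rw [Finset.disjoint_union_left]
        exact ⟨Finset.disjoint_of_subset_left (Finset.erase_subset _ _)
          (Finset.disjoint_of_subset_right Finset.sdiff_subset hAU), Finset.disjoint_sdiff⟩) rfl
    rw [hc1, hc2, show a + W.card + (U.card - W.card) = a + U.card by omega] at hih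
    push_cast at hih
    refine le_trans ?_ (add_le_add le_rfl hih)
    refine le_trans (ex_le_ex hp (g := fun S => 1 +
      ((reach S (A.erase v ∪ N W) (U \ N W)).card : ℝ)) fun S => ?_)
      (le_of_eq (by rw [ex_add, ex_const]))
    have hsub := reach_subset (S := S \ T ∪ W) (W := N W) hv hvU hNU (by
      rintro u hu ⟨h, hS⟩
      refine Finset.mem_filter.2 ⟨hu, h, ?_⟩
      rcases Finset.mem_union.1 hS with h' | h'
      · refine absurd ?_ (Finset.mem_sdiff.1 h').2
        exact Finset.mem_image.2 ⟨⟨u, hu⟩, Finset.mem_attach _ _, rfl⟩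
      · exact h')
    -- All revealed edges contain `v`, which has left the active set, so the rest of the exploration
    -- does not see them.
    have hcongr : reach (S \ T ∪ W) (A.erase v ∪ N W) (U \ N W) =
        reach S (A.erase v ∪ N W) (U \ N W) := by
      refine reach_congr fun x y hx hy => ?_
      have hvX : ∀ b ∈ A.erase v ∪ N W ∪ U \ N W, b ≠ v := by
        intro b hb h
        subst h
        simp only [Finset.mem_union, Finset.mem_erase, Finset.mem_sdiff] at hb
        have := @hNU b
        tauto
      refine exists_congr fun h => ?_
      have h1 : mkEdge x y h ∉ T := fun h' => by
        rcases hvT x y h h' with h2 | h2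
        · exact hvX x hx h2
        · exact hvX y hy h2
      have h2 : mkEdge x y h ∉ W := fun h' => h1 (hWT h')
      simp [h1, h2]
    rw [hcongr] at hsub
    have := (Finset.card_le_card hsub).trans (Finset.card_insert_le _ _)
    have h' : ((reach (S \ T ∪ W) A U).card : ℝ) ≤
      (reach S (A.erase v ∪ N W) (U \ N W)).card + 1 := by exact_mod_cast this
    linarith
  refine (Finset.sum_le_sum hle).trans ?_
  have hsum : ∑ W ∈ T.powerset, bernOn (fun _ : Edge V => p) T W *
        (1 + (c (a + U.card) * (1 - z ^ (a + W.card)) + γ * (a + W.card))) =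
      1 + c (a + U.card) * (1 - z ^ a * (1 - p + p * z) ^ U.card) + γ * (a + p * U.card) := by
    have e : ∀ W : Finset (Edge V), bernOn (fun _ : Edge V => p) T W *
        (1 + (c (a + U.card) * (1 - z ^ (a + W.card)) + γ * (a + W.card))) =
        (1 + c (a + U.card) + γ * a) * bernOn (fun _ : Edge V => p) T W
        - c (a + U.card) * z ^ a * (bernOn (fun _ : Edge V => p) T W * z ^ W.card)
        + γ * (bernOn (fun _ : Edge V => p) T W * (W.card : ℝ)) := fun W => by rw [pow_add]; ring
    simp_rw [e]
    rw [Finset.sum_add_distrib, Finset.sum_sub_distrib, ← Finset.mul_sum, ← Finset.mul_sum,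
      ← Finset.mul_sum, sum_bernOn, sum_bernOn_pow, sum_bernOn_card, hTcard]
    ring
  rw [hsum, ← hA1]
  have := hstep a U.card (by
    have := (Finset.card_union_of_disjoint hAU) ▸ Finset.card_le_univ (A ∪ U)
    omega)
  push_cast
  exact this

theorem mem_reach_of_reachable {S : Finset (Edge V)} {x y : V} (h : (gr S).Reachable x y) :
    y ∈ reach S {x} (Finset.univ.erase x) := by
  classical
  simp only [reach, Finset.mem_filter, Finset.mem_univ, true_and, Finset.mem_singleton,
    exists_eq_left]
  rw [SimpleGraph.reachable_iff_reflTransGen] at h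
  refine Relation.ReflTransGen.mono (fun a b hab => ⟨hab, ?_, ?_⟩) _ _ h <;>
    · simp only [Finset.mem_union, Finset.mem_singleton, Finset.mem_erase, Finset.mem_univ]
      tauto

theorem sum_pr_reachable_le (p : ℝ) (hp0 : 0 ≤ p) (hp1 : p ≤ 1) (x : V) :
    ∑ y, pr (fun _ : Edge V => p) (fun S => (gr S).Reachable x y) ≤
      ex (fun _ : Edge V => p) (fun S => ((reach S {x} (Finset.univ.erase x)).card : ℝ)) := by
  unfold pr
  rw [← ex_sum]
  refine ex_le_ex (fun _ => ⟨hp0, hp1⟩) fun S => ?_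
  have h : ((reach S {x} (Finset.univ.erase x)).card : ℝ) =
      ∑ y, if y ∈ reach S {x} (Finset.univ.erase x) then 1 else 0 := by simp
  rw [h]
  refine Finset.sum_le_sum fun y _ => ?_
  have := mem_reach_of_reachable (S := S) (x := x) (y := y)
  split_ifs <;> first | tauto | norm_num

end RandomGraph

/-! ### The expected component size in the critical window -/

section Critical

/-- Collects what the single smallness condition `hs` provides; it holds for large `n` because `h`
is of order `n^{-1/3}` while `l` is fixed. -/
theorem window_bounds {h l : ℝ} (hh : 0 < h) (hl : 0 ≤ l) (hs : (l + 4) * (2 * l + 2) * h ≤ 1) :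
    h ≤ 1 / 8 ∧ l * h ≤ 1 ∧ (2 * l + 2) * h ≤ 1 ∧ h ^ 3 ≤ h / 64 := by
  have e : (l + 4) * (2 * l + 2) * h = 2 * (l * (l * h)) + 10 * (l * h) + 8 * h := by ring
  have h1 := mul_nonneg hl hh.le
  have h2 := mul_nonneg hl h1
  have h3 : h ≤ 1 / 8 := by linarith
  refine ⟨h3, by linarith, by linarith, ?_⟩
  have : h ^ 2 ≤ (1 / 8) ^ 2 := pow_le_pow_left₀ hh.le h3 2
  calc h ^ 3 = h * h ^ 2 := by ring
    _ ≤ h * (1 / 8) ^ 2 := by gcongr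
    _ = h / 64 := by ring

/-- The growth factor of the exponential part of the supermartingale. -/
theorem one_add_le_pow_mul {n : ℕ} {h l p : ℝ} (hh : 0 < h) (hl : 0 ≤ l) (hn : (n : ℝ) * h ^ 3 = 1)
    (hs : (l + 4) * (2 * l + 2) * h ≤ 1) (hp : p = (1 + l * h) * h ^ 3) {u : ℕ} (hu : u ≤ n) :
    (1 + (l + 1) / 3 * h ^ 2) * (1 / (1 + (2 * l + 2) * h)) ≤
      (1 - p + p * (1 / (1 + (2 * l + 2) * h))) ^ u := by
  set b := 2 * l + 2 with hb
  set θ := b * h with hθ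
  have hb2 : 2 ≤ b := by rw [hb]; linarith
  have hθ0 : 0 < θ := by positivity
  obtain ⟨hh1, hlh, hθ1, hh3⟩ := window_bounds hh hl hs
  have hlh0 : 0 ≤ l * h := mul_nonneg hl hh.le
  have hp0 : 0 < p := by rw [hp]; positivity
  have hp1 : p ≤ 2 * h ^ 3 := by rw [hp]; gcongr; linarith
  have hp2 : p ≤ h := by linarith
  have hx : 1 - p + p * (1 / (1 + θ)) = (1 + θ - p * θ) / (1 + θ) := by field_simp; ring
  have hpθ : p * θ ≤ θ := mul_le_of_le_one_left hθ0.le (by linarith)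
  have hpos : 0 < 1 + θ - p * θ := by linarith
  have hlt : (1 + θ - p * θ) / (1 + θ) ≤ 1 := by
    rw [div_le_one (by positivity)]; linarith [mul_pos hp0 hθ0]
  rw [hx]
  refine le_trans ?_ (pow_le_pow_of_le_one (by positivity) hlt hu)
  -- lower bound for the power
  have h1 : Real.exp (-(p * θ / (1 + θ - p * θ))) ≤ (1 + θ - p * θ) / (1 + θ) := by
    rw [Real.exp_neg, ← inv_div (1 + θ) (1 + θ - p * θ)]
    refine inv_anti₀ (div_pos (by positivity) hpos) ?_
    have : (1 + θ) / (1 + θ - p * θ) = p * θ / (1 + θ - p * θ) + 1 := by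
      rw [div_add_one hpos.ne']; congr 1; ring
    rw [this]
    exact Real.add_one_le_exp _
  have h2 : Real.exp (-(n * (p * θ / (1 + θ - p * θ)))) ≤ ((1 + θ - p * θ) / (1 + θ)) ^ n := by
    have := pow_le_pow_left₀ (Real.exp_pos _).le h1 n
    rwa [← Real.exp_nat_mul, mul_neg] at this
  refine le_trans ?_ h2
  -- The bound `log (1 + θ) ≥ 2θ / (θ + 2)` is correct to second order, which is needed because the
  -- first-order terms of the drift cancel.
  have h3 : Real.exp (2 * θ / (θ + 2)) ≤ 1 + θ := by
    rw [← Real.le_log_iff_exp_le (by positivity)]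
    exact Real.le_log_one_add_of_nonneg hθ0.le
  have hnp : (n : ℝ) * p = 1 + l * h := by rw [hp, ← mul_assoc, mul_comm (n : ℝ), mul_assoc, hn]; ring
  have h4 : (l + 1) / 3 * h ^ 2 ≤ 2 * θ / (θ + 2) - n * (p * θ / (1 + θ - p * θ)) := by
    have e : 2 * θ / (θ + 2) - n * (p * θ / (1 + θ - p * θ)) =
        θ * (2 * (1 + θ - p * θ) - (1 + l * h) * (2 + θ)) / ((θ + 2) * (1 + θ - p * θ)) := by
      rw [← hnp]
      generalize 1 + θ - p * θ = D at hpos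
      field_simp
      ring
    rw [e, le_div_iff₀ (by positivity)]
    have e2 : 2 * (1 + θ - p * θ) - (1 + l * h) * (2 + θ) =
        h * (b - 2 * l - l * b * h - 2 * p * b) := by rw [hθ]; ring
    rw [e2]
    -- The choice `b = 2 * l + 2` makes the second-order gain exceed the supercritical drift `l * h`
    -- by 2, and the error terms use up at most 1.
    have e3 : 1 ≤ b - 2 * l - l * b * h - 2 * p * b := by
      have : 2 * p * b ≤ 2 * h * b := by gcongr
      linarith
    have e4 : (θ + 2) * (1 + θ - p * θ) ≤ 6 := by
      have h1 : 1 + θ - p * θ ≤ 2 := by linarith [mul_pos hp0 hθ0]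
      calc (θ + 2) * (1 + θ - p * θ) ≤ (1 + 2) * 2 := by gcongr
        _ = 6 := by norm_num
    have e5 : 0 ≤ (l + 1) / 3 * h ^ 2 := by positivity
    calc (l + 1) / 3 * h ^ 2 * ((θ + 2) * (1 + θ - p * θ)) ≤ (l + 1) / 3 * h ^ 2 * 6 :=
          mul_le_mul_of_nonneg_left e4 e5
      _ = θ * (h * 1) := by rw [hθ, hb]; ring
      _ ≤ _ := by gcongr
  calc (1 + (l + 1) / 3 * h ^ 2) * (1 / (1 + θ))
      ≤ Real.exp (2 * θ / (θ + 2) - n * (p * θ / (1 + θ - p * θ))) *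
          (1 / Real.exp (2 * θ / (θ + 2))) := by
        gcongr
        linarith [Real.add_one_le_exp (2 * θ / (θ + 2) - n * (p * θ / (1 + θ - p * θ)))]
    _ = _ := by
        rw [one_div, ← Real.exp_neg, ← Real.exp_add]
        congr 1
        ring

variable {V : Type*} [Fintype V] [DecidableEq V]

/-- In the critical window the expected component size is of order `n^{1/3}`. -/
theorem ex_card_reach_critical {h l p : ℝ} (hh : 0 < h) (hl : 0 ≤ l)
    (hn : (Fintype.card V : ℝ) * h ^ 3 = 1)
    (hs : (l + 4) * (2 * l + 2) * h ≤ 1) (hp : p = (1 + l * h) * h ^ 3) (x : V) :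
    ex (fun _ : Edge V => p) (fun S => ((reach S {x} (Finset.univ.erase x)).card : ℝ)) ≤
      ((3 + (l + 1) * (l + 2)) * (2 * l + 2) + 1) / h := by
  set n := Fintype.card V with hndef
  obtain ⟨hh1, hlh, -, hh3⟩ := window_bounds hh hl hs
  have hlh0 : 0 ≤ l * h := mul_nonneg hl hh.le
  have hp0 : 0 < p := by rw [hp]; positivity
  have hp1 : p ≤ 1 := by
    have : p ≤ 2 * h ^ 3 := by rw [hp]; gcongr; linarith
    linarith
  have hnp : (n : ℝ) * p = 1 + l * h := by rw [hp, ← mul_assoc, mul_comm (n : ℝ), mul_assoc, hn]; ring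
  have hθ : 0 < (2 * l + 2) * h := by positivity
  set z : ℝ := 1 / (1 + (2 * l + 2) * h) with hz
  have hz0 : 0 < z := by positivity
  have hz1 : z ≤ 1 := by rw [hz, div_le_one (by positivity)]; linarith
  -- Once at most `rs` vertices remain, the mean number of new vertices is at most `1 - h`, so the
  -- exploration is subcritical. The level `3 / h ^ 2` in `c` makes the gain in the exponential term
  -- at least `(l + 1) y`, where `y` is the power of `z` before the step.
  set rs : ℕ := ⌊(n : ℝ) - (l + 1) / h ^ 2⌋₊ with hrs
  set c : ℕ → ℝ := fun r => 3 / h ^ 2 + (l + 1) * ((r - rs : ℕ) : ℝ) with hc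
  have hc0 : ∀ r, 3 / h ^ 2 ≤ c r := fun r => by
    have : 0 ≤ (l + 1) * ((r - rs : ℕ) : ℝ) := by positivity
    simp only [hc]; linarith
  have hκ : ∀ r, l + 1 ≤ c r * ((l + 1) / 3 * h ^ 2) := fun r => by
    have h1 : 0 ≤ (l + 1) / 3 * h ^ 2 := by positivity
    have h2 := mul_le_mul_of_nonneg_right (hc0 r) h1
    have h3 : 3 / h ^ 2 * ((l + 1) / 3 * h ^ 2) = l + 1 := by field_simp
    linarith
  have hstep : ∀ a u : ℕ, a + 1 + u ≤ n →
      1 + c (a + u) * (1 - z ^ a * (1 - p + p * z) ^ u) + 1 / h * (a + p * u) ≤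
        c (a + 1 + u) * (1 - z ^ (a + 1)) + 1 / h * (a + 1) := by
    intro a u hau
    have hw := one_add_le_pow_mul hh hl hn hs hp (show u ≤ n by omega)
    rw [← hz] at hw
    have hy : z ^ (a + 1) * (1 + (l + 1) / 3 * h ^ 2) ≤ z ^ a * (1 - p + p * z) ^ u := by
      have := mul_le_mul_of_nonneg_left hw (pow_pos hz0 a).le
      calc _ = z ^ a * ((1 + (l + 1) / 3 * h ^ 2) * z) := by ring
        _ ≤ _ := this
    have hy0 : 0 < z ^ (a + 1) := pow_pos hz0 _
    have hy1 : z ^ (a + 1) ≤ 1 := pow_le_one₀ hz0.le hz1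
    set y := z ^ (a + 1) with hydef
    have hcpos : 0 ≤ c (a + u) := le_trans (by positivity) (hc0 _)
    have h1 : c (a + u) * (1 - z ^ a * (1 - p + p * z) ^ u) ≤
        c (a + u) * (1 - y * (1 + (l + 1) / 3 * h ^ 2)) :=
      mul_le_mul_of_nonneg_left (by linarith) hcpos
    have h2 : (l + 1) * y ≤ c (a + u) * ((l + 1) / 3 * h ^ 2) * y :=
      mul_le_mul_of_nonneg_right (hκ _) hy0.le
    have hu : (u : ℝ) ≤ n := by exact_mod_cast (show u ≤ n by omega)
    -- Early steps: the linear term may grow by `l`, and the decrease `l + 1` of `c` pays for this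
    -- and for the cost 1. Late steps: `c` is constant and the linear term alone drops by 1.
    rcases lt_or_ge rs (a + 1 + u) with hr | hr
    · have hceq : c (a + 1 + u) = c (a + u) + (l + 1) := by
        simp only [hc]
        rw [show a + 1 + u - rs = (a + u - rs) + 1 by omega]
        push_cast
        ring
      have h3 : 1 / h * (p * u) ≤ 1 / h + l := by
        have : p * u ≤ 1 + l * h := by rw [← hnp, mul_comm]; gcongr
        calc 1 / h * (p * u) ≤ 1 / h * (1 + l * h) := by gcongr
          _ = _ := by field_simp
      rw [hceq]
      linarith
    · have hceq : c (a + 1 + u) = c (a + u) := by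
        simp only [hc]
        rw [show a + 1 + u - rs = 0 by omega, show a + u - rs = 0 by omega]
      have hrs0 : (rs : ℝ) ≤ n - (l + 1) / h ^ 2 := by
        refine Nat.floor_le ?_
        have : 0 < rs := by omega
        rw [hrs, Nat.floor_pos] at this
        linarith
      have hur : (u : ℝ) ≤ rs := by exact_mod_cast (show u ≤ rs by omega)
      have h3 : 1 / h * (p * u) ≤ 1 / h - 1 := by
        have : p * u ≤ 1 - h := by
          calc p * u ≤ p * (n - (l + 1) / h ^ 2) := by gcongr; linarith
            _ = n * p - (1 + l * h) * h * (l + 1) := by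
              rw [hp]; field_simp
            _ ≤ 1 - h := by
              rw [hnp]
              nlinarith [mul_nonneg hlh0 hh.le, mul_nonneg hl (mul_nonneg hlh0 hh.le)]
        calc 1 / h * (p * u) ≤ 1 / h * (1 - h) := by gcongr
          _ = _ := by field_simp
      rw [hceq]
      have h4 : 0 ≤ (l + 1) * y := by positivity
      linarith
  refine (ex_card_reach_le (γ := 1 / h) (c := c) hp0.le hp1 hstep {x} (Finset.univ.erase x)
    (by simp)).trans ?_
  have hcard : ({x} : Finset V).card + (Finset.univ.erase x).card = n := by
    rw [Finset.card_singleton, Finset.card_erase_of_mem (Finset.mem_univ x), Finset.card_univ]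
    have : 0 < Fintype.card V := Fintype.card_pos_iff.2 ⟨x⟩
    omega
  rw [hcard, Finset.card_singleton, pow_one, Nat.cast_one, mul_one]
  have hz2 : 1 - z ≤ (2 * l + 2) * h := by
    have : 1 - z = (2 * l + 2) * h / (1 + (2 * l + 2) * h) := by rw [hz]; field_simp; ring
    rw [this]
    exact div_le_self hθ.le (by linarith)
  have hcn : c n ≤ (3 + (l + 1) * (l + 2)) / h ^ 2 := by
    have h1 : ((n - rs : ℕ) : ℝ) ≤ (l + 1) / h ^ 2 + 1 := by
      have h2 := Nat.lt_floor_add_one ((n : ℝ) - (l + 1) / h ^ 2)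
      rw [← hrs] at h2
      rcases le_total rs n with h3 | h3
      · rw [Nat.cast_sub h3]; linarith
      · rw [Nat.sub_eq_zero_of_le h3, Nat.cast_zero]; positivity
    have h2 : 1 ≤ 1 / h ^ 2 := by
      rw [le_div_iff₀ (by positivity)]
      nlinarith
    have h3 : (l + 1) * ((n - rs : ℕ) : ℝ) ≤ (l + 1) * ((l + 1) / h ^ 2 + 1 / h ^ 2) := by
      gcongr; linarith
    calc c n ≤ 3 / h ^ 2 + (l + 1) * ((l + 1) / h ^ 2 + 1 / h ^ 2) := by
          simp only [hc]; linarith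
      _ = _ := by ring
  calc c n * (1 - z) + 1 / h ≤ (3 + (l + 1) * (l + 2)) / h ^ 2 * ((2 * l + 2) * h) + 1 / h := by
        gcongr
    _ = _ := by field_simp

end Critical

/-! ### The random graph is outerplanar with positive probability -/

section Negative

variable {E : Type*} [Fintype E] [DecidableEq E] {p q : E → ℝ}

/-- Decreasing and increasing events are negatively correlated. -/
theorem pr_and_le_mul (hp : IsProb p) {A B : Finset E → Prop}
    (hA : ∀ S T, S ⊆ T → A T → A S) (hB : ∀ S T, S ⊆ T → B S → B T) :
    pr p (fun S => A S ∧ B S) ≤ pr p A * pr p B := by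
  classical
  have h := harris hp (f := fun S => if ¬ A S then 1 else 0) (g := fun S => if B S then 1 else 0)
    (fun S => by dsimp; split_ifs <;> norm_num) (fun S => by dsimp; split_ifs <;> norm_num)
    (fun S T hST => by
      have := hA S T hST
      dsimp
      split_ifs <;> first | tauto | norm_num)
    (fun S T hST => by
      have := hB S T hST
      dsimp
      split_ifs <;> first | tauto | norm_num)
  rw [← pr_eq_ex, ← pr_eq_ex, pr_not] at h
  have e : (fun S : Finset E => (if ¬ A S then (1 : ℝ) else 0) * if B S then 1 else 0) =
      fun S => (if B S then 1 else 0) - if A S ∧ B S then 1 else 0 := by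
    funext S
    by_cases h1 : A S <;> by_cases h2 : B S <;> simp [h1, h2]
  rw [e, ex_sub, ← pr_eq_ex, ← pr_eq_ex] at h
  linarith

/-- The effect on a decreasing event of raising the probability of a single element. -/
theorem pr_raise (hp : IsProb p) {e : E} (hpq : ∀ x, x ≠ e → p x = q x)
    (hle : p e ≤ q e) (he : p e ≤ 1 / 2) {A B : Finset E → Prop}
    (hA : ∀ S T, S ⊆ T → A T → A S) (hB : ∀ S T, S ⊆ T → B S → B T)
    (hAB : ∀ S, e ∉ S → A S → ¬ A (insert e S) → B S) :
    pr p A * (1 - 2 * (q e - p e) * pr p B) ≤ pr q A := by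
  classical
  have hins : ∀ S : Finset E, insert e (S.erase e) = insert e S := fun S => by
    ext x
    simp only [Finset.mem_insert, Finset.mem_erase]
    tauto
  set a0 := pr p fun S => A (S.erase e) with ha0
  set a1 := pr p fun S => A (insert e S) with ha1
  have h1 : pr p A = p e * a1 + (1 - p e) * a0 := by
    rw [pr_eq_ex, ex_split p e, ha0, ha1, pr_eq_ex, pr_eq_ex]
  have h2 : pr q A = q e * a1 + (1 - q e) * a0 := by
    rw [pr_eq_ex, ex_split q e, ha0, ha1, pr_eq_ex, pr_eq_ex]
    congr 2
    · exact (ex_congr_of_erase hpq fun S => by simp only [hins]).symm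
    · exact (ex_congr_of_erase hpq fun S => by simp only [Finset.erase_idem]).symm
  -- The difference is the probability that `e` is pivotal for `A`. This forces `B`, and the
  -- decreasing event `A (S.erase e)` is negatively correlated with the increasing event `B`.
  have h3 : a0 - a1 ≤ a0 * pr p B := by
    have h4 : a0 - a1 ≤ pr p fun S => A (S.erase e) ∧ B S := by
      rw [ha0, ha1, pr_eq_ex, pr_eq_ex, pr_eq_ex, ← ex_sub]
      refine ex_le_ex hp fun S => ?_
      have k1 := hAB (S.erase e) (by simp)
      rw [hins] at k1
      have k2 := hB (S.erase e) S (Finset.erase_subset _ _)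
      by_cases j1 : A (S.erase e) <;> by_cases j2 : A (insert e S) <;> by_cases j3 : B S <;>
        simp [j1, j2, j3]
      all_goals tauto
    exact h4.trans (pr_and_le_mul hp (A := fun S => A (S.erase e))
      (fun S T hST => hA _ _ (Finset.erase_subset_erase e hST)) hB)
  have hB0 := pr_nonneg hp B
  -- The element `e` is absent with probability at least 1/2; this is where the factor 2 comes from.
  have h5 : a0 ≤ 2 * pr p A := by
    have := mul_nonneg (hp e).1 (pr_nonneg hp fun S => A (insert e S))
    have := pr_nonneg hp fun S => A (S.erase e)
    rw [h1]
    nlinarith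
  have h6 : pr q A = pr p A - (q e - p e) * (a0 - a1) := by rw [h1, h2]; ring
  have h7 : (q e - p e) * (a0 - a1) ≤ (q e - p e) * (2 * pr p A * pr p B) := by
    refine mul_le_mul_of_nonneg_left (h3.trans ?_) (by linarith)
    exact mul_le_mul_of_nonneg_right h5 hB0
  rw [h6]
  linarith

/-- Raising all probabilities from `c` to `d`. -/
theorem pr_raise_all {c d : ℝ} (hc0 : 0 ≤ c) (hcd : c ≤ d) (hd : d ≤ 1 / 2)
    {A : Finset E → Prop} {B : E → Finset E → Prop}
    (hA : ∀ S T, S ⊆ T → A T → A S) (hB : ∀ e S T, S ⊆ T → B e S → B e T)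
    (hAB : ∀ e S, e ∉ S → A S → ¬ A (insert e S) → B e S) :
    pr (fun _ => c) A * ∏ e, (1 - 2 * (d - c) * pr (fun _ => d) (B e)) ≤ pr (fun _ => d) A := by
  classical
  have hd' : IsProb fun _ : E => d := fun _ => ⟨by linarith, by linarith⟩
  -- Raise the elements of `T` one after another. At every intermediate stage the increasing event
  -- `B e` is at most as likely as at full density `d`.
  have key : ∀ T : Finset E, pr (fun _ => c) A *
      ∏ e ∈ T, (1 - 2 * (d - c) * pr (fun _ => d) (B e)) ≤
        pr (fun e => if e ∈ T then d else c) A := by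
    intro T
    induction T using Finset.induction_on with
    | empty => simp
    | insert e T he ih =>
      have hp : IsProb fun x => if x ∈ T then d else c := fun x => by
        beta_reduce; split_ifs <;> constructor <;> linarith
      have h := pr_raise (q := fun x => if x ∈ insert e T then d else c) hp (e := e) (fun x hx => by simp [hx]) (by simp [he, hcd])
        (by simp only [he, if_false]; linarith) hA (hB e) (hAB e)
      simp only [he, if_false, Finset.mem_insert_self, if_true] at h
      have hBle : pr (fun x => if x ∈ T then d else c) (B e) ≤ pr (fun _ => d) (B e) := by
        rw [pr_eq_ex, pr_eq_ex]
        refine ex_mono_prob hp hd' (fun x => by split_ifs <;> linarith) (fun S => ?_)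
          fun S T' hST => ?_
        · dsimp; split_ifs <;> norm_num
        · have := hB e S T' hST
          split_ifs <;> first | tauto | norm_num
      have hB1 := pr_le_one hd' (B e)
      have hB0 := pr_nonneg hd' (B e)
      have hfac : 0 ≤ 1 - 2 * (d - c) * pr (fun _ => d) (B e) := by nlinarith
      rw [Finset.prod_insert he]
      have hA0 := pr_nonneg hp A
      calc _ = (pr (fun _ => c) A * ∏ e ∈ T, (1 - 2 * (d - c) * pr (fun _ => d) (B e))) *
            (1 - 2 * (d - c) * pr (fun _ => d) (B e)) := by ring
        _ ≤ pr (fun x => if x ∈ T then d else c) A *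
            (1 - 2 * (d - c) * pr (fun _ => d) (B e)) := mul_le_mul_of_nonneg_right ih hfac
        _ ≤ pr (fun x => if x ∈ T then d else c) A *
            (1 - 2 * (d - c) * pr (fun x => if x ∈ T then d else c) (B e)) := by
          refine mul_le_mul_of_nonneg_left ?_ hA0
          have : 2 * (d - c) * pr (fun x => if x ∈ T then d else c) (B e) ≤
            2 * (d - c) * pr (fun _ => d) (B e) := by
            refine mul_le_mul_of_nonneg_left hBle (by linarith)
          linarith
        _ ≤ _ := h
  simpa using key Finset.univ

end Negative

theorem exp_neg_two_mul_le {x : ℝ} (h0 : 0 ≤ x) (h1 : x ≤ 1 / 2) : Real.exp (-(2 * x)) ≤ 1 - x := by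
  have h2 : 1 + 2 * x ≤ Real.exp (2 * x) := by linarith [Real.add_one_le_exp (2 * x)]
  rw [Real.exp_neg]
  refine (inv_anti₀ (by positivity) h2).trans ?_
  rw [inv_le_iff_one_le_mul₀ (by positivity)]
  nlinarith

/-- Compare `(k + 1) ^ 2` with `2 * (k + 2).choose 2` and sum the binomial series. -/
theorem sum_sq_mul_pow_le {x : ℝ} (h0 : 0 ≤ x) (h1 : x < 1) (n : ℕ) :
    ∑ k ∈ Finset.range n, ((k : ℝ) + 1) ^ 2 * x ^ k ≤ 2 / (1 - x) ^ 3 := by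
  have hs := hasSum_choose_mul_geometric_of_norm_lt_one 2 (r := x)
    (by rwa [Real.norm_eq_abs, abs_of_nonneg h0])
  have h2 := sum_le_hasSum (Finset.range n) (fun k _ => by positivity) hs
  have h3 : ∀ k ∈ Finset.range n, ((k : ℝ) + 1) ^ 2 * x ^ k ≤
      2 * (((k + 2).choose 2 : ℕ) * x ^ k) := by
    intro k _
    rw [← mul_assoc]
    refine mul_le_mul_of_nonneg_right ?_ (by positivity)
    rw [Nat.cast_choose_two]
    push_cast
    nlinarith [Nat.cast_nonneg (α := ℝ) k]
  refine (Finset.sum_le_sum h3).trans ?_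
  rw [← Finset.mul_sum]
  calc _ ≤ 2 * (1 / (1 - x) ^ (2 + 1)) := by gcongr
    _ = _ := by ring

/-! ### Paths with two chords in the random graph, and outerplanarity in the critical window. -/

section TwoChordProb

variable {V : Type*} [Fintype V] [DecidableEq V]

/-- The ends, as indices, of the `t`-th edge of a path with two chords. -/
def chordIdx (k i j t : ℕ) : ℕ × ℕ :=
  if t < k then (t, t + 1) else if t = k then (0, i) else (k, j)

theorem pr_isTwoChord_le {p : ℝ} (hp0 : 0 ≤ p) (hp1 : p ≤ 1) (k i j : ℕ) (v : ℕ → V) :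
    pr (fun _ : Edge V => p) (fun S => IsTwoChord (gr S) k i j v) ≤ p ^ (k + 2) := by
  classical
  have hp : IsProb fun _ : Edge V => p := fun _ => ⟨hp0, hp1⟩
  by_cases hc : Set.InjOn v (Set.Iic k) ∧ 2 ≤ i ∧ i ≤ k ∧ j + 2 ≤ k ∧ (i = k → j ≠ 0)
  swap
  · refine (pr_mono hp (Q := fun _ => False) fun S h => hc ?_).trans ?_
    · obtain ⟨h1, h2, h3, h4, h5, -⟩ := h
      exact ⟨h1.1, h2, h3, h4, h5⟩
    · rw [pr_eq_ex]
      simp only [if_false, ex_const]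
      positivity
  obtain ⟨hv, h2, h3, h4, h5⟩ := hc
  have hidx : ∀ t < k + 2, (chordIdx k i j t).1 ≤ k ∧ (chordIdx k i j t).2 ≤ k ∧
      (chordIdx k i j t).1 ≠ (chordIdx k i j t).2 := by
    intro t ht
    unfold chordIdx
    split_ifs <;> dsimp <;> omega
  set g : ℕ → Sym2 V := fun t => s(v (chordIdx k i j t).1, v (chordIdx k i j t).2) with hg
  have hginj : Set.InjOn g (Finset.range (k + 2)) := by
    intro s hs t ht hst
    simp only [Finset.coe_range, Set.mem_Iio] at hs ht
    have a1 := hidx s hs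
    have a2 := hidx t ht
    have : (chordIdx k i j s).1 = (chordIdx k i j t).1 ∧ (chordIdx k i j s).2 = (chordIdx k i j t).2 ∨
        (chordIdx k i j s).1 = (chordIdx k i j t).2 ∧ (chordIdx k i j s).2 = (chordIdx k i j t).1 := by
      rcases Sym2.eq_iff.1 hst with ⟨b1, b2⟩ | ⟨b1, b2⟩
      · exact Or.inl ⟨hv a1.1 a2.1 b1, hv a1.2.1 a2.2.1 b2⟩
      · exact Or.inr ⟨hv a1.1 a2.2.1 b1, hv a1.2.1 a2.1 b2⟩
    grind [chordIdx]
  set F : Finset (Edge V) := Finset.univ.filter fun e => ∃ t < k + 2, g t = e.1 with hF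
  have hFcard : F.card = k + 2 := by
    have : F.map (Function.Embedding.subtype _) = (Finset.range (k + 2)).image g := by
      ext e
      simp only [hF, Finset.mem_map, Finset.mem_filter, Finset.mem_univ, true_and,
        Function.Embedding.coe_subtype, Finset.mem_image, Finset.mem_range]
      constructor
      · rintro ⟨e', ⟨t, ht, h⟩, rfl⟩
        exact ⟨t, ht, h⟩
      · rintro ⟨t, ht, rfl⟩
        refine ⟨⟨g t, ?_⟩, ⟨t, ht, rfl⟩, rfl⟩
        have := hidx t ht
        rw [hg, Sym2.mk_isDiag_iff]
        exact fun h => this.2.2 (hv this.1 this.2.1 h)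
    rw [← Finset.card_map, this, Finset.card_image_of_injOn hginj, Finset.card_range]
  refine (pr_mono hp (Q := fun S => F ⊆ S) fun S h e he => ?_).trans ?_
  · obtain ⟨t, ht, hte⟩ := (Finset.mem_filter.1 he).2
    have hadj : (gr S).Adj (v (chordIdx k i j t).1) (v (chordIdx k i j t).2) := by
      obtain ⟨⟨-, k1⟩, -, -, -, -, k2, k3⟩ := h
      unfold chordIdx
      split_ifs with c1 c2
      · exact k1 t c1
      · exact k2
      · exact k3
    obtain ⟨hne, hS⟩ := hadj
    have : mkEdge _ _ hne = e := Subtype.ext hte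
    rwa [this] at hS
  · rw [pr_subset, Finset.prod_const, hFcard]

/-- Union bound: `(k + 1) ^ 2` positions of the chords, `n ^ (k + 1)` vertex sequences and `k + 2`
edges each. There is one more edge than there are vertices, which leaves the factor `p` in front. -/
theorem pr_hasTwoChord_le {p : ℝ} (hp0 : 0 ≤ p) (hp1 : p ≤ 1)
    (hnp : (Fintype.card V : ℝ) * p < 1) :
    pr (fun _ : Edge V => p) (fun S => HasTwoChord (gr S)) ≤
      p * (2 / (1 - Fintype.card V * p) ^ 3) := by
  classical
  have hp : IsProb fun _ : Edge V => p := fun _ => ⟨hp0, hp1⟩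
  set n := Fintype.card V with hn
  have h1 : pr (fun _ : Edge V => p) (fun S => HasTwoChord (gr S)) ≤
      ∑ k ∈ Finset.range n, pr (fun _ : Edge V => p) (fun S => ∃ x ∈
        (Finset.univ : Finset (Fin (k + 1) × Fin (k + 1) × (Fin (k + 1) → V))),
        IsTwoChord (gr S) k x.1 x.2.1 fun t => x.2.2 ⟨min t k, by omega⟩) := by
    refine le_trans (pr_mono hp fun S h => ?_) (pr_exists_le hp _ _)
    obtain ⟨k, i, j, v, h1, h2, h3, h4, h5, h6, h7⟩ := h
    have := h1.lt_card
    refine ⟨k, Finset.mem_range.2 (by omega),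
      (⟨i, by omega⟩, ⟨j, by omega⟩, fun t => v t), Finset.mem_univ _, ?_⟩
    dsimp only
    -- Only the first `k + 1` vertices matter, so the sequence is truncated to range over a finite
    -- type.
    have hmin : ∀ t ≤ k, min t k = t := fun t ht => by omega
    refine ⟨⟨fun s hs t ht hst => ?_, fun t ht => ?_⟩, h2, h3, h4, h5, ?_, ?_⟩
    · simp only [Set.mem_Iic] at hs ht
      simp only [hmin s hs, hmin t ht] at hst
      exact h1.1 hs ht hst
    · simp only [hmin t ht.le, hmin (t + 1) ht]
      exact h1.2 t ht
    · simpa [hmin i h3] using h6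
    · simpa [hmin j (by omega)] using h7
  refine h1.trans ?_
  have h2 : ∀ k ∈ Finset.range n, pr (fun _ : Edge V => p) (fun S => ∃ x ∈
        (Finset.univ : Finset (Fin (k + 1) × Fin (k + 1) × (Fin (k + 1) → V))),
        IsTwoChord (gr S) k x.1 x.2.1 fun t => x.2.2 ⟨min t k, by omega⟩) ≤
        p * (((k : ℝ) + 1) ^ 2 * (n * p) ^ k) := by
    intro k _
    refine (pr_exists_le hp _ _).trans ((Finset.sum_le_sum fun x _ =>
      pr_isTwoChord_le hp0 hp1 k _ _ _).trans ?_)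
    rw [Finset.sum_const, Finset.card_univ, nsmul_eq_mul]
    simp only [Fintype.card_prod, Fintype.card_fin, Fintype.card_fun, ← hn]
    push_cast
    have : ((k : ℝ) + 1) * ((k + 1) * n ^ (k + 1)) * p ^ (k + 2) =
      p * ((k + 1) ^ 2 * (n * p) ^ k) * (n * p) := by rw [mul_pow]; ring
    rw [this]
    exact mul_le_of_le_one_right (by positivity) hnp.le
  refine (Finset.sum_le_sum h2).trans ?_
  rw [← Finset.mul_sum]
  exact mul_le_mul_of_nonneg_left (sum_sq_mul_pow_le (by positivity) hnp n) hp0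

/-- In the critical window the binomial random graph is outerplanar with probability bounded
away from `0`. -/
theorem pr_isOuterplanar_ge {h l : ℝ} (hh : 0 < h) (hl : 0 ≤ l)
    (hn : (Fintype.card V : ℝ) * h ^ 3 = 1) (hs : (l + 4) * (2 * l + 2) * h ≤ 1) :
    3 / 4 * Real.exp (-(4 * (l + 2) * ((3 + (l + 1) * (l + 2)) * (2 * l + 2) + 1))) ≤
      pr (fun _ : Edge V => (1 + l * h) * h ^ 3) (fun S => IsOuterplanar (gr S)) := by
  classical
  obtain ⟨hh1, hlh, hθ1, hh3⟩ := window_bounds hh hl hs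
  have hlh0 : 0 ≤ l * h := mul_nonneg hl hh.le
  have h30 : 0 < h ^ 3 := pow_pos hh 3
  set n := Fintype.card V with hndef
  set d := (1 + l * h) * h ^ 3 with hd
  -- Here `n * c = 1 - 2 * h`, so the first moment bound is at most `h ^ 3 * 2 / (2 * h) ^ 3 = 1 /
  -- 4`.
  set c := (1 - 2 * h) * h ^ 3 with hc
  set M := (3 + (l + 1) * (l + 2)) * (2 * l + 2) + 1 with hM
  have hc0 : 0 ≤ c := mul_nonneg (by linarith) h30.le
  have hc1 : c ≤ h ^ 3 := mul_le_of_le_one_left h30.le (by linarith)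
  have hd1 : d ≤ 1 / 2 := by
    have : d ≤ 2 * h ^ 3 := by rw [hd]; gcongr; linarith
    linarith
  have hdc : d - c = (l + 2) * h * h ^ 3 := by rw [hd, hc]; ring
  have hcd : c ≤ d := by
    have : 0 ≤ d - c := by rw [hdc]; positivity
    linarith
  have hdp : IsProb fun _ : Edge V => d := fun _ => ⟨by linarith, by linarith⟩
  have hcp : IsProb fun _ : Edge V => c := fun _ => ⟨hc0, by linarith⟩
  have hA : ∀ S T : Finset (Edge V), S ⊆ T → IsOuterplanar (gr T) → IsOuterplanar (gr S) :=
    fun S T hST h => h.mono (gr_mono hST)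
  -- the lower end of the window
  have hstart : 3 / 4 ≤ pr (fun _ : Edge V => c) (fun S => IsOuterplanar (gr S)) := by
    have hnc : (n : ℝ) * c = 1 - 2 * h := by
      rw [hc, mul_comm (1 - 2 * h), ← mul_assoc, hn, one_mul]
    have k1 := pr_hasTwoChord_le (V := V) hc0 (by linarith) (by rw [← hndef, hnc]; linarith)
    rw [← hndef, hnc] at k1
    have k2 : c * (2 / (1 - (1 - 2 * h)) ^ 3) ≤ 1 / 4 := by
      calc c * (2 / (1 - (1 - 2 * h)) ^ 3) ≤ h ^ 3 * (2 / (1 - (1 - 2 * h)) ^ 3) :=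
            mul_le_mul_of_nonneg_right hc1 (by
              rw [show 1 - (1 - 2 * h) = 2 * h by ring]; positivity)
        _ = 1 / 4 := by rw [show 1 - (1 - 2 * h) = 2 * h by ring]; field_simp; norm_num
    have k3 := pr_not (fun _ : Edge V => c) fun S => HasTwoChord (gr S)
    have k4 : pr (fun _ : Edge V => c) (fun S => ¬ HasTwoChord (gr S)) ≤
        pr (fun _ : Edge V => c) (fun S => IsOuterplanar (gr S)) :=
      pr_mono hcp fun S h => isOuterplanar_of_not_hasTwoChord h
    linarith
  -- the ends of an edge
  have hends : ∀ e : Edge V, ∃ xy : V × V, ∃ h : xy.1 ≠ xy.2, e = mkEdge xy.1 xy.2 h := by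
    rintro ⟨e, he⟩
    induction e with | h x y => ?_
    exact ⟨(x, y), by simpa using he, rfl⟩
  choose ends hne hends using hends
  -- If the ends of `e` are not connected, then `e` is a bridge after insertion and `of_bridge`
  -- keeps outerplanarity; so `B e` is the event that they are connected.
  have hraise := pr_raise_all (E := Edge V) (A := fun S => IsOuterplanar (gr S))
    (B := fun e S => (gr S).Reachable (ends e).1 (ends e).2) hc0 hcd hd1 hA
    (fun e S T hST h => h.mono (gr_mono hST)) (fun e S _ h1 h2 => by
      by_contra h3
      refine h2 (h1.of_bridge h3 fun a b hab => ?_)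
      obtain ⟨hab, hmem⟩ := hab
      rcases Finset.mem_insert.1 hmem with h4 | h4
      · right
        rw [hends e] at h4
        exact congrArg Subtype.val h4
      · exact Or.inl ⟨hab, h4⟩)
  refine le_trans ?_ hraise
  set τ : V × V → ℝ := fun xy => pr (fun _ : Edge V => d) fun S => (gr S).Reachable xy.1 xy.2 with hτ
  have hτ0 : ∀ xy, 0 ≤ τ xy := fun xy => pr_nonneg hdp _
  have hτ1 : ∀ xy, τ xy ≤ 1 := fun xy => pr_le_one hdp _
  have hsum : ∑ e : Edge V, τ (ends e) ≤ n * (M / h) := by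
    have hinj : Function.Injective ends := fun e f hef => by
      rw [hends e, hends f]
      simp only [hef]
    calc ∑ e : Edge V, τ (ends e) = ∑ xy ∈ Finset.univ.image ends, τ xy :=
          (Finset.sum_image hinj.injOn).symm
      _ ≤ ∑ xy : V × V, τ xy :=
          Finset.sum_le_sum_of_subset_of_nonneg (Finset.subset_univ _) fun xy _ _ => hτ0 xy
      _ = ∑ x, ∑ y, τ (x, y) := Fintype.sum_prod_type _
      _ ≤ ∑ _x : V, M / h := by
          refine Finset.sum_le_sum fun x _ => ?_
          exact (sum_pr_reachable_le d (by linarith) (by linarith) x).trans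
            (ex_card_reach_critical hh hl hn hs hd x)
      _ = n * (M / h) := by rw [Finset.sum_const, Finset.card_univ, nsmul_eq_mul]
  have hδ : 2 * (d - c) ≤ 1 / 2 := by
    rw [hdc]
    nlinarith
  have hδ0 : 0 ≤ 2 * (d - c) := by linarith
  have hprod : Real.exp (-(4 * (l + 2) * M)) ≤ ∏ e : Edge V, (1 - 2 * (d - c) * τ (ends e)) := by
    calc Real.exp (-(4 * (l + 2) * M))
        ≤ Real.exp (∑ e : Edge V, -(2 * (2 * (d - c) * τ (ends e)))) := by
          refine Real.exp_le_exp.2 ?_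
          rw [Finset.sum_neg_distrib, ← Finset.mul_sum, ← Finset.mul_sum]
          have k1 : 2 * (2 * (d - c) * ∑ e : Edge V, τ (ends e)) ≤
              2 * (2 * (d - c) * (n * (M / h))) := by gcongr
          -- The increment `(l + 2) * h ^ 4` meets the sum `n * M / h` of connection probabilities;
          -- since `n * h ^ 3 = 1`, the exponent does not depend on `n`.
          have k2 : 2 * (2 * (d - c) * (n * (M / h))) = 4 * (l + 2) * M * (n * h ^ 3) := by
            rw [hdc]; field_simp; ring
          rw [k2, hn] at k1
          linarith
      _ = ∏ e : Edge V, Real.exp (-(2 * (2 * (d - c) * τ (ends e)))) := Real.exp_sum _ _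
      _ ≤ _ := by
          refine Finset.prod_le_prod (fun _ _ => (Real.exp_pos _).le) fun e _ => ?_
          refine exp_neg_two_mul_le (mul_nonneg hδ0 (hτ0 _)) ?_
          calc 2 * (d - c) * τ (ends e) ≤ 2 * (d - c) * 1 := by gcongr; exact hτ1 _
            _ ≤ 1 / 2 := by linarith
  exact mul_le_mul hstart hprod (Real.exp_pos _).le (pr_nonneg hcp _)

end TwoChordProb

/-! ### Uniformly random sets of given size -/

section Uniform

variable {E : Type*} [Fintype E] [DecidableEq E]

open Classical in
/-- The probability of `Q` for a uniformly random set of size `m`. -/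
noncomputable def unif (m : ℕ) (Q : Finset E → Prop) : ℝ :=
  ((Finset.univ.filter fun S : Finset E => S.card = m ∧ Q S).card : ℝ) /
    ((Fintype.card E).choose m : ℝ)

omit [DecidableEq E] in
theorem unif_nonneg (m : ℕ) (Q : Finset E → Prop) : 0 ≤ unif m Q := by
  unfold unif; positivity

omit [DecidableEq E] in
theorem unif_mono (m : ℕ) {P Q : Finset E → Prop} (h : ∀ S, S.card = m → P S → Q S) :
    unif m P ≤ unif m Q := by
  classical
  unfold unif
  gcongr 1
  refine Nat.cast_le.2 (Finset.card_le_card fun S hS => ?_)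
  simp only [Finset.mem_filter, Finset.mem_univ, true_and] at hS ⊢
  exact ⟨hS.1, h S hS.1 hS.2⟩

omit [DecidableEq E] in
theorem card_filter_card_eq (m : ℕ) :
    (Finset.univ.filter fun S : Finset E => S.card = m).card = (Fintype.card E).choose m := by
  rw [← Finset.card_univ, ← Finset.card_powersetCard]
  congr 1
  ext S
  simp [Finset.mem_powersetCard]

theorem unif_exists_le {ι : Type*} (m : ℕ) (s : Finset ι) (R : ι → Finset E → Prop) :
    unif m (fun S => ∃ i ∈ s, R i S) ≤ ∑ i ∈ s, unif m (R i) := by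
  classical
  unfold unif
  rw [← Finset.sum_div]
  gcongr 1
  rw [← Nat.cast_sum]
  refine Nat.cast_le.2 (le_trans (Finset.card_le_card fun S hS => ?_) Finset.card_biUnion_le)
  simp only [Finset.mem_filter, Finset.mem_univ, true_and, Finset.mem_biUnion] at hS ⊢
  obtain ⟨h1, i, hi, h2⟩ := hS
  exact ⟨i, hi, h1, h2⟩

/-- Decreasing events become less likely when the size grows. -/
theorem unif_succ_le {Q : Finset E → Prop} (hQ : ∀ S T, S ⊆ T → Q T → Q S) (m : ℕ) :
    unif (m + 1) Q ≤ unif m Q := by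
  classical
  unfold unif
  -- The local LYM inequality: passing to the shadow does not lower the density in a layer, and the
  -- shadow of a decreasing family stays in the family.
  have h := Finset.local_lubell_yamamoto_meshalkin_inequality_div (𝕜 := ℝ) (r := m + 1)
    (𝒜 := Finset.univ.filter fun S : Finset E => S.card = m + 1 ∧ Q S) (by omega)
    (fun S hS => (Finset.mem_filter.1 hS).2.1)
  refine h.trans ?_
  rw [Nat.add_sub_cancel]
  gcongr 1
  refine Nat.cast_le.2 (Finset.card_le_card fun S hS => ?_)
  obtain ⟨T, hT, a, ha, rfl⟩ := Finset.mem_shadow_iff.1 hS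
  simp only [Finset.mem_filter, Finset.mem_univ, true_and] at hT ⊢
  exact ⟨by rw [Finset.card_erase_of_mem ha, hT.1]; rfl, hQ _ _ (Finset.erase_subset _ _) hT.2⟩

theorem unif_antitone {Q : Finset E → Prop} (hQ : ∀ S T, S ⊆ T → Q T → Q S) :
    Antitone fun m => unif m Q := antitone_nat_of_succ_le (unif_succ_le hQ)

/-- At constant density all sets of one size have the same weight, so conditioning on the size gives
the uniform model. -/
theorem pr_and_card_eq (c : ℝ) (Q : Finset E → Prop) (k : ℕ) :
    pr (fun _ : E => c) (fun S => S.card = k ∧ Q S) =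
      pr (fun _ : E => c) (fun S => S.card = k) * unif k Q := by
  classical
  have key : ∀ P : Finset E → Prop, pr (fun _ : E => c) (fun S => S.card = k ∧ P S) =
      c ^ k * (1 - c) ^ (Fintype.card E - k) *
        ((Finset.univ.filter fun S : Finset E => S.card = k ∧ P S).card : ℝ) := by
    intro P
    rw [pr_eq_ex]
    unfold ex
    simp only [mul_ite, mul_one, mul_zero]
    rw [← Finset.sum_filter, Finset.sum_congr rfl (g := fun _ => c ^ k *
      (1 - c) ^ (Fintype.card E - k)), Finset.sum_const, nsmul_eq_mul, mul_comm]
    intro S hS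
    rw [bern_const, (Finset.mem_filter.1 hS).2.1]
  have h1 := key fun _ => True
  simp only [and_true, card_filter_card_eq] at h1
  rw [key, h1]
  unfold unif
  rcases Nat.eq_zero_or_pos ((Fintype.card E).choose k) with h0 | h0
  · have : (Finset.univ.filter fun S : Finset E => S.card = k ∧ Q S).card = 0 := by
      refine Nat.le_zero.1 (h0 ▸ card_filter_card_eq (E := E) k ▸ Finset.card_le_card ?_)
      exact fun S hS => Finset.mem_filter.2 ⟨Finset.mem_univ _, (Finset.mem_filter.1 hS).2.1⟩
    simp [h0, this]
  · have : ((Fintype.card E).choose k : ℝ) ≠ 0 := by positivity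
    field_simp

theorem pr_eq_sum_card (c : ℝ) (Q : Finset E → Prop) :
    pr (fun _ => c) Q = ∑ k ∈ Finset.range (Fintype.card E + 1),
      pr (fun _ => c) (fun S => S.card = k ∧ Q S) := by
  classical
  simp_rw [pr_eq_ex]
  rw [← ex_sum]
  congr 1
  funext S
  rw [Finset.sum_eq_single S.card]
  · simp
  · intro k _ hk
    simp [hk.symm]
  · intro h
    exact absurd (Finset.mem_range.2 (Nat.lt_succ_of_le (Finset.card_le_univ S))) h

/-- Lower bound for the uniform model in terms of the binomial model. -/
theorem pr_le_add_unif {c : ℝ} (h0 : 0 ≤ c) (h1 : c ≤ 1) {Q : Finset E → Prop}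
    (hQ : ∀ S T, S ⊆ T → Q T → Q S) (m : ℕ) :
    pr (fun _ => c) Q ≤ pr (fun _ => c) (fun S : Finset E => S.card < m) + unif m Q := by
  have hp : IsProb fun _ : E => c := fun _ => ⟨h0, h1⟩
  have hsum : ∑ k ∈ Finset.range (Fintype.card E + 1),
      pr (fun _ : E => c) (fun S => S.card = k) = 1 := by
    have := pr_eq_sum_card c fun _ : Finset E => True
    simp only [and_true] at this
    rw [← this, pr_eq_ex]
    simp [ex_one]
  have hA : pr (fun _ => c) Q ≤ pr (fun _ => c) (fun S : Finset E => S.card < m) +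
      pr (fun _ => c) (fun S : Finset E => m ≤ S.card ∧ Q S) :=
    (pr_mono hp fun S h => by
      rcases lt_or_ge S.card m with h' | h'
      exacts [Or.inl h', Or.inr ⟨h', h⟩]).trans (pr_or_le hp)
  refine hA.trans (add_le_add le_rfl ?_)
  rw [pr_eq_sum_card, ← one_mul (unif m Q), ← hsum, Finset.sum_mul]
  refine Finset.sum_le_sum fun k _ => ?_
  rcases lt_or_ge k m with hk | hk
  · have : pr (fun _ => c) (fun S : Finset E => S.card = k ∧ m ≤ S.card ∧ Q S) ≤
        pr (fun _ : E => c) (fun _ => False) := pr_mono hp fun S h => by omega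
    refine this.trans ?_
    rw [pr_eq_ex]
    simp only [if_false, ex_const]
    exact mul_nonneg (pr_nonneg hp _) (unif_nonneg m Q)
  · calc pr (fun _ => c) (fun S : Finset E => S.card = k ∧ m ≤ S.card ∧ Q S) ≤
          pr (fun _ => c) (fun S : Finset E => S.card = k ∧ Q S) :=
          pr_mono hp fun S h => ⟨h.1, h.2.2⟩
      _ = pr (fun _ => c) (fun S : Finset E => S.card = k) * unif k Q := pr_and_card_eq c Q k
      _ ≤ _ := mul_le_mul_of_nonneg_left (unif_antitone hQ hk) (pr_nonneg hp _)

/-- Upper bound for the uniform model in terms of the binomial model. -/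
theorem mul_unif_le_pr {c : ℝ} (h0 : 0 ≤ c) (h1 : c ≤ 1) {Q : Finset E → Prop}
    (hQ : ∀ S T, S ⊆ T → Q T → Q S) (m : ℕ) :
    pr (fun _ => c) (fun S : Finset E => S.card ≤ m) * unif m Q ≤ pr (fun _ => c) Q := by
  have hp : IsProb fun _ : E => c := fun _ => ⟨h0, h1⟩
  rw [pr_eq_sum_card c Q, pr_eq_sum_card, Finset.sum_mul]
  refine Finset.sum_le_sum fun k _ => ?_
  rw [pr_and_card_eq c Q k]
  rcases le_or_gt k m with hk | hk
  · exact mul_le_mul (pr_mono hp fun S h => h.1) (unif_antitone hQ hk) (unif_nonneg m Q)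
      (pr_nonneg hp _)
  · have : pr (fun _ => c) (fun S : Finset E => S.card = k ∧ S.card ≤ m) ≤
        pr (fun _ : E => c) (fun _ => False) := pr_mono hp fun S h => by omega
    have h2 : pr (fun _ : E => c) (fun _ => False) = 0 := by
      rw [pr_eq_ex]
      simp only [if_false, ex_const]
    rw [h2] at this
    exact (mul_nonpos_of_nonpos_of_nonneg this (unif_nonneg m Q)).trans
      (mul_nonneg (pr_nonneg hp _) (unif_nonneg k Q))

/-- Factor by factor this is `(m - i) / (N - i) ≤ m / N`. -/
theorem descFactorial_mul_pow_le {m N : ℕ} (h : m ≤ N) (d : ℕ) :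
    m.descFactorial d * N ^ d ≤ N.descFactorial d * m ^ d := by
  induction d with
  | zero => simp
  | succ d ih =>
    rw [Nat.descFactorial_succ, Nat.descFactorial_succ, pow_succ, pow_succ]
    have : (m - d) * N ≤ (N - d) * m := by
      rw [Nat.sub_mul, Nat.sub_mul, mul_comm N m]
      exact Nat.sub_le_sub_left (Nat.mul_le_mul_left d h) _
    calc (m - d) * m.descFactorial d * (N ^ d * N)
        = (m.descFactorial d * N ^ d) * ((m - d) * N) := by ring
      _ ≤ (N.descFactorial d * m ^ d) * ((N - d) * m) := Nat.mul_le_mul ih this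
      _ = _ := by ring

/-- The probability that a random `m`-set contains a given set. -/
theorem unif_subset_le {m : ℕ} (hm : m ≤ Fintype.card E) (W : Finset E) :
    unif m (fun S => W ⊆ S) ≤ ((m : ℝ) / Fintype.card E) ^ W.card := by
  classical
  set N := Fintype.card E with hN
  set d := W.card with hd
  have hdN : d ≤ N := Finset.card_le_univ W
  rcases lt_or_ge m d with hmd | hmd
  · have : (Finset.univ.filter fun S : Finset E => S.card = m ∧ W ⊆ S) = ∅ := by
      refine Finset.filter_eq_empty_iff.2 fun S _ h => ?_
      have := Finset.card_le_card h.2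
      omega
    have h0 : unif m (fun S => W ⊆ S) = 0 := by
      unfold unif
      rw [Finset.card_eq_zero.2 (by convert this), Nat.cast_zero, zero_div]
    rw [h0]
    positivity
  have hcard : (Finset.univ.filter fun S : Finset E => S.card = m ∧ W ⊆ S).card ≤
      (N - d).choose (m - d) := by
    have hc : (Finset.univ \ W).card = N - d := by
      rw [Finset.card_sdiff_of_subset (Finset.subset_univ W), Finset.card_univ]
    rw [← hc, ← Finset.card_powersetCard]
    refine Finset.card_le_card_of_injOn (fun S => S \ W) (fun S hS => ?_) fun S hS T hT hST => ?_
    · simp only [Finset.coe_filter, Finset.mem_univ, true_and, Set.mem_ofPred_eq] at hS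
      rw [Finset.mem_coe, Finset.mem_powersetCard]
      exact ⟨Finset.sdiff_subset_sdiff (Finset.subset_univ S) le_rfl,
        by rw [Finset.card_sdiff_of_subset hS.2, hS.1]⟩
    · simp only [Finset.coe_filter, Finset.mem_univ, true_and, Set.mem_ofPred_eq] at hS hT
      dsimp only at hST
      rw [← Finset.sdiff_union_of_subset hS.2, ← Finset.sdiff_union_of_subset hT.2, hST]
  have hpos : 0 < N.choose m := Nat.choose_pos hm
  have h1 := Nat.choose_mul (n := N) (k := m) (s := d) hmd
  have h2 : m.choose d * N ^ d ≤ N.choose d * m ^ d := by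
    have := descFactorial_mul_pow_le hm d
    rw [Nat.descFactorial_eq_factorial_mul_choose, Nat.descFactorial_eq_factorial_mul_choose,
      mul_assoc, mul_assoc] at this
    exact Nat.le_of_mul_le_mul_left this (Nat.factorial_pos d)
  have h3 : (N - d).choose (m - d) * N ^ d ≤ m ^ d * N.choose m := by
    have hp : 0 < N.choose d := Nat.choose_pos hdN
    refine Nat.le_of_mul_le_mul_left ?_ hp
    calc N.choose d * ((N - d).choose (m - d) * N ^ d)
        = N.choose m * (m.choose d * N ^ d) := by rw [← mul_assoc, ← h1, mul_assoc]
      _ ≤ N.choose m * (N.choose d * m ^ d) := Nat.mul_le_mul_left _ h2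
      _ = _ := by ring
  have hle : unif m (fun S => W ⊆ S) ≤ ((N - d).choose (m - d) : ℝ) / (N.choose m : ℝ) := by
    unfold unif
    gcongr
    refine le_trans (le_of_eq ?_) hcard
    congr!
  refine hle.trans ?_
  rcases Nat.eq_zero_or_pos N with h0 | h0
  · have hd0 : d = 0 := by omega
    have hm0 : m = 0 := by omega
    simp [h0, hd0, hm0]
  rw [div_pow, div_le_div_iff₀ (by positivity) (by positivity)]
  exact_mod_cast h3

end Uniform

/-! ### Degrees in the binomial and in the uniform random graph -/

section Degree

variable {V : Type*} [Fintype V] [DecidableEq V]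

/-- The possible edges at `v`. -/
def star (v : V) : Finset (Edge V) := Finset.univ.filter fun e => v ∈ e.1

theorem mem_star {v : V} {e : Edge V} : e ∈ star v ↔ v ∈ e.1 := by simp [star]

/-- The edges at `v` correspond to the other vertices. -/
theorem card_inter_star (S : Finset (Edge V)) (v : V) [DecidableRel (gr S).Adj] :
    (S ∩ star v).card = (gr S).degree v := by
  symm
  rw [← SimpleGraph.card_neighborFinset_eq_degree]
  refine Finset.card_bij (fun u hu => mkEdge v u ((SimpleGraph.mem_neighborFinset _ _ _).1 hu).1)
    (fun u hu => ?_) (fun u _ w _ h => mkEdge_right_inj.1 h) fun e he => ?_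
  · obtain ⟨h, hS⟩ := (SimpleGraph.mem_neighborFinset _ _ _).1 hu
    exact Finset.mem_inter.2 ⟨hS, mem_star.2 (Sym2.mem_mk_left v u)⟩
  · obtain ⟨h1, h2⟩ := Finset.mem_inter.1 he
    obtain ⟨u, hu⟩ := mem_star.1 h2
    have hne : v ≠ u := fun h => e.2 (by rw [hu, h]; simp)
    have he' : mkEdge v u hne = e := Subtype.ext hu.symm
    exact ⟨u, (SimpleGraph.mem_neighborFinset _ _ _).2 ⟨hne, by rwa [he']⟩, he'⟩

theorem card_star (v : V) : (star v).card = Fintype.card V - 1 := by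
  classical
  have h := card_inter_star (Finset.univ : Finset (Edge V)) v
  rw [Finset.univ_inter] at h
  have htop : gr (Finset.univ : Finset (Edge V)) = ⊤ := by
    ext x y
    simp [gr]
  rw [h, ← SimpleGraph.complete_graph_degree v]
  congr!

theorem star_inter_star {u v : V} (h : u ≠ v) {e : Edge V} (hu : e ∈ star u) (hv : e ∈ star v) :
    e = mkEdge u v h :=
  Subtype.ext ((Sym2.mem_and_mem_iff h).1 ⟨mem_star.1 hu, mem_star.1 hv⟩)

theorem card_edge : Fintype.card (Edge V) = (Fintype.card V).choose 2 :=
  Sym2.card_subtype_not_diag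

section Tail

variable {E : Type*} [Fintype E] [DecidableEq E]

theorem pr_le_card_inter_le {p : ℝ} (hp0 : 0 ≤ p) (hp1 : p ≤ 1) (T : Finset E) (j : ℕ) :
    pr (fun _ => p) (fun S => j ≤ (S ∩ T).card) ≤ T.card.choose j * p ^ j := by
  have hp : IsProb fun _ : E => p := fun _ => ⟨hp0, hp1⟩
  refine (pr_mono hp (Q := fun S => ∃ W ∈ T.powersetCard j, W ⊆ S) fun S h => ?_).trans
    ((pr_exists_le hp _ _).trans ?_)
  · obtain ⟨W, hW, hc⟩ := Finset.exists_subset_card_eq h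
    exact ⟨W, Finset.mem_powersetCard.2 ⟨hW.trans Finset.inter_subset_right, hc⟩,
      hW.trans Finset.inter_subset_left⟩
  · rw [Finset.sum_congr rfl (g := fun _ => p ^ j), Finset.sum_const, Finset.card_powersetCard,
      nsmul_eq_mul]
    intro W hW
    rw [pr_subset, Finset.prod_const, (Finset.mem_powersetCard.1 hW).2]

/-- Only the sets meeting `T` in exactly `j` elements are counted. -/
theorem le_pr_le_card_inter {p : ℝ} (hp0 : 0 ≤ p) (hp1 : p ≤ 1) (T : Finset E) (j : ℕ) :
    T.card.choose j * (p ^ j * (1 - p) ^ T.card) ≤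
      pr (fun _ => p) (fun S => j ≤ (S ∩ T).card) := by
  classical
  have hp : IsProb fun _ : E => p := fun _ => ⟨hp0, hp1⟩
  rw [pr_eq_ex, ex_eq_sum_bernOn _ T fun S => by simp]
  have h0 : ∀ W ∈ T.powerset, W ∉ T.powersetCard j →
      0 ≤ bernOn (fun _ => p) T W * if j ≤ (W ∩ T).card then (1 : ℝ) else 0 := fun W _ _ =>
    mul_nonneg (bernOn_nonneg hp T W) (by split_ifs <;> norm_num)
  have hsub : T.powersetCard j ⊆ T.powerset := fun W hW =>
    Finset.mem_powerset.2 (Finset.mem_powersetCard.1 hW).1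
  refine le_trans ?_ (Finset.sum_le_sum_of_subset_of_nonneg hsub h0)
  rw [← Finset.card_powersetCard, ← nsmul_eq_mul, ← Finset.sum_const]
  refine Finset.sum_le_sum fun W hW => ?_
  obtain ⟨h1, h2⟩ := Finset.mem_powersetCard.1 hW
  rw [bernOn_const p h1, Finset.inter_eq_left.2 h1, h2, if_pos le_rfl, mul_one]
  refine mul_le_mul_of_nonneg_left ?_ (by positivity)
  exact pow_le_pow_of_le_one (by linarith) (by linarith) (by omega)

/-- Events about disjoint sets of coordinates are independent. -/
theorem pr_and_of_disjoint (p : E → ℝ) (T : Finset E) {A B : Finset E → Prop}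
    (hA : ∀ S, A S ↔ A (S ∩ T)) (hB : ∀ S, B S ↔ B (S \ T)) :
    pr p (fun S => A S ∧ B S) = pr p A * pr p B := by
  classical
  rw [pr_eq_ex, pr_eq_ex, pr_eq_ex, ← ex_mul_of_disjoint p T (fun S => by simp only [← hA S])
    fun S => by simp only [← hB S]]
  congr 1
  funext S
  by_cases h1 : A S <;> by_cases h2 : B S <;> simp [h1, h2]

end Tail

/-- The joint law of two large degrees. -/
theorem pr_two_degrees_le {p : ℝ} (hp0 : 0 ≤ p) (hp1 : p ≤ 1) {u v : V} (huv : u ≠ v) {d : ℕ}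
    {r : ℝ} (hd : 1 ≤ d) (hr : ∀ T : Finset (Edge V), T.card ≤ Fintype.card V →
      pr (fun _ => p) (fun S => d - 1 ≤ (S ∩ T).card) ≤ r) :
    pr (fun _ : Edge V => p) (fun S => d ≤ (S ∩ star u).card ∧ d ≤ (S ∩ star v).card) ≤
      pr (fun _ : Edge V => p) (fun S => d ≤ (S ∩ star u).card) *
        pr (fun _ : Edge V => p) (fun S => d ≤ (S ∩ star v).card) + p * r ^ 2 := by
  classical
  have hp : IsProb fun _ : Edge V => p := fun _ => ⟨hp0, hp1⟩
  set e := mkEdge u v huv with he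
  set Tu := (star u).erase e with hTu
  set Tv := (star v).erase e with hTv
  have hdis : Disjoint Tv Tu := by
    rw [Finset.disjoint_left]
    intro f hf hf'
    exact (Finset.mem_erase.1 hf).1 (star_inter_star huv (Finset.mem_erase.1 hf').2
      (Finset.mem_erase.1 hf).2)
  have hTvu : ∀ S : Finset (Edge V), S ∩ Tv = (S \ Tu) ∩ Tv := fun S => by
    ext f
    have : f ∈ Tv → f ∉ Tu := fun h => Finset.disjoint_left.1 hdis h
    simp only [Finset.mem_inter, Finset.mem_sdiff]
    tauto
  have hindep : ∀ j, pr (fun _ : Edge V => p) (fun S => j ≤ (S ∩ Tu).card ∧ j ≤ (S ∩ Tv).card) =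
      pr (fun _ : Edge V => p) (fun S => j ≤ (S ∩ Tu).card) *
        pr (fun _ : Edge V => p) (fun S => j ≤ (S ∩ Tv).card) := fun j =>
    pr_and_of_disjoint _ Tu (fun S => by rw [Finset.inter_assoc, Finset.inter_self])
      fun S => by rw [hTvu]
  have hle : ∀ (S : Finset (Edge V)) (w : V), (S ∩ (star w).erase e).card ≤ (S ∩ star w).card :=
    fun S w => Finset.card_le_card
      (Finset.inter_subset_inter_left (Finset.erase_subset _ _))
  have hge : ∀ (S : Finset (Edge V)) (w : V), (S ∩ star w).card ≤ (S ∩ (star w).erase e).card + 1 :=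
    fun S w => by
      rw [Finset.inter_erase]
      exact Nat.sub_le_iff_le_add.1 Finset.pred_card_le_card_erase
  have hge' : ∀ (S : Finset (Edge V)) (w : V), e ∉ S →
      (S ∩ star w).card = (S ∩ (star w).erase e).card := fun S w heS => by
    rw [Finset.inter_erase, Finset.erase_eq_of_notMem]
    exact fun h => heS (Finset.mem_inter.1 h).1
  -- The two stars share only the edge `uv`. Without it the degrees are independent; with it, at
  -- cost `p`, each vertex needs only `d - 1` further edges.
  have hsplit : pr (fun _ : Edge V => p)
      (fun S => d ≤ (S ∩ star u).card ∧ d ≤ (S ∩ star v).card) ≤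
      pr (fun _ : Edge V => p) (fun S => d ≤ (S ∩ Tu).card ∧ d ≤ (S ∩ Tv).card) +
      pr (fun _ : Edge V => p) (fun S => ({e} : Finset (Edge V)) ⊆ S ∧
        (d - 1 ≤ (S ∩ Tu).card ∧ d - 1 ≤ (S ∩ Tv).card)) := by
    refine (pr_mono hp fun S h => ?_).trans (pr_or_le hp)
    by_cases heS : e ∈ S
    · right
      have h1 := hge S u
      have h2 := hge S v
      rw [← hTu] at h1
      rw [← hTv] at h2
      exact ⟨by simpa using heS, by omega, by omega⟩
    · left
      rw [← hge' S u heS, ← hge' S v heS]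
      exact h
  refine hsplit.trans (add_le_add ?_ ?_)
  · rw [hindep]
    exact mul_le_mul (pr_mono hp fun S h => h.trans (hle S u))
      (pr_mono hp fun S h => h.trans (hle S v)) (pr_nonneg hp _) (pr_nonneg hp _)
  · rw [pr_and_of_disjoint _ {e} (A := fun S => {e} ⊆ S)
      (B := fun S => d - 1 ≤ (S ∩ Tu).card ∧ d - 1 ≤ (S ∩ Tv).card) (fun S => by simp) fun S => ?_,
      pr_subset, Finset.prod_singleton, hindep, sq]
    · have hcard : ∀ w : V, ((star w).erase e).card ≤ Fintype.card V := fun w =>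
        (Finset.card_le_card (Finset.erase_subset _ _)).trans (by rw [card_star]; omega)
      have h0 := pr_nonneg hp fun S => d - 1 ≤ (S ∩ Tu).card
      exact mul_le_mul_of_nonneg_left (mul_le_mul (hr _ (hcard u)) (hr _ (hcard v))
        (pr_nonneg hp _) (h0.trans (hr _ (hcard u)))) hp0
    · have : ∀ w : V, (S \ {e}) ∩ (star w).erase e = S ∩ (star w).erase e := fun w => by
        ext f
        simp only [Finset.mem_inter, Finset.mem_sdiff, Finset.mem_singleton, Finset.mem_erase]
        tauto
      rw [hTu, hTv, this, this]

/-- The second moment method for the number of vertices of large degree. -/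
theorem pr_all_degrees_lt_le {p : ℝ} (hp0 : 0 ≤ p) (hp1 : p ≤ 1) {d : ℕ}
    {r s : ℝ} (hd : 1 ≤ d) (hV : 0 < Fintype.card V) (hs : 0 < s)
    (hr : ∀ T : Finset (Edge V), T.card ≤ Fintype.card V →
      pr (fun _ => p) (fun S => d - 1 ≤ (S ∩ T).card) ≤ r)
    (hsr : ∀ v : V, s ≤ pr (fun _ : Edge V => p) (fun S => d ≤ (S ∩ star v).card)) :
    pr (fun _ : Edge V => p) (fun S => ∀ v, (S ∩ star v).card < d) ≤
      1 / (Fintype.card V * s) + p * (r / s) ^ 2 := by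
  classical
  have hp : IsProb fun _ : Edge V => p := fun _ => ⟨hp0, hp1⟩
  set n := Fintype.card V with hn
  have hn0 : (0 : ℝ) < n := by exact_mod_cast hV
  set I : V → Finset (Edge V) → ℝ := fun v S => if d ≤ (S ∩ star v).card then 1 else 0 with hI
  set π : V → ℝ := fun v => pr (fun _ : Edge V => p) (fun S => d ≤ (S ∩ star v).card) with hπ
  have hexI : ∀ v, ex (fun _ : Edge V => p) (I v) = π v := fun v => by rw [hπ]; simp only [pr_eq_ex]; rfl
  set μ := ∑ v, π v with hμ
  have hμs : n * s ≤ μ := by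
    rw [hμ, ← nsmul_eq_mul, hn, ← Finset.card_univ, ← Finset.sum_const]
    exact Finset.sum_le_sum fun v _ => hsr v
  have hμ0 : 0 < μ := lt_of_lt_of_le (by positivity) hμs
  -- Off the diagonal the covariance is at most `p * r ^ 2`, so the variance is at most `μ + n ^ 2 *
  -- p * r ^ 2`, and Chebyshev's inequality applies with `μ ≥ n * s`.
  have hpair : ∀ u v, ex (fun _ : Edge V => p) (fun S => I u S * I v S) ≤
      (if u = v then π u else 0) + (π u * π v + p * r ^ 2) := by
    intro u v
    have e1 : (fun S => I u S * I v S) = fun S =>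
        if d ≤ (S ∩ star u).card ∧ d ≤ (S ∩ star v).card then (1 : ℝ) else 0 := by
      funext S
      simp only [hI]
      by_cases h1 : d ≤ (S ∩ star u).card <;> by_cases h2 : d ≤ (S ∩ star v).card <;> simp [h1, h2]
    rw [e1, ← pr_eq_ex]
    split_ifs with huv
    · subst huv
      simp only [and_self]
      have : 0 ≤ π u * π u + p * r ^ 2 := add_nonneg (mul_self_nonneg _) (by positivity)
      linarith
    · rw [zero_add]
      exact pr_two_degrees_le hp0 hp1 huv hd hr
  have hsq : ex (fun _ : Edge V => p) (fun S => (∑ v, I v S) ^ 2) ≤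
      μ + (μ ^ 2 + n ^ 2 * (p * r ^ 2)) := by
    have e1 : (fun S => (∑ v, I v S) ^ 2) = fun S => ∑ u, ∑ v, I u S * I v S := by
      funext S; rw [sq, Finset.sum_mul_sum]
    rw [e1, ex_sum]
    simp_rw [ex_sum]
    refine (Finset.sum_le_sum fun u _ => Finset.sum_le_sum fun v _ => hpair u v).trans ?_
    simp_rw [Finset.sum_add_distrib]
    rw [← Finset.sum_mul_sum, ← sq]
    simp only [Finset.sum_ite_eq, Finset.mem_univ, if_true, Finset.sum_const, Finset.card_univ,
      nsmul_eq_mul, ← hn, ← hμ]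
    exact le_of_eq (by ring)
  have hvar : ex (fun _ : Edge V => p) (fun S => (∑ v, I v S - μ) ^ 2) ≤
      μ + n ^ 2 * (p * r ^ 2) := by
    have e1 : (fun S => (∑ v, I v S - μ) ^ 2) =
        fun S => (∑ v, I v S) ^ 2 - (2 * μ * ∑ v, I v S - μ ^ 2) := by funext S; ring
    rw [e1, ex_sub, ex_sub, ex_const_mul, ex_const, ex_sum]
    simp_rw [hexI]
    rw [← hμ]
    linarith
  refine (pr_le_of_le hp (f := fun S => (∑ v, I v S - μ) ^ 2) (pow_pos hμ0 2)
    (fun S => sq_nonneg _) fun S h => ?_).trans ?_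
  · have : ∑ v, I v S = 0 := Finset.sum_eq_zero fun v _ => by
      simp only [hI]
      rw [if_neg (not_le.2 (h v))]
    rw [this, zero_sub, neg_sq]
  · refine (div_le_div_of_nonneg_right hvar (sq_nonneg μ)).trans ?_
    rw [add_div]
    refine add_le_add ?_ ?_
    · rw [sq, div_mul_cancel_left₀ hμ0.ne', one_div]
      exact inv_anti₀ (by positivity) hμs
    · rw [div_pow, ← mul_div_assoc]
      rw [div_le_div_iff₀ (by positivity) (by positivity)]
      have : n ^ 2 * s ^ 2 ≤ μ ^ 2 := by
        rw [← mul_pow]; exact pow_le_pow_left₀ (by positivity) hμs 2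
      calc (n : ℝ) ^ 2 * (p * r ^ 2) * s ^ 2 = p * r ^ 2 * (n ^ 2 * s ^ 2) := by ring
        _ ≤ p * r ^ 2 * μ ^ 2 := mul_le_mul_of_nonneg_left this (by positivity)

/-- The first moment bound for the maximum degree of the uniform random graph. -/
theorem unif_exists_degree_ge_le {m : ℕ} (hm : m ≤ Fintype.card (Edge V)) (d : ℕ) :
    unif m (fun S : Finset (Edge V) => ∃ v, d ≤ (S ∩ star v).card) ≤
      Fintype.card V * ((Fintype.card V - 1).choose d *
        ((m : ℝ) / Fintype.card (Edge V)) ^ d) := by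
  classical
  refine (unif_mono m (Q := fun S => ∃ x ∈ Finset.univ.sigma fun v : V => (star v).powersetCard d,
    x.2 ⊆ S) fun S _ h => ?_).trans ((unif_exists_le m _ _).trans ?_)
  · obtain ⟨v, hv⟩ := h
    obtain ⟨W, hW, hc⟩ := Finset.exists_subset_card_eq hv
    exact ⟨⟨v, W⟩, Finset.mem_sigma.2 ⟨Finset.mem_univ _, Finset.mem_powersetCard.2
      ⟨hW.trans Finset.inter_subset_right, hc⟩⟩, hW.trans Finset.inter_subset_left⟩
  · rw [Finset.sum_sigma]
    have : ∀ v : V, ∑ W ∈ (star v).powersetCard d, unif m (fun S => W ⊆ S) ≤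
        (Fintype.card V - 1).choose d * ((m : ℝ) / Fintype.card (Edge V)) ^ d := by
      intro v
      rw [← card_star v, ← Finset.card_powersetCard, ← nsmul_eq_mul, ← Finset.sum_const]
      refine Finset.sum_le_sum fun W hW => ?_
      have := unif_subset_le hm W
      rwa [(Finset.mem_powersetCard.1 hW).2] at this
    refine (Finset.sum_le_sum fun v _ => this v).trans (le_of_eq ?_)
    rw [Finset.sum_const, Finset.card_univ, nsmul_eq_mul]

end Degree

/-! ### Estimates for the maximum degree -/

section Estimates

theorem sqrt_mul_le_factorial {d : ℕ} (hd : 1 ≤ d) :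
    √(d : ℝ) * (d / Real.exp 1) ^ d ≤ (d.factorial : ℝ) := by
  refine le_trans ?_ (Stirling.le_factorial_stirling d)
  gcongr
  have h1 := Real.pi_gt_three
  have h2 : (0 : ℝ) ≤ d := Nat.cast_nonneg d
  nlinarith

/-- The Stirling sequence decreases, so it is bounded by its value at 1. -/
theorem factorial_le_sqrt_mul {d : ℕ} (hd : 1 ≤ d) :
    (d.factorial : ℝ) ≤ Real.exp 1 * (√(d : ℝ) * (d / Real.exp 1) ^ d) := by
  obtain ⟨k, rfl⟩ : ∃ k, d = k + 1 := ⟨d - 1, by omega⟩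
  have h := Stirling.stirlingSeq'_antitone (Nat.zero_le k)
  simp only [Function.comp, Nat.succ_eq_add_one, zero_add, Stirling.stirlingSeq_one] at h
  unfold Stirling.stirlingSeq at h
  have hpos : (0 : ℝ) < ((k + 1 : ℕ) : ℝ) := by positivity
  rw [div_le_iff₀ (by positivity), Real.sqrt_mul (by norm_num)] at h
  refine h.trans (le_of_eq ?_)
  have h2 : √(2 : ℝ) ≠ 0 := by positivity
  field_simp

/-- The link between `nu` and degrees: with `d!` replaced by `√d (d / e) ^ d`, the right side is `n`
times `(k / n) ^ d / d!`, the Poisson tail estimate for the mean degree `k / n`. -/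
theorem exp_nuFun {n k d : ℕ} (hn : 1 ≤ n) (hk : 1 ≤ k) (hd : 1 ≤ d) :
    Real.exp (nuFun n k d) = n * ((k : ℝ) / n) ^ d / (√(d : ℝ) * (d / Real.exp 1) ^ d) := by
  have hn0 : (0 : ℝ) < n := by exact_mod_cast hn
  have hk0 : (0 : ℝ) < k := by exact_mod_cast hk
  have hd0 : (0 : ℝ) < d := by exact_mod_cast hd
  have hs : 0 < √(d : ℝ) := Real.sqrt_pos.2 hd0
  rw [← Real.exp_log (show 0 < n * ((k : ℝ) / n) ^ d / (√(d : ℝ) * (d / Real.exp 1) ^ d) by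
    positivity)]
  congr 1
  rw [Real.log_div (by positivity) (by positivity), Real.log_mul (by positivity) (by positivity),
    Real.log_mul (by positivity) (by positivity), Real.log_pow, Real.log_pow,
    Real.log_div (by positivity) (by positivity), Real.log_div (by positivity) (by positivity),
    Real.log_exp, Real.log_sqrt hd0.le]
  unfold nuFun
  ring

theorem card_edge_fin (n : ℕ) : (Fintype.card (Edge (Fin n)) : ℝ) = n * (n - 1) / 2 := by
  rw [card_edge, Fintype.card_fin, Nat.cast_choose_two]

/-- The first moment bound in terms of `nuFun`. -/
theorem unif_exists_degree_ge_le_exp {n m d : ℕ} (hn : 2 ≤ n) (hm0 : 1 ≤ m)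
    (hm : m ≤ Fintype.card (Edge (Fin n))) (hd : 1 ≤ d) :
    unif m (fun S : Finset (Edge (Fin n)) => ∃ v, d ≤ (S ∩ star v).card) ≤
      Real.exp (nuFun n (2 * m) d) := by
  refine (unif_exists_degree_ge_le hm d).trans ?_
  rw [exp_nuFun (by omega) (by omega) hd, Fintype.card_fin, card_edge_fin]
  have hn0 : (0 : ℝ) < n := by exact_mod_cast (show 0 < n by omega)
  have hn1 : (0 : ℝ) < n - 1 := by
    have : (2 : ℝ) ≤ n := by exact_mod_cast hn
    linarith
  have hd0 : (0 : ℝ) < d := by exact_mod_cast hd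
  have hs : 0 < √(d : ℝ) := Real.sqrt_pos.2 hd0
  have h1 := Nat.choose_le_pow_div (α := ℝ) d (n - 1)
  rw [Nat.cast_sub (by omega), Nat.cast_one] at h1
  rw [mul_div_assoc (n : ℝ) ((((2 * m : ℕ) : ℝ) / n) ^ d)]
  refine mul_le_mul_of_nonneg_left ?_ hn0.le
  calc ((n - 1).choose d : ℝ) * ((m : ℝ) / (n * (n - 1) / 2)) ^ d
      ≤ ((n : ℝ) - 1) ^ d / d.factorial * ((m : ℝ) / (n * (n - 1) / 2)) ^ d := by gcongr
    -- Exactly `(n - 1) * m / (n choose 2) = 2 * m / n`, the average degree.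
    _ = (((2 * m : ℕ) : ℝ) / n) ^ d / d.factorial := by
      rw [div_mul_eq_mul_div, ← mul_pow]
      congr 2
      push_cast
      field_simp
    _ ≤ _ := by
      gcongr
      exact sqrt_mul_le_factorial hd

/-- The second moment bound in the binomial random graph. -/
theorem pr_all_degrees_lt_le_of_binomial {n d : ℕ} {p : ℝ} (hp0 : 0 < p) (hp2 : p ≤ 1 / 2)
    (hnp4 : (n : ℝ) * p ≤ 4) (hd : 2 ≤ d) (hdn : 2 * d ^ 2 ≤ n) :
    pr (fun _ : Edge (Fin n) => p) (fun S => ∀ v, (S ∩ star v).card < d) ≤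
      2 * Real.exp 8 * d.factorial / (n * (n * p) ^ d) +
        4 * Real.exp 16 * (d ^ 2 / (n ^ 2 * p)) := by
  have hdn' : 2 * (d : ℝ) ^ 2 ≤ n := by exact_mod_cast hdn
  have hdn1 : d ≤ n := by nlinarith
  have hd0 : (0 : ℝ) < d := by exact_mod_cast (show 0 < d by omega)
  have hn0 : (0 : ℝ) < n := by exact_mod_cast (show 0 < n by omega)
  have hx0 : 0 < (n : ℝ) * p := by positivity
  set r : ℝ := (n * p) ^ (d - 1) / ((d - 1).factorial : ℝ) with hr
  -- The factor `exp (-8)` bounds the probability of the absent edges, as `n * p ≤ 4`; the factor 2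
  -- is Bernoulli's inequality for `(n - d) ^ d`, as `2 * d ^ 2 ≤ n`.
  set s : ℝ := (n * p) ^ d * Real.exp (-8) / (2 * (d.factorial : ℝ)) with hs
  have hs0 : 0 < s := by positivity
  have hrT : ∀ T : Finset (Edge (Fin n)), T.card ≤ Fintype.card (Fin n) →
      pr (fun _ => p) (fun S => d - 1 ≤ (S ∩ T).card) ≤ r := by
    intro T hT
    rw [Fintype.card_fin] at hT
    refine (pr_le_card_inter_le hp0.le (by linarith) T (d - 1)).trans ?_
    have h1 := Nat.choose_le_pow_div (α := ℝ) (d - 1) T.card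
    have hT' : (T.card : ℝ) ≤ n := by exact_mod_cast hT
    calc (T.card.choose (d - 1) : ℝ) * p ^ (d - 1)
        ≤ (T.card : ℝ) ^ (d - 1) / (d - 1).factorial * p ^ (d - 1) := by gcongr
      _ ≤ (n : ℝ) ^ (d - 1) / (d - 1).factorial * p ^ (d - 1) := by gcongr
      _ = r := by rw [hr, mul_pow]; ring
  have hsv : ∀ v : Fin n, s ≤ pr (fun _ : Edge (Fin n) => p) (fun S => d ≤ (S ∩ star v).card) := by
    intro v
    refine le_trans ?_ (le_pr_le_card_inter hp0.le (by linarith) (star v) d)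
    rw [card_star, Fintype.card_fin]
    have h1 : ((n : ℝ) - d) ^ d / d.factorial ≤ (n - 1).choose d := by
      have h2 := Nat.pow_sub_le_descFactorial (n - 1) d
      rw [show n - 1 + 1 - d = n - d by omega, Nat.descFactorial_eq_factorial_mul_choose] at h2
      rw [div_le_iff₀ (by positivity), ← Nat.cast_sub hdn1, mul_comm]
      exact_mod_cast h2
    have h2 : (n : ℝ) ^ d / 2 ≤ ((n : ℝ) - d) ^ d := by
      have h3 := one_add_mul_le_pow (a := -((d : ℝ) / n)) (by
        have : (d : ℝ) / n ≤ 1 := by rw [div_le_one hn0]; exact_mod_cast hdn1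
        linarith) d
      have h4 : (1 : ℝ) / 2 ≤ 1 + d * -((d : ℝ) / n) := by
        have : (d : ℝ) * (d / n) ≤ 1 / 2 := by
          rw [← mul_div_assoc, div_le_iff₀ hn0]
          nlinarith
        linarith
      have h5 : ((n : ℝ) - d) ^ d = n ^ d * (1 + -((d : ℝ) / n)) ^ d := by
        rw [← mul_pow]; congr 1; field_simp; ring
      rw [h5]
      calc (n : ℝ) ^ d / 2 = n ^ d * (1 / 2) := by ring
        _ ≤ _ := by gcongr; exact h4.trans h3
    have h3 : Real.exp (-8) ≤ (1 - p) ^ (n - 1) := by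
      calc Real.exp (-8) ≤ Real.exp (n * -(2 * p)) := Real.exp_le_exp.2 (by linarith)
        _ = Real.exp (-(2 * p)) ^ n := Real.exp_nat_mul _ _
        _ ≤ (1 - p) ^ n := pow_le_pow_left₀ (Real.exp_pos _).le (exp_neg_two_mul_le hp0.le hp2) n
        _ ≤ (1 - p) ^ (n - 1) := pow_le_pow_of_le_one (by linarith) (by linarith) (by omega)
    have h4 : (n : ℝ) ^ d / 2 / d.factorial ≤ (n - 1).choose d :=
      (div_le_div_of_nonneg_right h2 (by positivity)).trans h1
    calc s = (n : ℝ) ^ d / 2 / d.factorial * (p ^ d * Real.exp (-8)) := by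
          rw [hs, mul_pow]; field_simp
      _ ≤ (n - 1).choose d * (p ^ d * (1 - p) ^ (n - 1)) := by gcongr
  refine (pr_all_degrees_lt_le (V := Fin n) hp0.le (by linarith) (d := d) (r := r) (s := s)
    (by omega) (by rw [Fintype.card_fin]; omega) hs0 hrT hsv).trans ?_
  rw [Fintype.card_fin]
  refine add_le_add (le_of_eq ?_) (le_of_eq ?_)
  · rw [hs, Real.exp_neg]
    generalize (n : ℝ) * p = x at hx0
    field_simp
  · have h1 : r / s = 2 * Real.exp 8 * d / (n * p) := by
      rw [hr, hs, Real.exp_neg]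
      obtain ⟨e, rfl⟩ : ∃ e, d = e + 1 := ⟨d - 1, by omega⟩
      rw [Nat.add_sub_cancel, Nat.factorial_succ]
      generalize (n : ℝ) * p = x at hx0
      push_cast
      field_simp
      ring
    rw [h1, show (16 : ℝ) = 8 + 8 by norm_num, Real.exp_add]
    field_simp
    norm_num

/-- The binomial random graph of slightly smaller density has at most `m` edges. -/
theorem half_le_pr_card_le {E : Type*} [Fintype E] [DecidableEq E] {p : ℝ} (hp0 : 0 ≤ p)
    (hp1 : p ≤ 1) {m d : ℕ} (hd : 1 ≤ d) (hdm : 2 * d ^ 2 ≤ m)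
    (hNp : (Fintype.card E : ℝ) * p = (1 - 1 / d) * m) :
    1 / 2 ≤ pr (fun _ : E => p) (fun S => S.card ≤ m) := by
  have hd0 : (0 : ℝ) < d := by exact_mod_cast hd
  have hdm' : 2 * (d : ℝ) ^ 2 ≤ m := by exact_mod_cast hdm
  have hm0 : (0 : ℝ) < m := lt_of_lt_of_le (by positivity) hdm'
  -- The mean is `m / d` below `m`, so Chebyshev's inequality bounds the excess by `d ^ 2 / m ≤ 1 /
  -- 2`.
  have h1 := pr_card_far_le (E := E) (c := p) (t := m / d) hp0 hp1 (by positivity)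
  have h2 : pr (fun _ : E => p) (fun S => ¬ S.card ≤ m) ≤
      pr (fun _ : E => p) (fun S => (m : ℝ) / d ≤ |(S.card : ℝ) - Fintype.card E * p|) := by
    refine pr_mono (fun _ => ⟨hp0, hp1⟩) fun S h => ?_
    have h3 : (m : ℝ) ≤ S.card := by exact_mod_cast (not_le.1 h).le
    refine le_trans ?_ (le_abs_self _)
    rw [hNp]
    have : (m : ℝ) / d = 1 / d * m := by ring
    rw [this]
    linarith
  rw [pr_not] at h2
  have h3 : (Fintype.card E : ℝ) * p / (m / d) ^ 2 ≤ 1 / 2 := by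
    rw [hNp, div_le_iff₀ (by positivity), div_pow]
    have : 1 / 2 * ((m : ℝ) ^ 2 / d ^ 2) = m * (m / (2 * d ^ 2)) := by field_simp
    rw [this]
    have h4 : 1 ≤ (m : ℝ) / (2 * d ^ 2) := by rwa [one_le_div (by positivity)]
    calc (1 - 1 / (d : ℝ)) * m ≤ 1 * m := by gcongr; linarith [show (0 : ℝ) < 1 / d by positivity]
      _ = m * 1 := by ring
      _ ≤ m * (m / (2 * d ^ 2)) := by gcongr
  linarith

/-- The second moment bound in terms of `nuFun`. -/
theorem unif_all_degrees_lt_le {n m d : ℕ} (hd : 2 ≤ d) (hdm : 2 * d ^ 2 ≤ m) (hmn : m ≤ n) :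
    unif m (fun S : Finset (Edge (Fin n)) => ∀ v, (S ∩ star v).card < d) ≤
      4 * Real.exp 11 * Real.exp (-nuFun n (2 * m) d) + 8 * Real.exp 16 * (d ^ 2 / m) := by
  have h8 : 8 ≤ m := by nlinarith
  have hn8 : (8 : ℝ) ≤ n := by exact_mod_cast h8.trans hmn
  have hn0 : (0 : ℝ) < n := by linarith
  have hn1 : (0 : ℝ) < n - 1 := by linarith
  have hm0 : (0 : ℝ) < m := by exact_mod_cast (show 0 < m by omega)
  have hd2 : (2 : ℝ) ≤ d := by exact_mod_cast hd
  have hd0 : (0 : ℝ) < d := by linarith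
  have hmn' : (m : ℝ) ≤ n := by exact_mod_cast hmn
  have hdinv : (1 : ℝ) / d ≤ 1 / 2 := by gcongr
  have hdinv0 : (0 : ℝ) < 1 / d := by positivity
  -- Lowering the density by the factor `a = 1 - 1 / d` keeps the edge number below `m` with
  -- probability at least 1/2, yet costs only `a ^ d ≥ exp (-2)` in the degree estimate.
  obtain ⟨a, ha⟩ : ∃ a : ℝ, a = 1 - 1 / d := ⟨_, rfl⟩
  have ha1 : 1 / 2 ≤ a := by linarith
  have ha2 : a ≤ 1 := by linarith
  have hexp2 : Real.exp (-2) ≤ a ^ d := by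
    calc Real.exp (-2) = Real.exp (-(2 * (1 / d))) ^ d := by
          rw [← Real.exp_nat_mul]; congr 1; field_simp
      _ ≤ a ^ d := by
          rw [ha]
          exact pow_le_pow_left₀ (Real.exp_pos _).le (exp_neg_two_mul_le hdinv0.le hdinv) d
  obtain ⟨p, hp⟩ : ∃ p : ℝ, p = a * (m / (n * (n - 1) / 2)) := ⟨_, rfl⟩
  have hp0 : 0 < p := by rw [hp]; positivity
  have hnp : (n : ℝ) * p = a * (2 * m / (n - 1)) := by rw [hp]; field_simp
  have hnp4 : (n : ℝ) * p ≤ 4 := by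
    have h1 : 2 * (m : ℝ) / (n - 1) ≤ 4 := by rw [div_le_iff₀ hn1]; linarith
    have h2 : 0 ≤ 2 * (m : ℝ) / (n - 1) := by positivity
    rw [hnp]
    nlinarith
  have hp2 : p ≤ 1 / 2 := by nlinarith
  have hNp : (Fintype.card (Edge (Fin n)) : ℝ) * p = (1 - 1 / d) * m := by
    rw [card_edge_fin, hp, ha]; field_simp
  have hlow : a * (((2 * m : ℕ) : ℝ) / n) ≤ n * p := by
    rw [hnp]; push_cast; gcongr; linarith
  have hn2p : (m : ℝ) ≤ n ^ 2 * p := by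
    have h3 : (m : ℝ) ≤ n * (m / (n - 1)) := by
      rw [mul_div_assoc', le_div_iff₀ hn1]; nlinarith
    have h4 : (n : ℝ) ^ 2 * p = 2 * a * (n * (m / (n - 1))) := by rw [sq, mul_assoc, hnp]; ring
    have h5 : 0 ≤ (n : ℝ) * (m / (n - 1)) := by positivity
    rw [h4]
    nlinarith
  have hcard := half_le_pr_card_le hp0.le (by linarith) (by omega) hdm hNp
  clear hp hnp hNp ha
  have hmain := pr_all_degrees_lt_le_of_binomial hp0 hp2 hnp4 hd (hdm.trans hmn)
  -- The exponent is `11 = 8 + 1 + 2`: absent edges, Stirling's formula and the lowered density.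
  have hfirst : 2 * Real.exp 8 * d.factorial / (n * (n * p) ^ d) ≤
      2 * Real.exp 11 * Real.exp (-nuFun n (2 * m) d) := by
    have hx : 0 < ((2 * m : ℕ) : ℝ) / n := by
      have : (0 : ℝ) < (2 * m : ℕ) := by push_cast; positivity
      positivity
    rw [Real.exp_neg, exp_nuFun (by omega) (by omega) (by omega), inv_div]
    generalize ((2 * m : ℕ) : ℝ) / n = x at hx hlow
    have hq0 : 0 < √(d : ℝ) * (d / Real.exp 1) ^ d := by positivity
    generalize hq : √(d : ℝ) * (d / Real.exp 1) ^ d = q at hq0 ⊢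
    have hfac : (d.factorial : ℝ) ≤ Real.exp 1 * q := hq ▸ factorial_le_sqrt_mul (by omega)
    have hpow : Real.exp (-2) * x ^ d ≤ (n * p) ^ d := by
      calc Real.exp (-2) * x ^ d ≤ a ^ d * x ^ d := by gcongr
        _ = (a * x) ^ d := (mul_pow _ _ _).symm
        _ ≤ _ := by gcongr
    calc 2 * Real.exp 8 * d.factorial / (n * (n * p) ^ d)
        ≤ 2 * Real.exp 8 * (Real.exp 1 * q) / (n * (Real.exp (-2) * x ^ d)) := by gcongr
      _ = 2 * (Real.exp 8 * Real.exp 1 * Real.exp 2) * (q / (n * x ^ d)) := by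
          rw [Real.exp_neg]; field_simp
      _ = _ := by rw [← Real.exp_add, ← Real.exp_add]; norm_num
  have hsecond : 4 * Real.exp 16 * ((d : ℝ) ^ 2 / (n ^ 2 * p)) ≤ 4 * Real.exp 16 * (d ^ 2 / m) := by
    gcongr
  have hdec := mul_unif_le_pr (E := Edge (Fin n)) hp0.le (by linarith : p ≤ 1)
    (Q := fun S => ∀ v, (S ∩ star v).card < d) (fun S T hST h v =>
      (Finset.card_le_card (Finset.inter_subset_inter_right hST)).trans_lt (h v)) m
  have hu := unif_nonneg m fun S : Finset (Edge (Fin n)) => ∀ v, (S ∩ star v).card < d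
  have h5 := mul_le_mul_of_nonneg_right hcard hu
  linarith

end Estimates

/-! ### Slope and size of `nuFun` near its zero. -/

section Nu

theorem nuFun_nu {n k : ℕ} (hn : 1 ≤ n) (hk : 1 ≤ k) : 1 < nu n k ∧ nuFun n k (nu n k) = 0 := by
  have h : 0 < n ∧ 0 < k := ⟨hn, hk⟩
  have hs := (existsUnique_nu h.1 h.2).choose_spec.1
  have e : nu n k = (existsUnique_nu h.1 h.2).choose := by unfold nu; rw [dif_pos h]
  rw [← e] at hs
  refine ⟨?_, hs.2⟩
  by_contra hle
  exact (nuFun_pos hs.1 (not_lt.1 hle)).ne' hs.2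

/-- The slope of `nuFun`. -/
theorem nuFun_le_sub {n k : ℕ} (hn : 1 ≤ n) (hk : 1 ≤ k) {x y : ℝ} (hx : 0 < x) (hxy : x ≤ y) :
    nuFun n k y ≤ nuFun n k x - (y - x) * Real.log (n * x / k) := by
  have hn0 : (0 : ℝ) < n := by exact_mod_cast hn
  have hk0 : (0 : ℝ) < k := by exact_mod_cast hk
  have hy : 0 < y := by linarith
  have h1 : Real.log (x / y) ≤ x / y - 1 := Real.log_le_sub_one_of_pos (by positivity)
  rw [Real.log_div hx.ne' hy.ne'] at h1
  have h2 : y - x ≤ y * (Real.log y - Real.log x) := by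
    have := mul_le_mul_of_nonneg_left h1 hy.le
    have e : y * (x / y - 1) = x - y := by field_simp
    linarith
  have h3 : Real.log x ≤ Real.log y := Real.log_le_log hx hxy
  rw [Real.log_div (by positivity) (by positivity), Real.log_mul (by positivity) (by positivity)]
  unfold nuFun
  linarith

/-- Either `nuFun` has a steep slope at `x` or it is large there. -/
theorem slope_or_large {n k : ℕ} (hn : 1 ≤ n) (hk : 1 ≤ k) (hkn : (k : ℝ) ≤ 2 * n) {M x : ℝ}
    (hM : 0 ≤ M) (hx : 1 ≤ x) : M ≤ Real.log (n * x / k) ∨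
      Real.log n - 2 * M * Real.exp M ≤ nuFun n k x := by
  have hn0 : (0 : ℝ) < n := by exact_mod_cast hn
  have hk0 : (0 : ℝ) < k := by exact_mod_cast hk
  have hx0 : 0 < x := by linarith
  rcases le_or_gt M (Real.log (n * x / k)) with h | h
  · exact Or.inl h
  right
  -- A gentle slope forces `x ≤ 2 * exp M`; then only the term `log n` of `nuFun = log n + x - x log
  -- (n x / k) - (log x) / 2` can be large.
  have h1 : n * x / k < Real.exp M := (Real.log_lt_iff_lt_exp (by positivity)).1 h
  rw [div_lt_iff₀ hk0] at h1
  have h2 : x ≤ 2 * Real.exp M := by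
    have : n * x ≤ n * (2 * Real.exp M) := by
      nlinarith [Real.exp_pos M]
    exact le_of_mul_le_mul_left this hn0
  rw [Real.log_div (by positivity) (by positivity), Real.log_mul (by positivity) (by positivity)] at h
  have h3 : Real.log x ≤ x - 1 := Real.log_le_sub_one_of_pos hx0
  have h4 : 0 ≤ Real.log x := Real.log_nonneg hx
  have h5 : x * (Real.log n + Real.log x - Real.log k) ≤ x * M :=
    mul_le_mul_of_nonneg_left h.le hx0.le
  have h6 : M * x ≤ M * (2 * Real.exp M) := mul_le_mul_of_nonneg_left h2 hM
  unfold nuFun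
  linarith

/-- A degree at which `nuFun` is nonnegative is small. -/
theorem bounds_of_nuFun_nonneg {n k d : ℕ} (hn : 1 ≤ n) (hk : 1 ≤ k) (hkn : (k : ℝ) ≤ 2 * n)
    (hd : 2 ≤ d) (h : 0 ≤ nuFun n k d) :
    (d : ℝ) ≤ Real.log n + Real.exp 3 ∧ Real.exp (Real.log n / 2 - 1) ≤ k := by
  have hn0 : (0 : ℝ) < n := by exact_mod_cast hn
  have hk0 : (0 : ℝ) < k := by exact_mod_cast hk
  have hd2 : (2 : ℝ) ≤ d := by exact_mod_cast hd
  have hd0 : (0 : ℝ) < d := by linarith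
  have hln : 0 ≤ Real.log n := Real.log_natCast_nonneg n
  have hld : 0 ≤ Real.log d := Real.log_natCast_nonneg d
  have hlk : Real.log k ≤ Real.log n + 1 := by
    have h1 := Real.log_le_log hk0 hkn
    rw [Real.log_mul (by norm_num) hn0.ne'] at h1
    have := Real.log_two_lt_d9
    linarith
  unfold nuFun at h
  constructor
  · by_contra hlt
    push Not at hlt
    have h3 : 3 ≤ Real.log d := by
      rw [Real.le_log_iff_exp_le hd0]
      linarith
    have h4 : (d : ℝ) * Real.log k ≤ d * (Real.log n + 1) := mul_le_mul_of_nonneg_left hlk hd0.le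
    have h5 : (d : ℝ) * 3 ≤ d * Real.log d := mul_le_mul_of_nonneg_left h3 hd0.le
    have := Real.exp_pos 3
    nlinarith
  · rw [← Real.le_log_iff_exp_le hk0]
    by_contra hlt
    push Not at hlt
    have h6 : (d : ℝ) * Real.log k ≤ d * (Real.log n / 2 - 1) :=
      mul_le_mul_of_nonneg_left hlt.le hd0.le
    have h7 : 0 ≤ (d - 2) * Real.log n := mul_nonneg (by linarith) hln
    have h8 : 0 < Real.log d := Real.log_pos (by linarith)
    nlinarith

end Nu

/-! ### Asymptotics -/

section Asymptotics

/-- Positivity of `d` matters for `n = 0`, where the maximum degree is 0 and the right side is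
vacuous. -/
theorem maxDeg_gr_lt_iff {n : ℕ} (S : Finset (Edge (Fin n))) {d : ℕ} (hd : 0 < d) :
    maxDeg (gr S) < d ↔ ∀ v, (S ∩ star v).card < d := by
  classical
  unfold maxDeg
  constructor
  · intro h v
    rw [card_inter_star]
    refine lt_of_le_of_lt ?_ h
    convert SimpleGraph.degree_le_maxDegree (gr S) v
  · intro h
    rw [Nat.lt_iff_le_pred hd]
    refine SimpleGraph.maxDegree_le_of_forall_degree_le _ _ fun v => ?_
    have := h v
    rw [card_inter_star] at this
    rw [← Nat.lt_iff_le_pred hd]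
    convert this

theorem maxDeg_gr_pos {n : ℕ} {S : Finset (Edge (Fin n))} (hS : 1 ≤ S.card) :
    1 ≤ maxDeg (gr S) := by
  by_contra h
  have h1 := (maxDeg_gr_lt_iff S one_pos).1 (not_le.1 h)
  obtain ⟨e, he⟩ := Finset.card_pos.1 hS
  obtain ⟨v, hv⟩ : ∃ v, v ∈ e.1 := by
    obtain ⟨e, _⟩ := e
    induction e with | h x y => ?_
    exact ⟨x, by simp⟩
  have := h1 v
  rw [Nat.lt_one_iff, Finset.card_eq_zero] at this
  exact Finset.notMem_empty e (this ▸ Finset.mem_inter.2 ⟨he, mem_star.2 hv⟩)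

theorem tendsto_log_natCast : Tendsto (fun n : ℕ => Real.log n) atTop atTop :=
  Real.tendsto_log_atTop.comp tendsto_natCast_atTop_atTop

/-- With the bounds of `bounds_of_nuFun_nonneg` this makes `d ^ 2 / m` tend to 0, the error term of
the second moment method. -/
theorem tendsto_sq_mul_exp : Tendsto (fun n : ℕ => (Real.log n + Real.exp 3) ^ 2 *
    Real.exp (-(Real.log n / 2))) atTop (𝓝 0) := by
  have h : Tendsto (fun x : ℝ => (x + Real.exp 3) ^ 2 * Real.exp (-(x / 2))) atTop (𝓝 0) := by
    have h1 : Tendsto (fun y : ℝ => y ^ 2 * Real.exp (-y)) atTop (𝓝 0) :=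
      Real.tendsto_pow_mul_exp_neg_atTop_nhds_zero 2
    have h2 : Tendsto (fun x : ℝ => (x + Real.exp 3) / 2) atTop atTop :=
      (tendsto_atTop_add_const_right _ _ tendsto_id).atTop_div_const (by norm_num)
    have h3 := (h1.comp h2).const_mul (4 * Real.exp (Real.exp 3 / 2))
    rw [mul_zero] at h3
    refine h3.congr fun x => ?_
    have : Real.exp (-(x / 2)) = Real.exp (Real.exp 3 / 2) * Real.exp (-((x + Real.exp 3) / 2)) := by
      rw [← Real.exp_add]; congr 1; ring
    simp only [Function.comp]
    rw [this]
    ring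
  exact h.comp tendsto_log_natCast

/-- The maximum degree of the uniform random graph is concentrated. -/
theorem eventually_unif_maxDeg (m : ℕ → ℕ) (hpos : ∀ᶠ n in atTop, 1 ≤ m n)
    (hmn : ∀ᶠ n in atTop, m n ≤ n) {ε δ : ℝ} (hε : 0 < ε) (hδ : 0 < δ) :
    ∀ᶠ n in atTop, unif (m n) (fun S : Finset (Edge (Fin n)) =>
      ¬ (⌊nu n (2 * m n) - ε⌋ ≤ (maxDeg (gr S) : ℤ) ∧
        (maxDeg (gr S) : ℤ) ≤ ⌊nu n (2 * m n) + ε⌋)) ≤ δ := by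
  -- a bound `B` for `nuFun` that makes the exponential terms small
  obtain ⟨B, hB0, hB⟩ : ∃ B : ℝ, 0 ≤ B ∧ (1 + 4 * Real.exp 11) * Real.exp (-B) ≤ δ / 2 := by
    have h1 : Tendsto (fun B : ℝ => (1 + 4 * Real.exp 11) * Real.exp (-B)) atTop (𝓝 0) := by
      have := Real.tendsto_exp_neg_atTop_nhds_zero.const_mul (1 + 4 * Real.exp 11)
      rwa [mul_zero] at this
    obtain ⟨B, hB⟩ := ((h1.eventually (ge_mem_nhds (half_pos hδ))).and
      (eventually_ge_atTop 0)).exists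
    exact ⟨B, hB.2, hB.1⟩
  -- A slope of at least `M` over a distance `ε` changes `nuFun` by at least `B`.
  set M := B / ε with hM
  have hM0 : 0 ≤ M := by positivity
  have hMε : ε * M = B := by rw [hM]; field_simp
  have hη : 0 < min (δ / 2 / (8 * Real.exp 16)) (1 / 2) := by positivity
  set η := min (δ / 2 / (8 * Real.exp 16)) (1 / 2) with hηdef
  have hsmall : ∀ᶠ n : ℕ in atTop, 2 * Real.exp 1 * ((Real.log n + Real.exp 3) ^ 2 *
      Real.exp (-(Real.log n / 2))) ≤ η := by
    have := tendsto_sq_mul_exp.const_mul (2 * Real.exp 1)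
    rw [mul_zero] at this
    exact this.eventually (ge_mem_nhds hη)
  filter_upwards [hpos, hmn, eventually_ge_atTop 4, hsmall,
    tendsto_log_natCast.eventually (eventually_gt_atTop (B + 2 * M * Real.exp M))]
    with n hm1 hmn hn4 hsm hlog
  set k := 2 * m n with hk
  have hn1 : 1 ≤ n := by omega
  have hk1 : 1 ≤ k := by omega
  have hkn : (k : ℝ) ≤ 2 * n := by rw [hk]; push_cast; gcongr
  obtain ⟨hν1, hν0⟩ := nuFun_nu hn1 hk1
  set ν := nu n k with hν
  have hmE : m n ≤ Fintype.card (Edge (Fin n)) := by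
    have h1 : (n : ℝ) ≤ Fintype.card (Edge (Fin n)) := by
      rw [card_edge_fin]
      have : (4 : ℝ) ≤ n := by exact_mod_cast hn4
      nlinarith
    exact hmn.trans (by exact_mod_cast h1)
  have hsplit : unif (m n) (fun S : Finset (Edge (Fin n)) =>
      ¬ (⌊ν - ε⌋ ≤ (maxDeg (gr S) : ℤ) ∧ (maxDeg (gr S) : ℤ) ≤ ⌊ν + ε⌋)) ≤
      unif (m n) (fun S : Finset (Edge (Fin n)) => ⌊ν + ε⌋ < (maxDeg (gr S) : ℤ)) +
      unif (m n) (fun S : Finset (Edge (Fin n)) => (maxDeg (gr S) : ℤ) < ⌊ν - ε⌋) := by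
    refine (unif_mono _ (Q := fun S => ∃ i ∈ (Finset.univ : Finset Bool), cond i
      (⌊ν + ε⌋ < (maxDeg (gr S) : ℤ)) ((maxDeg (gr S) : ℤ) < ⌊ν - ε⌋)) fun S _ h => ?_).trans
      ((unif_exists_le _ _ _).trans (le_of_eq (by simp)))
    by_cases h1 : ⌊ν + ε⌋ < (maxDeg (gr S) : ℤ)
    · exact ⟨true, Finset.mem_univ _, h1⟩
    · exact ⟨false, Finset.mem_univ _, by
        by_contra h2
        exact h ⟨not_lt.1 h2, not_lt.1 h1⟩⟩
  -- The other alternative would make the value at the zero `ν` exceed `B ≥ 0`.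
  have hslope : M ≤ Real.log (n * ν / k) := by
    rcases slope_or_large hn1 hk1 hkn hM0 hν1.le with h | h
    · exact h
    · linarith
  have hup : unif (m n) (fun S : Finset (Edge (Fin n)) => ⌊ν + ε⌋ < (maxDeg (gr S) : ℤ)) ≤
      Real.exp (-B) := by
    obtain ⟨d, hd⟩ : ∃ d : ℕ, (d : ℤ) = ⌊ν + ε⌋ + 1 := by
      have : 0 ≤ ⌊ν + ε⌋ := Int.floor_nonneg.2 (by linarith)
      exact ⟨(⌊ν + ε⌋ + 1).toNat, Int.toNat_of_nonneg (by omega)⟩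
    have hd1 : ν + ε ≤ d := by
      have h1 := (Int.lt_floor_add_one (ν + ε)).le
      have h2 : (d : ℝ) = (⌊ν + ε⌋ : ℝ) + 1 := by exact_mod_cast hd
      rwa [h2]
    have hd0 : 1 ≤ d := by
      have : (0 : ℝ) < d := by linarith
      exact_mod_cast this
    have hf : nuFun n k d ≤ -B := by
      have h1 := nuFun_le_sub hn1 hk1 (x := ν) (y := d) (by linarith) (by linarith)
      have h2 : ε * M ≤ (d - ν) * Real.log (n * ν / k) :=
        mul_le_mul (by linarith) hslope hM0 (by linarith)
      rw [hν0] at h1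
      linarith
    refine (unif_mono _ fun S _ h => ?_).trans ((unif_exists_degree_ge_le_exp (by omega) hm1 hmE
      hd0).trans (Real.exp_le_exp.2 hf))
    by_contra hno
    push Not at hno
    have := (maxDeg_gr_lt_iff S (by omega)).2 hno
    omega
  have hlow : unif (m n) (fun S : Finset (Edge (Fin n)) => (maxDeg (gr S) : ℤ) < ⌊ν - ε⌋) ≤
      4 * Real.exp 11 * Real.exp (-B) + δ / 2 := by
    -- If the bound is at most 1 it holds for every graph with an edge; the event is impossible,
    -- expressed as a union over the empty set.
    rcases le_or_gt ⌊ν - ε⌋ 1 with hle | hgt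
    · have h0 : unif (m n) (fun S : Finset (Edge (Fin n)) => (maxDeg (gr S) : ℤ) < ⌊ν - ε⌋) ≤
          unif (m n) (fun S : Finset (Edge (Fin n)) => ∃ i ∈ (∅ : Finset ℕ), i = S.card) :=
        unif_mono _ fun S hS h => by
          have := maxDeg_gr_pos (S := S) (by omega)
          omega
      have h1 := h0.trans (unif_exists_le _ _ _)
      rw [Finset.sum_empty] at h1
      exact h1.trans (by positivity)
    obtain ⟨d, hd⟩ : ∃ d : ℕ, (d : ℤ) = ⌊ν - ε⌋ :=
      ⟨⌊ν - ε⌋.toNat, Int.toNat_of_nonneg (by omega)⟩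
    have hd2 : 2 ≤ d := by omega
    have hdν : (d : ℝ) ≤ ν - ε := by
      have h2 : (d : ℝ) = (⌊ν - ε⌋ : ℝ) := by exact_mod_cast hd
      rw [h2]
      exact Int.floor_le _
    have hd2' : (2 : ℝ) ≤ d := by exact_mod_cast hd2
    have hf : B ≤ nuFun n k d := by
      rcases slope_or_large hn1 hk1 hkn hM0 (x := d) (by linarith) with h | h
      · have h1 := nuFun_le_sub hn1 hk1 (x := d) (y := ν) (by linarith) (by linarith)
        have h2 : ε * M ≤ (ν - d) * Real.log (n * d / k) :=
          mul_le_mul (by linarith) h hM0 (by linarith)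
        rw [hν0] at h1
        linarith
      · linarith
    obtain ⟨hd3, hk3⟩ := bounds_of_nuFun_nonneg hn1 hk1 hkn hd2 (hB0.trans hf)
    have hm0 : (0 : ℝ) < m n := by exact_mod_cast hm1
    have hratio : (d : ℝ) ^ 2 / m n ≤ η := by
      refine le_trans ?_ hsm
      rw [div_le_iff₀ hm0]
      have h1 : Real.exp (Real.log n / 2 - 1) ≤ 2 * m n := by rw [hk] at hk3; exact_mod_cast hk3
      have h2 : (1 : ℝ) ≤ Real.exp 1 * Real.exp (-(Real.log n / 2)) * (2 * m n) := by
        calc (1 : ℝ) = Real.exp 1 * Real.exp (-(Real.log n / 2)) * Real.exp (Real.log n / 2 - 1) := by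
              rw [← Real.exp_add, ← Real.exp_add, show 1 + -(Real.log n / 2) + (Real.log n / 2 - 1) = 0
                by ring, Real.exp_zero]
          _ ≤ _ := by gcongr
      calc (d : ℝ) ^ 2 ≤ (Real.log n + Real.exp 3) ^ 2 * 1 := by rw [mul_one]; gcongr
        _ ≤ (Real.log n + Real.exp 3) ^ 2 *
            (Real.exp 1 * Real.exp (-(Real.log n / 2)) * (2 * m n)) := by gcongr
        _ = _ := by ring
    have hdm : 2 * d ^ 2 ≤ m n := by
      have h1 := hratio.trans (min_le_right _ _)
      rw [div_le_iff₀ hm0] at h1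
      have : 2 * (d : ℝ) ^ 2 ≤ m n := by linarith
      exact_mod_cast this
    refine (unif_mono _ (Q := fun S => ∀ v, (S ∩ star v).card < d) fun S _ h => ?_).trans
      ((unif_all_degrees_lt_le hd2 hdm hmn).trans (add_le_add ?_ ?_))
    · exact (maxDeg_gr_lt_iff S (by omega)).1 (by omega)
    · gcongr
    · have h1 := hratio.trans (min_le_left _ _)
      rw [le_div_iff₀ (by positivity)] at h1
      linarith
  refine hsplit.trans ((add_le_add hup hlow).trans ?_)
  linarith

/-- In the sparse range the uniform random graph is outerplanar with probability bounded away
from `0`. -/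
theorem eventually_le_unif_isOuterplanar (m : ℕ → ℕ)
    (hm : ∃ C : ℝ, ∀ᶠ n : ℕ in atTop, (m n : ℝ) ≤ (n : ℝ) / 2 + C * (n : ℝ) ^ (2 / 3 : ℝ)) :
    ∃ c : ℝ, 0 < c ∧ ∀ᶠ n in atTop,
      c ≤ unif (m n) fun S : Finset (Edge (Fin n)) => IsOuterplanar (gr S) := by
  obtain ⟨C, hC⟩ := hm
  -- With this `l` the mean number of edges exceeds `m` by at least `n * h / 2`, while the standard
  -- deviation is of order `√n`, so Chebyshev's inequality leaves an error of at most `4 * h`.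
  set l : ℝ := 2 * |C| + 4 with hl
  have hl0 : 0 ≤ l := by positivity
  set c₀ : ℝ := 3 / 4 * Real.exp (-(4 * (l + 2) * ((3 + (l + 1) * (l + 2)) * (2 * l + 2) + 1)))
    with hc₀
  have hc₀0 : 0 < c₀ := by positivity
  have hh : Tendsto (fun n : ℕ => (n : ℝ) ^ (-(1 / 3) : ℝ)) atTop (𝓝 0) :=
    (tendsto_rpow_neg_atTop (by norm_num)).comp tendsto_natCast_atTop_atTop
  refine ⟨c₀ / 2, half_pos hc₀0, ?_⟩
  have h1 := (hh.const_mul ((l + 4) * (2 * l + 2))).eventually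
    (ge_mem_nhds (by rw [mul_zero]; exact one_pos))
  have h2 := (hh.const_mul 4).eventually
    (ge_mem_nhds (by rw [mul_zero]; exact half_pos hc₀0))
  filter_upwards [hC, eventually_ge_atTop 1, h1, h2] with n hmC hn1 hs h4
  have hn0 : (0 : ℝ) < n := by exact_mod_cast hn1
  set h : ℝ := (n : ℝ) ^ (-(1 / 3) : ℝ) with hdef
  have hh0 : 0 < h := Real.rpow_pos_of_pos hn0 _
  have hn3 : (n : ℝ) * h ^ 3 = 1 := by
    rw [hdef, ← Real.rpow_natCast, ← Real.rpow_mul hn0.le]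
    norm_num
    rw [Real.rpow_neg_one]
    exact mul_inv_cancel₀ hn0.ne'
  have h23 : (n : ℝ) ^ (2 / 3 : ℝ) = n * h := by
    rw [hdef]
    nth_rewrite 2 [← Real.rpow_one (n : ℝ)]
    rw [← Real.rpow_add hn0]
    norm_num
  obtain ⟨hh8, hlh, -, hh3⟩ := window_bounds hh0 hl0 hs
  set p : ℝ := (1 + l * h) * h ^ 3 with hp
  have hp0 : 0 < p := by positivity
  have hnp : (n : ℝ) * p = 1 + l * h := by rw [hp, mul_left_comm, hn3, mul_one]
  have hp1 : p ≤ 1 := by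
    have : p ≤ 2 * h ^ 3 := by rw [hp]; gcongr; linarith
    linarith
  have hprob := pr_isOuterplanar_ge (V := Fin n) hh0 hl0 (by rwa [Fintype.card_fin]) hs
  have htrans := pr_le_add_unif (E := Edge (Fin n)) hp0.le hp1
    (Q := fun S => IsOuterplanar (gr S)) (fun S T hST hT => hT.mono (gr_mono hST)) (m n)
  have hNp : (Fintype.card (Edge (Fin n)) : ℝ) * p = (n - 1) / 2 * (1 + l * h) := by
    rw [card_edge_fin, ← hnp]; ring
  -- the edge count
  have hnh : 1 ≤ (n : ℝ) * h := by
    have : h ^ 3 ≤ h * 1 := by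
      have : h ^ 2 ≤ 1 := pow_le_one₀ hh0.le (by linarith)
      calc h ^ 3 = h * h ^ 2 := by ring
        _ ≤ h * 1 := by gcongr
    calc (1 : ℝ) = n * h ^ 3 := hn3.symm
      _ ≤ n * h := by gcongr; linarith
  have hfar : pr (fun _ : Edge (Fin n) => p) (fun S => S.card < m n) ≤ 4 * h := by
    have hch := pr_card_far_le (E := Edge (Fin n)) (c := p) (t := n * h / 2) hp0.le hp1
      (by positivity)
    refine (pr_mono (fun _ => ⟨hp0.le, hp1⟩) fun S hS => ?_).trans (hch.trans ?_)
    · rw [hNp]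
      refine le_trans ?_ (neg_le_abs _)
      have k1 : (S.card : ℝ) ≤ m n := by exact_mod_cast hS.le
      have k2 : C * (n * h) ≤ |C| * (n * h) := by gcongr; exact le_abs_self C
      rw [h23] at hmC
      have k3 : (n : ℝ) * (l * h) / 2 = |C| * (n * h) + 2 * (n * h) := by rw [hl]; ring
      linarith
    · rw [hNp, div_le_iff₀ (by positivity)]
      have k1 : ((n : ℝ) - 1) / 2 * (1 + l * h) ≤ n := by
        calc ((n : ℝ) - 1) / 2 * (1 + l * h) ≤ n / 2 * 2 := by gcongr <;> linarith
          _ = n := by ring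
      calc _ ≤ (n : ℝ) := k1
        _ = n * (n * h ^ 3) := by rw [hn3, mul_one]
        _ = _ := by ring
  linarith

end Asymptotics

/-! ### From uniform graphs to uniform planar graphs -/

section Transfer

theorem gr_injective {V : Type*} : Function.Injective (gr (V := V)) := by
  intro S T h
  have key : ∀ S T : Finset (Edge V), gr S = gr T → S ⊆ T := by
    rintro S T h ⟨e, he⟩ heS
    induction e with | h x y => ?_
    have hxy : x ≠ y := by simpa using he
    have h1 : (gr S).Adj x y := ⟨hxy, heS⟩
    rw [h] at h1
    exact h1.2
  exact Finset.Subset.antisymm (key S T h) (key T S h.symm)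

theorem exists_gr_eq {V : Type*} [Fintype V] [DecidableEq V] (G : SimpleGraph V) :
    ∃ S, gr S = G := by
  classical
  refine ⟨Finset.univ.filter fun e => e.1 ∈ G.edgeSet, ?_⟩
  ext x y
  simp only [gr, Finset.mem_filter, Finset.mem_univ, true_and, mkEdge, SimpleGraph.mem_edgeSet]
  exact ⟨fun ⟨_, h⟩ => h, fun h => ⟨h.ne, h⟩⟩

theorem ncard_edgeSet_gr {V : Type*} (S : Finset (Edge V)) : (gr S).edgeSet.ncard = S.card := by
  have : (gr S).edgeSet = Subtype.val '' (S : Set (Edge V)) := by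
    ext e
    induction e with | h x y => ?_
    rw [SimpleGraph.mem_edgeSet]
    constructor
    · rintro ⟨h, hS⟩
      exact ⟨_, hS, rfl⟩
    · rintro ⟨e, he, hxy⟩
      have hne : x ≠ y := fun h => e.2 (by rw [hxy, h]; simp)
      refine ⟨hne, ?_⟩
      have : mkEdge x y hne = e := Subtype.ext hxy.symm
      rw [this]
      exact he
  rw [this, Set.ncard_image_of_injective _ Subtype.val_injective, Set.ncard_coe_finset]

theorem ncard_planarClass_inter {n m : ℕ} (hm : m ≤ Fintype.card (Edge (Fin n)))
    (Q : SimpleGraph (Fin n) → Prop) :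
    ((planarClass n m ∩ {G | Q G}).ncard : ℝ) = (Fintype.card (Edge (Fin n))).choose m *
      unif m fun S : Finset (Edge (Fin n)) => IsPlanar (gr S) ∧ Q (gr S) := by
  classical
  have h : planarClass n m ∩ {G | Q G} = gr '' ((Finset.univ.filter fun S : Finset (Edge (Fin n)) =>
      S.card = m ∧ IsPlanar (gr S) ∧ Q (gr S) : Finset _) : Set (Finset (Edge (Fin n)))) := by
    ext G
    obtain ⟨S, rfl⟩ := exists_gr_eq G
    rw [gr_injective.mem_set_image]
    simp only [planarClass, Set.mem_inter_iff, Set.mem_ofPred_eq, Finset.coe_filter,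
      Finset.mem_univ, true_and, ncard_edgeSet_gr]
    tauto
  have hpos : (0 : ℝ) < (Fintype.card (Edge (Fin n))).choose m := by
    exact_mod_cast Nat.choose_pos hm
  rw [h, Set.ncard_image_of_injective _ gr_injective, Set.ncard_coe_finset]
  unfold unif
  field_simp

/-- If a property fails with vanishing probability in the uniform random graph, and this is planar
with probability bounded away from `0`, then the property holds with high probability in the
uniform random planar graph. -/
theorem whpPlanar_of_unif {m : ℕ → ℕ} {Q : (n : ℕ) → SimpleGraph (Fin n) → Prop}
    (hm : ∀ᶠ n in atTop, m n ≤ Fintype.card (Edge (Fin n)))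
    (hpl : ∃ c : ℝ, 0 < c ∧ ∀ᶠ n in atTop,
      c ≤ unif (m n) fun S : Finset (Edge (Fin n)) => IsOuterplanar (gr S))
    (hQ : ∀ δ : ℝ, 0 < δ → ∀ᶠ n in atTop,
      unif (m n) (fun S : Finset (Edge (Fin n)) => ¬ Q n (gr S)) ≤ δ) : WhpPlanar m Q := by
  classical
  obtain ⟨c, hc, hpl⟩ := hpl
  unfold WhpPlanar
  rw [Metric.tendsto_nhds]
  intro δ hδ
  -- Conditioning on an event of probability `b ≥ c` multiplies the failure probability by at most
  -- `1 / c`.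
  filter_upwards [hm, hpl, hQ (c * (δ / 2)) (by positivity)] with n hmn hpl hbad
  set N := Fintype.card (Edge (Fin n)) with hN
  have hpos : (0 : ℝ) < N.choose (m n) := by exact_mod_cast Nat.choose_pos hmn
  set a := unif (m n) fun S : Finset (Edge (Fin n)) => IsPlanar (gr S) ∧ Q n (gr S) with ha
  set b := unif (m n) fun S : Finset (Edge (Fin n)) => IsPlanar (gr S) with hb
  have hcb : c ≤ b := hpl.trans (unif_mono _ fun S _ h => h.isPlanar)
  have hb0 : 0 < b := hc.trans_le hcb
  have hab : a ≤ b := unif_mono _ fun S _ h => h.1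
  have hba : b ≤ a + c * (δ / 2) := by
    refine le_trans ?_ (add_le_add le_rfl hbad)
    refine (unif_mono _ (Q := fun S => ∃ i ∈ (Finset.univ : Finset Bool), cond i
      (IsPlanar (gr S) ∧ Q n (gr S)) (¬ Q n (gr S))) fun S _ h => ?_).trans
      ((unif_exists_le _ _ _).trans (le_of_eq (by simp [ha])))
    by_cases h1 : Q n (gr S)
    · exact ⟨true, Finset.mem_univ _, h, h1⟩
    · exact ⟨false, Finset.mem_univ _, h1⟩
  have hS : ((planarClass n (m n)).ncard : ℝ) = N.choose (m n) * b := by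
    have := ncard_planarClass_inter hmn fun _ => True
    simp only [and_true, Set.ofPred_true, Set.inter_univ] at this
    exact this
  have hprob : uniformProb (planarClass n (m n)) {G | Q n G} = a / b := by
    unfold uniformProb
    rw [hS, ncard_planarClass_inter hmn, mul_div_mul_left _ _ hpos.ne']
  rw [hprob, Real.dist_eq, abs_sub_comm, abs_of_nonneg (by
    rw [sub_nonneg, div_le_one hb0]; exact hab), sub_lt_iff_lt_add, ← sub_lt_iff_lt_add',
    lt_div_iff₀ hb0]
  have : c * (δ / 2) < b * δ := by nlinarith
  linarith

end Transfer

end RandomPlanar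

theorem mainTheorem3 (m : ℕ → ℕ)
    (hpos : ∀ᶠ n in Filter.atTop, 1 ≤ m n)
    (hm : ∃ C : ℝ, ∀ᶠ n : ℕ in Filter.atTop,
      (m n : ℝ) ≤ (n : ℝ) / 2 + C * (n : ℝ) ^ (2 / 3 : ℝ)) :
    (∀ ε : ℝ, 0 < ε →
      RandomPlanar.WhpPlanar m fun n G =>
        ⌊RandomPlanar.nu n (2 * m n) - ε⌋ ≤ (RandomPlanar.maxDeg G : ℤ) ∧
          (RandomPlanar.maxDeg G : ℤ) ≤ ⌊RandomPlanar.nu n (2 * m n) + ε⌋) ∧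
    RandomPlanar.WhpPlanar m fun n G =>
      (RandomPlanar.maxDeg G : ℤ) = ⌊RandomPlanar.nu n (2 * m n) - 1 / 3⌋ ∨
        (RandomPlanar.maxDeg G : ℤ) = ⌊RandomPlanar.nu n (2 * m n) - 1 / 3⌋ + 1 := by
  open RandomPlanar Filter in
  have hpl := eventually_le_unif_isOuterplanar m hm
  have hmn : ∀ᶠ n in atTop, m n ≤ n := by
    obtain ⟨C, hC⟩ := hm
    have hh : Tendsto (fun n : ℕ => (n : ℝ) ^ (-(1 / 3) : ℝ)) atTop (nhds 0) :=
      (tendsto_rpow_neg_atTop (by norm_num)).comp tendsto_natCast_atTop_atTop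
    have h0 : Tendsto (fun n : ℕ => C * (n : ℝ) ^ (-(1 / 3) : ℝ)) atTop (nhds 0) := by
      simpa using hh.const_mul C
    have h1 := h0.eventually (ge_mem_nhds (show (0 : ℝ) < 1 / 2 by norm_num))
    filter_upwards [hC, h1, eventually_ge_atTop 1] with n hn hn1 hn2
    have hn0 : (0 : ℝ) < n := by exact_mod_cast hn2
    have h23 : (n : ℝ) ^ (2 / 3 : ℝ) = n * (n : ℝ) ^ (-(1 / 3) : ℝ) := by
      nth_rewrite 2 [← Real.rpow_one (n : ℝ)]
      rw [← Real.rpow_add hn0]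
      norm_num
    rw [h23] at hn
    have h2 : (n : ℝ) * (C * (n : ℝ) ^ (-(1 / 3) : ℝ)) ≤ n * (1 / 2) := by gcongr
    have : (m n : ℝ) ≤ n := by linarith
    exact_mod_cast this
  have hmE : ∀ᶠ n in atTop, m n ≤ Fintype.card (Edge (Fin n)) := by
    filter_upwards [hmn, eventually_ge_atTop 4] with n hn hn4
    have h1 : (n : ℝ) ≤ Fintype.card (Edge (Fin n)) := by
      rw [card_edge_fin]
      have : (4 : ℝ) ≤ n := by exact_mod_cast hn4
      nlinarith
    exact hn.trans (by exact_mod_cast h1)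
  refine ⟨fun ε hε => whpPlanar_of_unif hmE hpl fun δ hδ =>
    eventually_unif_maxDeg m hpos hmn hε hδ, whpPlanar_of_unif hmE hpl fun δ hδ => ?_⟩
  filter_upwards [eventually_unif_maxDeg m hpos hmn (ε := 1 / 3) (by norm_num) hδ] with n hn
  refine (unif_mono _ fun S _ h hgood => h ?_).trans hn
  -- The window has length `2 / 3 < 1`, so its two floors differ by at most 1.
  have h1 : ⌊nu n (2 * m n) + 1 / 3⌋ ≤ ⌊nu n (2 * m n) - 1 / 3⌋ + 1 := by
    rw [← Int.floor_add_one]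
    exact Int.floor_le_floor (by linarith)
  omega
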